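/- **Rate of convergence of the MLE in the CARE model.** Let $n,d,L$ be integers with $d\ge 0$, $L\ge 1$, $d+1<n$, let $p\in[0,1]$, and let $x_1,\dots,x_n\in\mathbb R^d$ be fixed covariates. Put $\tilde x_i=(e_i^\top,x_i^\top)^\top\in\mathbb R^{n+d}$, $\tilde X=[\tilde x_1,\dots,\tilde x_n]^\top$, let $\bar X\in\mathbb R^{n\times(d+1)}$ have rows $(1,x_i^\top)$, and let $$\Theta=\{\theta=(\alpha,\beta)\in\mathbb R^{n}\times\mathbb R^{d}:\bar X^\top\alpha=0\},\qquad \Sigma=\sum_{i>j}(\tilde x_i-\tilde x_j)(\tilde x_i-\tilde x_j)^\top .$$ *Model.* Let $\theta^*=(\alpha^*,\beta^*)\in\Theta$. Each pair $i>j$ is an edge of the comparison graph $\mathcal E$ independently with probability $p$ (Erdős–Rényi graph). For every edge one observes $L$ independent outcomes $y_{j,i}^{(l)}\in\{0,1\}$ with $$P(y_{j,i}^{(l)}=1)=P(i\text{ is preferred over }j)=\frac{e^{\tilde x_i^\top\theta^*}}{e^{\tilde x_i^\top\theta^*}+e^{\tilde x_j^\top\theta^*}},$$ all independent given the graph. Let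 $y_{j,i}=\frac1L\sum_{l} y_{j,i}^{(l)}$. The constrained MLE $\hat\theta=(\hat\alpha,\hat\beta)$ is the minimizer over $\Theta$ of $$\mathcal L(\theta)=\sum_{(i,j)\in\mathcal E,\ i>j}\Big\{-y_{j,i}(\tilde x_i^\top\theta-\tilde x_j^\top\theta)+\log\big(1+e^{\tilde x_i^\top\theta-\tilde x_j^\top\theta}\big)\Big\}.$$ Let $\kappa_1=\exp\big(\max_{i,j}(\tilde x_i^\top\theta^*-\tilde x_j^\top\theta^*)\big)$. *Claim.* For all constants $c_0,c_1,c_2,c_4,c_5,C_1,K>0$ there are constants $c_p,C,C'>0$, depending only on these, such that the following holds for all $n,d,L,p,(x_i),\theta^*$ as above. Suppose 1. $np>c_p\log n$, $(d+1)\log n\le C_1\,np$ and $L\le c_4n^{c_5}$; 2. $\|x_i\|_2\le\sqrt{(d+1)/n}$ for all $i$; 3. (incoherence) every row of $\bar X(\bar X^\top\bar X)^{-1}\bar X^\top$ has Euclidean norm at most $c_0\sqrt{(d+1)/n}$; 4. (eigenvalues) $z^\top\Sigma z\ge c_2n\|z\|_2^2$ for all $z\in\Theta$, and the operator norm satisfies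 $\|\Sigma\|\le c_1n$; 5. $\kappa_1^2\sqrt{(d+1)\log n/(npL)}\le K$. Then, with probability at least $1-C'n^{-6}$, the constrained MLE $\hat\theta$ exists, is unique, and satisfies $$\|\hat\alpha-\alpha^*\|_\infty\le C\kappa_1^2\sqrt{\frac{(d+1)\log n}{npL}},\qquad \|\hat\beta-\beta^*\|_2\le C\kappa_1\sqrt{\frac{\log n}{pL}},$$ $$\|\tilde X\hat\theta-\tilde X\theta^*\|_\infty\le C\kappa_1^2\sqrt{\frac{(d+1)\log n}{npL}},\qquad \frac{\|e^{\tilde X\hat\theta}-e^{\tilde X\theta^*}\|_\infty}{\|e^{\tilde X\theta^*}\|_\infty}\le C\kappa_1^2\sqrt{\frac{(d+1)\log n}{npL}},$$ where the exponential of a vector is taken entrywise. -/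

import Mathlib

open MeasureTheory ProbabilityTheory

noncomputable section

namespace CARE

/-- The unordered pairs of distinct items, each represented as `(i, j)` with `i > j`. -/
abbrev Pair (n : ℕ) : Type := {q : Fin n × Fin n // q.2 < q.1}

/-- The larger item `i` of the pair `(i, j)`, `i > j`. -/
abbrev Pair.hi {n : ℕ} (q : Pair n) : Fin n := q.1.1

/-- The smaller item `j` of the pair `(i, j)`, `i > j`. -/
abbrev Pair.lo {n : ℕ} (q : Pair n) : Fin n := q.1.2

/-- Parameter vectors `θ = (α, β) ∈ ℝ^(n+d)`, with the Euclidean norm. -/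
abbrev Param (n d : ℕ) : Type := EuclideanSpace ℝ (Fin n ⊕ Fin d)

variable {n d : ℕ}

/-- The first `n` coordinates of `θ`. As an element of `Fin n → ℝ` its norm is the sup norm. -/
def alpha (θ : Param n d) : Fin n → ℝ := fun i => θ (Sum.inl i)

/-- The last `d` coordinates of `θ`, with the Euclidean norm. -/
def beta (θ : Param n d) : EuclideanSpace ℝ (Fin d) := WithLp.toLp 2 fun k => θ (Sum.inr k)

/-- The extended covariate `x̃ᵢ = (eᵢ, xᵢ) ∈ ℝ^(n+d)`. -/
def xTilde (x : Fin n → EuclideanSpace ℝ (Fin d)) (i : Fin n) : Param n d :=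
  WithLp.toLp 2 (Sum.elim (Pi.single i (1 : ℝ)) fun k => x i k)

/-- The vector `X̃ θ` of the overall scores `x̃ᵢᵀ θ = αᵢ + xᵢᵀ β`; its norm is the sup norm. -/
def score (x : Fin n → EuclideanSpace ℝ (Fin d)) (θ : Param n d) : Fin n → ℝ :=
  fun i => inner ℝ (xTilde x i) θ

/-- The vector `e^{X̃ θ}`, entrywise; its norm is the sup norm. -/
def expScore (x : Fin n → EuclideanSpace ℝ (Fin d)) (θ : Param n d) : Fin n → ℝ :=
  fun i => Real.exp (score x θ i)

/-- The `n × (d+1)` matrix `X̄` with rows `(1, xᵢ)`. -/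
def xBar (x : Fin n → EuclideanSpace ℝ (Fin d)) : Matrix (Fin n) (Unit ⊕ Fin d) ℝ :=
  Matrix.of fun i => Sum.elim (fun _ => (1 : ℝ)) fun k => x i k

/-- The constrained parameter space `Θ = {(α, β) : X̄ᵀ α = 0}`. -/
def Theta (x : Fin n → EuclideanSpace ℝ (Fin d)) : Set (Param n d) :=
  {θ | Matrix.mulVec (xBar x).transpose (alpha θ) = 0}

/-- The projection matrix `X̄ (X̄ᵀ X̄)⁻¹ X̄ᵀ`. -/
def projXBar (x : Fin n → EuclideanSpace ℝ (Fin d)) : Matrix (Fin n) (Fin n) ℝ :=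
  xBar x * ((xBar x).transpose * xBar x)⁻¹ * (xBar x).transpose

/-- The two-to-infinity norm: the largest Euclidean norm of a row. -/
def twoInftyNorm (A : Matrix (Fin n) (Fin n) ℝ) : ℝ :=
  ⨆ i : Fin n, ‖(WithLp.toLp 2 (A i) : EuclideanSpace ℝ (Fin n))‖

/-- `Σ = ∑_{i>j} (x̃ᵢ - x̃ⱼ)(x̃ᵢ - x̃ⱼ)ᵀ`. -/
def covMatrix (x : Fin n → EuclideanSpace ℝ (Fin d)) :
    Matrix (Fin n ⊕ Fin d) (Fin n ⊕ Fin d) ℝ :=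
  ∑ q : Pair n, Matrix.vecMulVec (WithLp.ofLp (xTilde x q.hi - xTilde x q.lo))
    (WithLp.ofLp (xTilde x q.hi - xTilde x q.lo))

/-- The operator norm of a square matrix, with respect to the Euclidean norm. -/
def opNorm (A : Matrix (Fin n ⊕ Fin d) (Fin n ⊕ Fin d) ℝ) : ℝ :=
  ‖Matrix.toEuclideanCLM (𝕜 := ℝ) A‖

/-- The smallest eigenvalue of `A` on `Θ`: the largest `μ` with `zᵀ A z ≥ μ ‖z‖²` for `z ∈ Θ`. -/
def lambdaMinPerp (x : Fin n → EuclideanSpace ℝ (Fin d))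
    (A : Matrix (Fin n ⊕ Fin d) (Fin n ⊕ Fin d) ℝ) : ℝ :=
  sSup {μ : ℝ | ∀ z ∈ Theta x, μ * ‖z‖ ^ 2 ≤ dotProduct (WithLp.ofLp z) (A.mulVec (WithLp.ofLp z))}

/-- The condition number `κ₁ = maxᵢ wᵢ / minᵢ wᵢ` with `wᵢ = exp(αᵢ + xᵢᵀ β)`. -/
def kappa (x : Fin n → EuclideanSpace ℝ (Fin d)) (θ : Param n d) : ℝ :=
  (⨆ i : Fin n, expScore x θ i) / (⨅ i : Fin n, expScore x θ i)

/-- The CARE model with true parameter `θ`, edge probability `p` and `L` comparisons per edge.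
`edge q` says whether the pair `q = (i, j)`, `i > j`, is an edge of the comparison graph, and
`y q l` is the outcome of its `l`-th comparison, `true` if item `i` is preferred over item `j`.
All edge indicators and outcomes are independent; outcomes of pairs that are not
edges are latent: the likelihood does not use them. -/
structure IsModel {Ω : Type*} [MeasurableSpace Ω] (μ : Measure Ω) {L : ℕ} (p : ℝ)
    (x : Fin n → EuclideanSpace ℝ (Fin d)) (θ : Param n d)
    (edge : Pair n → Ω → Bool) (y : Pair n → Fin L → Ω → Bool) : Prop where
  measurable_edge : ∀ q, Measurable (edge q)
  measurable_y : ∀ q l, Measurable (y q l)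
  prob_edge : ∀ q, μ.real {ω | edge q ω = true} = p
  prob_y : ∀ q l, μ.real {ω | y q l ω = true} =
    expScore x θ q.hi / (expScore x θ q.hi + expScore x θ q.lo)
  indep : iIndepFun
    (Sum.elim edge fun r : Pair n × Fin L => y r.1 r.2 : Pair n ⊕ (Pair n × Fin L) → Ω → Bool) μ

/-- The observed frequency, among the `L` comparisons of a pair `(i, j)`, `i > j`, with which item
`i` is preferred over item `j`. -/
def freq {L : ℕ} (y : Fin L → Bool) : ℝ := (∑ l, if y l then (1 : ℝ) else 0) / L

/-- The negative log-likelihood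
`∑_{(i,j) ∈ E, i>j} (-y_{j,i} (x̃ᵢᵀθ - x̃ⱼᵀθ) + log (1 + exp (x̃ᵢᵀθ - x̃ⱼᵀθ)))`. -/
def loss {L : ℕ} (x : Fin n → EuclideanSpace ℝ (Fin d)) (edge : Pair n → Bool)
    (y : Pair n → Fin L → Bool) (θ : Param n d) : ℝ :=
  ∑ q : Pair n, if edge q then
      -freq (y q) * (score x θ q.hi - score x θ q.lo)
        + Real.log (1 + Real.exp (score x θ q.hi - score x θ q.lo))
    else 0

/-- `θ` is a constrained maximum likelihood estimate: a minimizer of the loss over `Θ`. -/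
def IsMLE {L : ℕ} (x : Fin n → EuclideanSpace ℝ (Fin d)) (edge : Pair n → Bool)
    (y : Pair n → Fin L → Bool) (θ : Param n d) : Prop :=
  θ ∈ Theta x ∧ IsMinOn (loss x edge y) (Theta x) θ

/-- `√((d+1) log n / (n p L))`. -/
def rate (n d L : ℕ) (p : ℝ) : ℝ := Real.sqrt ((d + 1) * Real.log n / (n * p * L))

end CARE

end

/-!
The covariates enter the likelihood only through the scores `s = X̃ θ`. By the eigenvalue condition
the map from `Θ` to score vectors modulo constants is injective, and a dimension count makes it
bijective (`exists_score_eq`). The constrained MLE is therefore the MLE of the plain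
Bradley–Terry–Luce model in the score coordinates, and it suffices to bound the centred score error
`δ` in `ℓ²` and in the sup norm; the eigenvalue condition and `‖x i‖ ≤ √((d + 1) / n)` turn these
bounds into bounds for `α` and `β` (`error_bounds`). With `ρ = √(log n / (n p L))` one needs
`‖δ‖₂ ≲ √n κ ρ` and `‖δ‖_∞ ≲ κ² ρ`.

The score equations describe a network: along each edge `(i, j)` of the comparison graph flows
`σ(tᵢ - tⱼ + δᵢ - δⱼ) - σ(tᵢ - tⱼ)` plus the noise of that edge, and the flows balance at each node.
The sigmoid `σ` has slope at least `1 / (12 κ)` near the true score differences; replacing it by a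
linear function farther away gives a globally strongly monotone network (`response`), for which
solutions exist by the contraction principle (`exists_balance_eq_zero`) as soon as the graph has a
spectral gap. Solutions with `|δᵢ - δⱼ| ≤ 1` solve the true score equations, and by convexity of the
loss and the spectral gap they give the unique MLE (`isMLE_unique`).

The gap of order `n p` comes from the edge expansion of the Erdős–Rényi graph through Cheeger's
inequality (`cheeger`). Monotonicity then gives the `ℓ²` bound. The sup-norm bound has two regimes.
* If `κ` is at most of the order `n p`, consider the node `i` at which `|δ|` is maximal, and the
  solution of the network without `i` (`leaveOneOut`). It is small in `ℓ²`, hence small at most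
  nodes, and it is independent of the edges at `i`, hence small at most neighbours of `i`. Strong
  monotonicity shows that it is close to `δ` in `ℓ²`, so that `|δ|` is at most half of its maximum
  at a fixed proportion of the neighbours of `i`. Now the flow out of `i` is at least of the order
  `n p |δᵢ| / κ`, and it is balanced by noise of the order `n p ρ` (`sup_bound_of_leaveOneOut`).
* Otherwise `log n ≲ n p ≲ κ`. The level sets of `δ` grow geometrically by edge expansion, which
  bounds the oscillation of `δ` by a multiple of `κ ρ log n` (`oscillation_le_of_expansion`), and
  `log n` is absorbed by the second factor `κ`.

The required properties of the graph and of the noise are collected in `IsRegular`; they fail with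
probability at most `8 n⁻⁶` by the Chernoff and Hoeffding bounds
(`IsModel.measure_not_isRegular_le`).
-/

namespace CARE

/-! ### Weighted graphs: cuts, energy and the Cheeger inequality -/

section Network

variable {V : Type*} [Fintype V]

/-- The Dirichlet energy `½ ∑ᵢ ∑ⱼ aᵢⱼ (zᵢ - zⱼ)²` of `z` for the edge weights `a`. -/
noncomputable def energy (a : V → V → ℝ) (z : V → ℝ) : ℝ :=
  (∑ i, ∑ j, a i j * (z i - z j) ^ 2) / 2

/-- The total weight of the ordered pairs leading from `S` to its complement. -/
def cutWeight [DecidableEq V] (a : V → V → ℝ) (S : Finset V) : ℝ := ∑ i ∈ S, ∑ j ∈ Sᶜ, a i j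

lemma sum_mul_sum_antisymm {a F : V → V → ℝ} (ha : ∀ i j, a i j = a j i)
    (hF : ∀ i j, F i j = -F j i) (z : V → ℝ) :
    ∑ i, z i * ∑ j, a i j * F i j = (∑ i, ∑ j, a i j * F i j * (z i - z j)) / 2 := by
  have h1 : ∑ i, z i * ∑ j, a i j * F i j = ∑ i, ∑ j, a i j * F i j * z i := by
    refine Finset.sum_congr rfl fun i _ => ?_
    rw [Finset.mul_sum]
    exact Finset.sum_congr rfl fun j _ => by ring
  have h2 : ∑ i, ∑ j, a i j * F i j * z i = -∑ i, ∑ j, a i j * F i j * z j := by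
    rw [Finset.sum_comm, ← Finset.sum_neg_distrib]
    refine Finset.sum_congr rfl fun i _ => ?_
    rw [← Finset.sum_neg_distrib]
    refine Finset.sum_congr rfl fun j _ => ?_
    rw [ha j i, hF j i]; ring
  have h3 : ∑ i, ∑ j, a i j * F i j * (z i - z j)
      = ∑ i, ∑ j, a i j * F i j * z i - ∑ i, ∑ j, a i j * F i j * z j := by
    simp only [mul_sub, Finset.sum_sub_distrib]
  rw [h3, h1]; linarith

lemma sum_antisymm_eq_cut [DecidableEq V] {a F : V → V → ℝ} (ha : ∀ i j, a i j = a j i)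
    (hF : ∀ i j, F i j = -F j i) (S : Finset V) :
    ∑ i ∈ S, ∑ j, a i j * F i j = ∑ i ∈ S, ∑ j ∈ Sᶜ, a i j * F i j := by
  have h0 : ∑ i ∈ S, ∑ j ∈ S, a i j * F i j = 0 := by
    have : ∑ i ∈ S, ∑ j ∈ S, a i j * F i j = -∑ i ∈ S, ∑ j ∈ S, a i j * F i j := by
      conv_lhs => rw [Finset.sum_comm]
      rw [← Finset.sum_neg_distrib]
      refine Finset.sum_congr rfl fun i _ => ?_
      rw [← Finset.sum_neg_distrib]
      refine Finset.sum_congr rfl fun j _ => ?_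
      rw [ha j i, hF j i]; ring
    linarith
  rw [← zero_add (∑ i ∈ S, ∑ j ∈ Sᶜ, a i j * F i j), ← h0, ← Finset.sum_add_distrib]
  exact Finset.sum_congr rfl fun i _ => (Finset.sum_add_sum_compl S _).symm

lemma cutWeight_eq [DecidableEq V] {a : V → V → ℝ} (ha : ∀ i j, a i j = a j i) (S : Finset V) :
    ∑ i, ∑ j, a i j * |(if i ∈ S then (1 : ℝ) else 0) - if j ∈ S then 1 else 0|
      = 2 * cutWeight a S := by
  have key : ∀ i j, a i j * |(if i ∈ S then (1 : ℝ) else 0) - if j ∈ S then 1 else 0|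
      = (if i ∈ S then (if j ∈ Sᶜ then a i j else 0) else 0)
        + (if j ∈ S then (if i ∈ Sᶜ then a j i else 0) else 0) := by
    intro i j
    by_cases hi : i ∈ S <;> by_cases hj : j ∈ S <;> simp [hi, hj, ha j i]
  have h1 : ∑ i, ∑ j, (if i ∈ S then (if j ∈ Sᶜ then a i j else 0) else 0) = cutWeight a S := by
    have e1 : ∀ i, ∑ j, (if i ∈ S then (if j ∈ Sᶜ then a i j else 0) else 0)
        = if i ∈ S then ∑ j ∈ Sᶜ, a i j else 0 := fun i => by
      by_cases hi : i ∈ S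
      · simp only [hi, if_true, Finset.sum_ite_mem, Finset.univ_inter]
      · simp [hi]
    simp only [e1, Finset.sum_ite_mem, Finset.univ_inter, cutWeight]
  simp only [key, Finset.sum_add_distrib]
  rw [h1, Finset.sum_comm, h1]; ring

/-- Discrete co-area inequality: an isoperimetric lower bound on the cuts of small sets gives an
`ℓ¹` Sobolev inequality for functions of small support. The induction on the size of the support
subtracts from `f` its smallest nonzero value on the support. -/
lemma coarea [DecidableEq V] {a : V → V → ℝ} {h : ℝ} (ha : ∀ i j, a i j = a j i)
    (hcut : ∀ S : Finset V, 2 * S.card ≤ Fintype.card V → h * S.card ≤ cutWeight a S) :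
    ∀ (k : ℕ) (f : V → ℝ), (∀ i, 0 ≤ f i) → (Finset.univ.filter fun i => f i ≠ 0).card = k →
      2 * k ≤ Fintype.card V → h * ∑ i, f i ≤ (∑ i, ∑ j, a i j * |f i - f j|) / 2 := by
  intro k
  induction k using Nat.strong_induction_on with
  | _ k ih =>
    intro f hf hk hk2
    set S := Finset.univ.filter fun i => f i ≠ 0 with hS
    have hmem : ∀ i, i ∈ S ↔ f i ≠ 0 := by simp [hS]
    rcases S.eq_empty_or_nonempty with h0 | hne
    · have : ∀ i, f i = 0 := fun i => by
        by_contra hi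
        simpa [h0] using (hmem i).2 hi
      simp [this]
    · obtain ⟨i₀, hi₀, hmin⟩ := S.exists_min_image f hne
      set c := f i₀ with hc
      have hcpos : 0 < c := lt_of_le_of_ne (hf i₀) (Ne.symm ((hmem i₀).1 hi₀))
      set g : V → ℝ := fun i => f i - c * if i ∈ S then 1 else 0 with hg
      have hg0 : ∀ i, 0 ≤ g i := by
        intro i
        by_cases hi : i ∈ S
        · simpa [hg, hi] using hmin i hi
        · simpa [hg, hi] using hf i
      have hlt : (Finset.univ.filter fun i => g i ≠ 0).card < k := by
        rw [← hk]
        refine Finset.card_lt_card ⟨fun i hi => ?_, fun hsub => ?_⟩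
        · by_contra hiS
          have : f i = 0 := by by_contra h'; exact hiS ((hmem i).2 h')
          simp [hg, hiS, this] at hi
        · have := hsub hi₀
          simp [hg, hi₀, hc] at this
      have IH := ih _ hlt g hg0 rfl (by omega)
      have hsplit : ∀ i j, a i j * |f i - f j| = a i j * |g i - g j|
          + c * (a i j * |(if i ∈ S then (1 : ℝ) else 0) - if j ∈ S then 1 else 0|) := by
        intro i j
        have hz : ∀ i, i ∉ S → f i = 0 := fun i hi => by
          by_contra h'; exact hi ((hmem i).2 h')
        by_cases hi : i ∈ S <;> by_cases hj : j ∈ S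
        · simp [hg, hi, hj]
        · have h1 := hmin i hi
          have h2 := hz j hj
          simp only [hg, hi, hj, h2, if_true, if_false]
          rw [abs_of_nonneg (by linarith [hf i]), abs_of_nonneg (by linarith)]
          norm_num; ring
        · have h1 := hmin j hj
          have h2 := hz i hi
          simp only [hg, hi, hj, h2, if_true, if_false]
          rw [abs_of_nonpos (by linarith [hf j]), abs_of_nonpos (by linarith)]
          norm_num; ring
        · simp [hg, hi, hj]
      have hsum : ∑ i, f i = ∑ i, g i + c * S.card := by
        simp only [hg, Finset.sum_sub_distrib, ← Finset.mul_sum]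
        simp
      simp only [hsplit, Finset.sum_add_distrib, ← Finset.mul_sum]
      rw [cutWeight_eq ha, hsum]
      have := mul_le_mul_of_nonneg_left (hcut S (by omega)) hcpos.le
      linarith

lemma exists_median [DecidableEq V] [Nonempty V] (z : V → ℝ) :
    ∃ c : ℝ, 2 * (Finset.univ.filter fun i => c < z i).card ≤ Fintype.card V ∧
      2 * (Finset.univ.filter fun i => z i < c).card ≤ Fintype.card V := by
  set T := Finset.univ.filter fun k : V =>
    2 * (Finset.univ.filter fun i => z k < z i).card ≤ Fintype.card V with hT
  have hne : T.Nonempty := by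
    obtain ⟨k, -, hk⟩ := Finset.univ.exists_max_image z Finset.univ_nonempty
    refine ⟨k, ?_⟩
    have : (Finset.univ.filter fun i => z k < z i) = ∅ := by
      ext i; simpa using hk i (Finset.mem_univ _)
    simp [hT, this]
  obtain ⟨k, hk, hmin⟩ := T.exists_min_image z hne
  refine ⟨z k, by simpa [hT] using hk, ?_⟩
  by_contra! hcon
  set B := Finset.univ.filter fun i => z i < z k with hB
  have hBne : B.Nonempty := by
    rw [← Finset.card_pos]; omega
  obtain ⟨l, hl, hmax⟩ := B.exists_max_image z hBne
  have hlk : z l < z k := by simpa [hB] using hl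
  have hsub : (Finset.univ.filter fun i => z l < z i) ⊆ Bᶜ := by
    intro i hi
    rw [Finset.mem_compl]
    intro hiB
    have := hmax i hiB
    simp at hi
    linarith
  have hcard := Finset.card_le_card hsub
  rw [Finset.card_compl] at hcard
  have : l ∈ T := by
    simp only [hT, Finset.mem_filter, Finset.mem_univ, true_and]
    omega
  linarith [hmin l this]

/-- Cheeger inequality for functions supported on at most half of the vertices. -/
lemma cheeger_of_support [DecidableEq V] {a : V → V → ℝ} {h D : ℝ} (ha : ∀ i j, a i j = a j i)
    (ha0 : ∀ i j, 0 ≤ a i j) (hh : 0 ≤ h) (hD : 0 < D) (hdeg : ∀ i, ∑ j, a i j ≤ D)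
    (hcut : ∀ S : Finset V, 2 * S.card ≤ Fintype.card V → h * S.card ≤ cutWeight a S)
    (u : V → ℝ)
    (hsupp : 2 * (Finset.univ.filter fun i => u i ≠ 0).card ≤ Fintype.card V) :
    h ^ 2 / (2 * D) * ∑ i, u i ^ 2 ≤ energy a u := by
  have h1 := coarea ha hcut _ (fun i => u i ^ 2) (fun i => sq_nonneg _) rfl (by simpa using hsupp)
  set Q := ∑ i, u i ^ 2 with hQ
  have hQ0 : 0 ≤ Q := Finset.sum_nonneg fun i _ => sq_nonneg _
  have hE0 : 0 ≤ energy a u := by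
    unfold energy
    have := Finset.sum_nonneg fun i (_ : i ∈ Finset.univ) => Finset.sum_nonneg
      fun j (_ : j ∈ Finset.univ) => mul_nonneg (ha0 i j) (sq_nonneg (u i - u j))
    linarith
  have hplus : ∑ i, ∑ j, a i j * (u i + u j) ^ 2 ≤ 4 * D * Q := by
    have e1 : ∑ i, ∑ j, a i j * u i ^ 2 ≤ D * Q := by
      rw [hQ, Finset.mul_sum]
      refine Finset.sum_le_sum fun i _ => ?_
      rw [← Finset.sum_mul]
      exact mul_le_mul_of_nonneg_right (hdeg i) (sq_nonneg _)
    have e2 : ∑ i, ∑ j, a i j * u j ^ 2 = ∑ i, ∑ j, a i j * u i ^ 2 := by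
      rw [Finset.sum_comm]
      exact Finset.sum_congr rfl fun i _ => Finset.sum_congr rfl fun j _ => by rw [ha]
    calc ∑ i, ∑ j, a i j * (u i + u j) ^ 2
        ≤ ∑ i, ∑ j, (2 * (a i j * u i ^ 2) + 2 * (a i j * u j ^ 2)) := by
          refine Finset.sum_le_sum fun i _ => Finset.sum_le_sum fun j _ => ?_
          nlinarith [mul_nonneg (ha0 i j) (sq_nonneg (u i - u j))]
      _ = 2 * ∑ i, ∑ j, a i j * u i ^ 2 + 2 * ∑ i, ∑ j, a i j * u j ^ 2 := by
          simp only [Finset.sum_add_distrib, Finset.mul_sum]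
      _ ≤ 4 * D * Q := by rw [e2]; linarith
  have hCS : (∑ i, ∑ j, a i j * |u i ^ 2 - u j ^ 2|) ^ 2
      ≤ (∑ i, ∑ j, a i j * (u i - u j) ^ 2) * ∑ i, ∑ j, a i j * (u i + u j) ^ 2 := by
    simp only [← Finset.sum_product']
    refine Finset.sum_sq_le_sum_mul_sum_of_sq_le_mul _ (fun x _ => ?_) (fun x _ => ?_) fun x _ => ?_
    · exact mul_nonneg (ha0 _ _) (sq_nonneg _)
    · exact mul_nonneg (ha0 _ _) (sq_nonneg _)
    · rw [mul_pow, sq_abs]; exact le_of_eq (by ring)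
  set A := ∑ i, ∑ j, a i j * |u i ^ 2 - u j ^ 2| with hA
  have hEe : ∑ i, ∑ j, a i j * (u i - u j) ^ 2 = 2 * energy a u := by unfold energy; ring
  rw [hEe] at hCS
  have h2 : (2 * (h * Q)) ^ 2 ≤ A ^ 2 :=
    pow_le_pow_left₀ (by positivity) (by linarith) 2
  have h3 : (2 * (h * Q)) ^ 2 ≤ 2 * energy a u * (4 * D * Q) :=
    h2.trans (hCS.trans (mul_le_mul_of_nonneg_left hplus (by linarith)))
  rcases hQ0.eq_or_lt with hz | hpos
  · rw [← hz]; simpa using hE0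
  · have h4 : h ^ 2 * Q ≤ energy a u * (2 * D) := by
      by_contra! hlt
      nlinarith
    rw [div_mul_eq_mul_div, div_le_iff₀ (by positivity)]
    exact h4

/-- Cheeger inequality: edge expansion `h` and maximal degree `D` give the spectral gap
`h² / (2 D)`. The function is split at a median into two parts of small support. -/
lemma cheeger [DecidableEq V] {a : V → V → ℝ} {h D : ℝ} (ha : ∀ i j, a i j = a j i)
    (ha0 : ∀ i j, 0 ≤ a i j) (hh : 0 ≤ h) (hD : 0 < D) (hdeg : ∀ i, ∑ j, a i j ≤ D)
    (hcut : ∀ S : Finset V, 2 * S.card ≤ Fintype.card V → h * S.card ≤ cutWeight a S)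
    (z : V → ℝ) (hz : ∑ i, z i = 0) :
    h ^ 2 / (2 * D) * ∑ i, z i ^ 2 ≤ energy a z := by
  rcases isEmpty_or_nonempty V with hV | hV
  · simp [energy]
  obtain ⟨c, hc1, hc2⟩ := exists_median z
  have hp := cheeger_of_support ha ha0 hh hD hdeg hcut (fun i => max (z i - c) 0)
    (by
      refine le_trans (Nat.mul_le_mul_left 2 (Finset.card_le_card ?_)) hc1
      intro i; simp only [Finset.mem_filter, Finset.mem_univ, true_and]
      intro hi; by_contra hle; exact hi (max_eq_right (by linarith)))
  have hn := cheeger_of_support ha ha0 hh hD hdeg hcut (fun i => max (c - z i) 0)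
    (by
      refine le_trans (Nat.mul_le_mul_left 2 (Finset.card_le_card ?_)) hc2
      intro i; simp only [Finset.mem_filter, Finset.mem_univ, true_and]
      intro hi; by_contra hle; exact hi (max_eq_right (by linarith)))
  have hE : energy a (fun i => max (z i - c) 0) + energy a (fun i => max (c - z i) 0)
      ≤ energy a z := by
    unfold energy
    rw [← add_div, ← Finset.sum_add_distrib]
    refine div_le_div_of_nonneg_right (Finset.sum_le_sum fun i _ => ?_) (by norm_num)
    rw [← Finset.sum_add_distrib]
    refine Finset.sum_le_sum fun j _ => ?_
    rw [← mul_add]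
    refine mul_le_mul_of_nonneg_left ?_ (ha0 i j)
    beta_reduce
    rcases le_total (z i) c with h1 | h1 <;> rcases le_total (z j) c with h2 | h2
    · rw [max_eq_right (by linarith), max_eq_right (by linarith), max_eq_left (by linarith),
        max_eq_left (by linarith)]; nlinarith
    · rw [max_eq_right (by linarith), max_eq_left (by linarith), max_eq_left (by linarith),
        max_eq_right (by linarith)]; nlinarith
    · rw [max_eq_left (by linarith), max_eq_right (by linarith), max_eq_right (by linarith),
        max_eq_left (by linarith)]; nlinarith
    · rw [max_eq_left (by linarith), max_eq_left (by linarith), max_eq_right (by linarith),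
        max_eq_right (by linarith)]; nlinarith
  have hS : ∑ i, z i ^ 2 ≤ ∑ i, max (z i - c) 0 ^ 2 + ∑ i, max (c - z i) 0 ^ 2 := by
    have e1 : ∀ i, max (z i - c) 0 ^ 2 + max (c - z i) 0 ^ 2 = z i ^ 2 - 2 * c * z i + c ^ 2 := by
      intro i
      rcases le_total (z i) c with h1 | h1
      · rw [max_eq_right (by linarith), max_eq_left (by linarith)]; ring
      · rw [max_eq_left (by linarith), max_eq_right (by linarith)]; ring
    rw [← Finset.sum_add_distrib, Finset.sum_congr rfl fun i _ => e1 i, Finset.sum_add_distrib,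
      Finset.sum_sub_distrib, ← Finset.mul_sum, hz]
    have : 0 ≤ ∑ _i : V, c ^ 2 := Finset.sum_nonneg fun i _ => sq_nonneg _
    linarith
  have := mul_le_mul_of_nonneg_left hS (show 0 ≤ h ^ 2 / (2 * D) by positivity)
  linarith

/-- For functions that vanish at the vertex `i`, deleting this vertex costs at most `∑ zⱼ²` of the
energy, hence at most `1` of a spectral gap. -/
lemma energy_delete_vertex [DecidableEq V] {a : V → V → ℝ}
    (ha1 : ∀ i j, a i j ≤ 1) (i : V) (z : V → ℝ) (hzi : z i = 0) :
    energy a z ≤ energy (fun j k => if j = i ∨ k = i then 0 else a j k) z + ∑ j, z j ^ 2 := by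
  have key : ∀ j k, a j k * (z j - z k) ^ 2
      ≤ (if j = i ∨ k = i then 0 else a j k) * (z j - z k) ^ 2
        + ((if j = i then z k ^ 2 else 0) + if k = i then z j ^ 2 else 0) := by
    intro j k
    by_cases hj : j = i <;> by_cases hk : k = i
    · subst hj; subst hk; simp [hzi]
    · subst hj; simp only [hzi, hk]; simp
      nlinarith [ha1 j k, sq_nonneg (z k)]
    · subst hk; simp only [hzi, hj]; simp
      nlinarith [ha1 j k, sq_nonneg (z j)]
    · simp [hj, hk]
  have h2 := Finset.sum_le_sum fun j (_ : j ∈ Finset.univ) =>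
    Finset.sum_le_sum fun k (_ : k ∈ Finset.univ) => key j k
  simp only [Finset.sum_add_distrib] at h2
  have e1 : ∑ j, ∑ k, (if j = i then z k ^ 2 else 0) = ∑ k, z k ^ 2 := by
    rw [Finset.sum_comm]; simp
  have e2 : ∑ j, ∑ k, (if k = i then z j ^ 2 else 0) = ∑ k, z k ^ 2 := by simp
  rw [e1, e2] at h2
  unfold energy
  linarith

end Network

/-! ### Strongly monotone networks -/

/-- A strongly monotone Lipschitz operator on a Hilbert space has a zero: `x ↦ x - η T x` is a
contraction for a suitable step size `η`. -/
lemma exists_zero_of_strongly_monotone {E : Type*} [NormedAddCommGroup E] [InnerProductSpace ℝ E]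
    [CompleteSpace E] (T : E → E) {μ Λ : ℝ} (hμ : 0 < μ)
    (hmono : ∀ x y, μ * ‖x - y‖ ^ 2 ≤ inner ℝ (T x - T y) (x - y))
    (hlip : ∀ x y, ‖T x - T y‖ ^ 2 ≤ Λ * ‖x - y‖ ^ 2) : ∃ x, T x = 0 := by
  set M := max Λ (μ ^ 2) with hM
  have hM0 : 0 < M := lt_of_lt_of_le (by positivity) (le_max_right _ _)
  set η := μ / M with hη
  have hη0 : 0 < η := div_pos hμ hM0
  set q := 1 - μ ^ 2 / M with hq
  have hq0 : 0 ≤ q := by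
    have : μ ^ 2 / M ≤ 1 := (div_le_one hM0).2 (le_max_right _ _)
    linarith
  have hq1 : q < 1 := by
    have : 0 < μ ^ 2 / M := by positivity
    linarith
  have hstep : ∀ x y, ‖(x - η • T x) - (y - η • T y)‖ ^ 2 ≤ q * ‖x - y‖ ^ 2 := by
    intro x y
    have e : (x - η • T x) - (y - η • T y) = (x - y) - η • (T x - T y) := by
      rw [smul_sub]; abel
    rw [e, norm_sub_sq_real, inner_smul_right, norm_smul, mul_pow, Real.norm_eq_abs, sq_abs,
      real_inner_comm]
    have h1 := mul_le_mul_of_nonneg_left (hmono x y) hη0.le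
    have h2 := mul_le_mul_of_nonneg_left (hlip x y) (sq_nonneg η)
    have h3 : η ^ 2 * (Λ * ‖x - y‖ ^ 2) ≤ η ^ 2 * (M * ‖x - y‖ ^ 2) := by
      gcongr; exact le_max_left _ _
    have h4 : η ^ 2 * M = η * μ := by rw [hη]; field_simp
    have h5 : q = 1 - η * μ := by rw [hq, hη]; ring
    rw [h5]
    nlinarith
  have hcoe : ((Real.sqrt q).toNNReal : ℝ) = Real.sqrt q :=
    Real.coe_toNNReal _ (Real.sqrt_nonneg q)
  have hc : ContractingWith (Real.sqrt q).toNNReal fun x => x - η • T x := by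
    refine ⟨?_, LipschitzWith.of_dist_le_mul fun x y => ?_⟩
    · rw [← NNReal.coe_lt_coe, hcoe]
      exact (Real.sqrt_lt' one_pos).2 (by simpa using hq1)
    · rw [dist_eq_norm, dist_eq_norm, hcoe]
      refine le_of_sq_le_sq ?_ (by positivity)
      rw [mul_pow, Real.sq_sqrt hq0]
      exact hstep x y
  refine ⟨hc.fixedPoint, ?_⟩
  have hfix : hc.fixedPoint - η • T hc.fixedPoint = hc.fixedPoint := hc.fixedPoint_isFixedPt
  have : η • T hc.fixedPoint = 0 := by simpa using hfix
  exact (smul_eq_zero.1 this).resolve_left hη0.ne'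

section Network

variable {V : Type*}

/-- `a` is the adjacency matrix of a simple graph, with real entries. -/
structure IsAdjacency (a : V → V → ℝ) : Prop where
  symm : ∀ i j, a i j = a j i
  zero_or_one : ∀ i j, a i j = 0 ∨ a i j = 1
  irrefl : ∀ i, a i i = 0

lemma IsAdjacency.nonneg {a : V → V → ℝ} (ha : IsAdjacency a) (i j : V) : 0 ≤ a i j := by
  rcases ha.zero_or_one i j with h | h <;> rw [h]; norm_num

lemma IsAdjacency.le_one {a : V → V → ℝ} (ha : IsAdjacency a) (i j : V) : a i j ≤ 1 := by
  rcases ha.zero_or_one i j with h | h <;> rw [h]; norm_num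

/-- The response functions of a network: `ψ i j u` is the flow from `i` to `j` caused by the
potential difference `u`. It is antisymmetric in the pair, strongly monotone with constant `m` and
`1`-Lipschitz in `u`. -/
structure IsResponse (m : ℝ) (ψ : V → V → ℝ → ℝ) : Prop where
  antisymm : ∀ i j u, ψ i j (-u) = -ψ j i u
  zero : ∀ i j, ψ i j 0 = 0
  mono : ∀ i j u v, m * (u - v) ^ 2 ≤ (ψ i j u - ψ i j v) * (u - v)
  lipschitz : ∀ i j u v, |ψ i j u - ψ i j v| ≤ |u - v|

/-- The adjacency matrix after the edges at `i` have been deleted. -/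
def deleteVertex [DecidableEq V] (a : V → V → ℝ) (i : V) : V → V → ℝ :=
  fun j k => if j = i ∨ k = i then 0 else a j k

lemma IsAdjacency.deleteVertex [DecidableEq V] {a : V → V → ℝ} (ha : IsAdjacency a) (i : V) :
    IsAdjacency (deleteVertex a i) where
  symm j k := by simp only [CARE.deleteVertex, or_comm, ha.symm j k]
  zero_or_one j k := by
    unfold CARE.deleteVertex
    split_ifs
    · exact Or.inl rfl
    · exact ha.zero_or_one j k
  irrefl j := by simp [CARE.deleteVertex, ha.irrefl]

variable {a : V → V → ℝ} {ψ : V → V → ℝ → ℝ} {ξ : V → V → ℝ} {m : ℝ}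

lemma IsResponse.flow_antisymm (hψ : IsResponse m ψ) (x : V → ℝ) (i j : V) :
    ψ i j (x i - x j) = -ψ j i (x j - x i) := by
  rw [← hψ.antisymm, neg_sub]

lemma IsResponse.flow_lower (hψ : IsResponse m ψ) (i j : V) {u : ℝ} (hu : 0 ≤ u) :
    m * u ≤ ψ i j u := by
  rcases hu.eq_or_lt with h | h
  · rw [← h, hψ.zero]; simp
  · have := hψ.mono i j u 0
    rw [hψ.zero, sub_zero, sub_zero] at this
    nlinarith

variable [Fintype V]

/-- The net flow out of the node `i` when the potentials are `δ` and the pair `(i, j)` carries the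
additional flow `ξ i j`. Its vanishing at all nodes is the score equation of the network. -/
def balance (a : V → V → ℝ) (ψ : V → V → ℝ → ℝ) (ξ : V → V → ℝ) (δ : V → ℝ) (i : V) : ℝ :=
  ∑ j, a i j * (ψ i j (δ i - δ j) + ξ i j)

lemma sum_balance (ha : IsAdjacency a) (hψ : IsResponse m ψ) (hξ : ∀ i j, ξ i j = -ξ j i)
    (x : V → ℝ) : ∑ i, balance a ψ ξ x i = 0 := by
  have := sum_mul_sum_antisymm (F := fun i j => ψ i j (x i - x j) + ξ i j) ha.symm
    (fun i j => by rw [hψ.flow_antisymm x i j, hξ i j]; ring) (fun _ => 1)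
  simpa [balance] using this

lemma balance_strongly_monotone (ha : IsAdjacency a) (hψ : IsResponse m ψ) (x y : V → ℝ) :
    m * energy a (x - y)
      ≤ ∑ i, (balance a ψ ξ x i - balance a ψ ξ y i) * (x i - y i) := by
  have e1 : ∀ i, (balance a ψ ξ x i - balance a ψ ξ y i) * (x i - y i)
      = (x - y) i * ∑ j, a i j * (ψ i j (x i - x j) - ψ i j (y i - y j)) := by
    intro i
    rw [balance, balance, ← Finset.sum_sub_distrib, mul_comm]
    congr 1
    exact Finset.sum_congr rfl fun j _ => by ring
  rw [Finset.sum_congr rfl fun i _ => e1 i,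
    sum_mul_sum_antisymm (F := fun i j => ψ i j (x i - x j) - ψ i j (y i - y j)) ha.symm
      (fun i j => by rw [hψ.flow_antisymm x i j, hψ.flow_antisymm y i j]; ring) (x - y),
    energy, ← mul_div_assoc, Finset.mul_sum]
  refine div_le_div_of_nonneg_right (Finset.sum_le_sum fun i _ => ?_) (by norm_num)
  rw [Finset.mul_sum]
  refine Finset.sum_le_sum fun j _ => ?_
  have h := mul_le_mul_of_nonneg_left (hψ.mono i j (x i - x j) (y i - y j)) (ha.nonneg i j)
  have e : (x - y) i - (x - y) j = x i - x j - (y i - y j) := by simp only [Pi.sub_apply]; ring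
  rw [e]
  nlinarith

lemma sum_sq_le_of_le_inner {c : ℝ} (hc : 0 ≤ c) (g z : V → ℝ)
    (h : c * ∑ i, z i ^ 2 ≤ ∑ i, g i * z i) : c ^ 2 * ∑ i, z i ^ 2 ≤ ∑ i, g i ^ 2 := by
  have hQ : 0 ≤ ∑ i, z i ^ 2 := Finset.sum_nonneg fun i _ => sq_nonneg _
  have hG : 0 ≤ ∑ i, g i ^ 2 := Finset.sum_nonneg fun i _ => sq_nonneg _
  have hCS := Finset.sum_mul_sq_le_sq_mul_sq Finset.univ g z
  have h2 := pow_le_pow_left₀ (by positivity) h 2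
  rcases hQ.eq_or_lt with h0 | h0
  · rw [← h0]; simpa using hG
  · by_contra! hlt
    nlinarith

/-- The `ℓ²` bound for a solution of the score equations, in terms of the spectral gap. -/
lemma sum_sq_le_of_balance_eq_zero (ha : IsAdjacency a) (hψ : IsResponse m ψ) (hm : 0 ≤ m)
    {gap : ℝ} (hgap0 : 0 ≤ gap) {δ : V → ℝ} (hgap : gap * ∑ i, δ i ^ 2 ≤ energy a δ)
    (hδ : ∀ i, balance a ψ ξ δ i = 0) :
    (m * gap) ^ 2 * ∑ i, δ i ^ 2 ≤ ∑ i, (∑ j, a i j * ξ i j) ^ 2 := by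
  have h := balance_strongly_monotone (ξ := ξ) ha hψ δ 0
  have h2 := sum_sq_le_of_le_inner (mul_nonneg hm hgap0) (fun i => -∑ j, a i j * ξ i j) δ (by
    refine le_trans ?_ (h.trans_eq (Finset.sum_congr rfl fun i _ => ?_))
    · rw [sub_zero, mul_assoc]
      exact mul_le_mul_of_nonneg_left hgap hm
    · rw [hδ i]; simp [balance, hψ.zero])
  simpa using h2

/-- The score equations are solvable in any subspace which they preserve and on which the energy
is coercive. -/
lemma exists_balance_eq_zero (ha : IsAdjacency a) (hψ : IsResponse m ψ) (hm : 0 < m)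
    {gap : ℝ} (hgap0 : 0 < gap) (U : Submodule ℝ (EuclideanSpace ℝ V))
    (hU : ∀ v ∈ U, WithLp.toLp 2 (balance a ψ ξ v) ∈ U)
    (hgap : ∀ v ∈ U, gap * ∑ i, v i ^ 2 ≤ energy a v) :
    ∃ v ∈ U, ∀ i, balance a ψ ξ v i = 0 := by
  have hnorm : ∀ w : U, ‖w‖ ^ 2 = ∑ i, (w : EuclideanSpace ℝ V) i ^ 2 := fun w => by
    rw [Submodule.coe_norm, EuclideanSpace.norm_sq_eq]; simp
  obtain ⟨v, hv⟩ := exists_zero_of_strongly_monotone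
    (fun v : U => (⟨WithLp.toLp 2 (balance a ψ ξ v), hU v v.2⟩ : U)) (μ := m * gap)
    (Λ := ∑ i, (∑ j, 2 * |a i j|) ^ 2) (mul_pos hm hgap0) (fun x y => by
      have h1 := balance_strongly_monotone (ξ := ξ) ha hψ x y
      have h2 := mul_le_mul_of_nonneg_left (hgap (x - y) (x - y).2) hm.le
      rw [hnorm, mul_assoc]
      refine h2.trans (h1.trans_eq ?_)
      rw [Submodule.coe_inner, PiLp.inner_apply]
      refine Finset.sum_congr rfl fun i _ => ?_
      simp [mul_comm]) (fun x y => by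
      rw [hnorm (_ - _), Finset.sum_mul]
      refine Finset.sum_le_sum fun i _ => ?_
      have hcoord : ∀ k, |(x : EuclideanSpace ℝ V) k - (y : EuclideanSpace ℝ V) k| ≤ ‖x - y‖ := by
        intro k
        have := PiLp.norm_apply_le ((x - y : U) : EuclideanSpace ℝ V) k
        simpa using this
      have hb : |balance a ψ ξ x i - balance a ψ ξ y i| ≤ (∑ j, 2 * |a i j|) * ‖x - y‖ := by
        rw [balance, balance, ← Finset.sum_sub_distrib, Finset.sum_mul]
        refine (Finset.abs_sum_le_sum_abs _ _).trans (Finset.sum_le_sum fun j _ => ?_)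
        rw [← mul_sub, abs_mul, mul_comm 2, mul_assoc]
        refine mul_le_mul_of_nonneg_left ?_ (abs_nonneg _)
        rw [add_sub_add_right_eq_sub]
        refine (hψ.lipschitz i j _ _).trans ?_
        have e : (x : EuclideanSpace ℝ V) i - (x : EuclideanSpace ℝ V) j
            - ((y : EuclideanSpace ℝ V) i - (y : EuclideanSpace ℝ V) j)
            = ((x : EuclideanSpace ℝ V) i - (y : EuclideanSpace ℝ V) i)
              - ((x : EuclideanSpace ℝ V) j - (y : EuclideanSpace ℝ V) j) := by ring
        rw [e]
        exact (abs_sub _ _).trans (by linarith [hcoord i, hcoord j])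
      have := pow_le_pow_left₀ (abs_nonneg _) hb 2
      rw [sq_abs, mul_pow] at this
      simpa using this)
  refine ⟨v, v.2, fun i => ?_⟩
  have := congrArg (fun w : U => (w : EuclideanSpace ℝ V) i) hv
  simpa using this

/-! ### Sup-norm bounds for the score equations -/

/-- One step of the level-set argument: the flow through the boundary of `{f ≥ t}` is at most `γ`
per node, so that a fixed proportion of the boundary leads to nodes with `f ≥ t - Δ`. -/
lemma levelSet_growth [DecidableEq V] (ha : IsAdjacency a) {Φ : V → V → ℝ} {f : V → ℝ}
    {γ h D Δ t : ℝ} (hΦ : ∀ i j, Φ i j = -Φ j i) (hm : 0 < m) (hΔ : 0 < Δ)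
    (hflow : ∀ i j, f j ≤ f i → m * (f i - f j) ≤ Φ i j)
    (hsum : ∀ i, ∑ j, a i j * Φ i j ≤ γ) (hdeg : ∀ i, ∑ j, a i j ≤ D)
    (hΔγ : 2 * γ ≤ m * h * Δ)
    (hcut : h * (Finset.univ.filter fun i => t ≤ f i).card
      ≤ cutWeight a (Finset.univ.filter fun i => t ≤ f i)) :
    h / 2 * (Finset.univ.filter fun i => t ≤ f i).card
      ≤ D * (((Finset.univ.filter fun i => t - Δ ≤ f i).card : ℝ)
        - (Finset.univ.filter fun i => t ≤ f i).card) := by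
  set S := Finset.univ.filter fun i => t ≤ f i with hS
  set S' := Finset.univ.filter fun i => t - Δ ≤ f i with hS'
  have hsub : S ⊆ S' := by
    intro i; simp only [hS, hS', Finset.mem_filter, Finset.mem_univ, true_and]
    intro h; linarith
  have hpt : ∀ i ∈ S, ∀ j ∈ Sᶜ, a i j
      ≤ (if j ∈ S' then a i j else 0) + a i j * Φ i j / (m * Δ) := by
    intro i hi j hj
    simp only [hS, Finset.mem_filter, Finset.mem_univ, true_and, Finset.mem_compl, not_le] at hi hj
    have hΦ0 := hflow i j (by linarith)
    have ha0 := ha.nonneg i j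
    split_ifs with hj'
    · have h0 : 0 ≤ m * (f i - f j) := mul_nonneg hm.le (by linarith)
      have : 0 ≤ a i j * Φ i j / (m * Δ) :=
        div_nonneg (mul_nonneg ha0 (h0.trans hΦ0)) (by positivity)
      linarith
    · simp only [hS', Finset.mem_filter, Finset.mem_univ, true_and, not_le] at hj'
      rw [zero_add, le_div_iff₀ (by positivity)]
      refine mul_le_mul_of_nonneg_left (le_trans ?_ hΦ0) ha0
      exact mul_le_mul_of_nonneg_left (by linarith) hm.le
  have h1 : cutWeight a S ≤ ∑ i ∈ S, ∑ j ∈ Sᶜ, (if j ∈ S' then a i j else 0)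
      + (∑ i ∈ S, ∑ j ∈ Sᶜ, a i j * Φ i j) / (m * Δ) := by
    rw [cutWeight, Finset.sum_div, ← Finset.sum_add_distrib]
    refine Finset.sum_le_sum fun i hi => ?_
    rw [Finset.sum_div, ← Finset.sum_add_distrib]
    exact Finset.sum_le_sum fun j hj => hpt i hi j hj
  have h2 : ∑ i ∈ S, ∑ j ∈ Sᶜ, a i j * Φ i j ≤ γ * S.card := by
    rw [← sum_antisymm_eq_cut ha.symm hΦ S]
    refine (Finset.sum_le_sum fun i _ => hsum i).trans_eq ?_
    simp [mul_comm]
  have h3 : ∑ i ∈ S, ∑ j ∈ Sᶜ, (if j ∈ S' then a i j else 0) ≤ D * (S'.card - S.card) := by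
    rw [Finset.sum_comm, ← Nat.cast_sub (Finset.card_le_card hsub),
      ← Finset.card_sdiff_of_subset hsub]
    calc ∑ j ∈ Sᶜ, ∑ i ∈ S, (if j ∈ S' then a i j else 0)
        ≤ ∑ j ∈ Sᶜ, (if j ∈ S' then D else 0) := by
          refine Finset.sum_le_sum fun j _ => ?_
          split_ifs
          · refine le_trans ?_ (hdeg j)
            rw [Finset.sum_congr rfl fun i _ => ha.symm i j]
            exact Finset.sum_le_sum_of_subset_of_nonneg (Finset.subset_univ _)
              fun k _ _ => ha.nonneg j k
          · simp
      _ = D * (S' \ S).card := by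
          rw [← Finset.sum_filter, Finset.sum_const, nsmul_eq_mul, mul_comm]
          congr 3
          ext j; simp [and_comm]
  have h4 : γ * S.card / (m * Δ) ≤ h / 2 * S.card := by
    rw [div_le_iff₀ (by positivity)]
    have : (0 : ℝ) ≤ S.card := Nat.cast_nonneg _
    nlinarith
  have h5 := div_le_div_of_nonneg_right h2 (by positivity : 0 ≤ m * Δ)
  linarith

/-- Iterating `levelSet_growth`, the level set at depth `k Δ` below the maximum contains more than
half of the nodes as soon as `2 (1 + h / (2 D))ᵏ > n`. -/
lemma levelSet_card [DecidableEq V] (ha : IsAdjacency a) {Φ : V → V → ℝ} {f : V → ℝ}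
    {γ h D Δ : ℝ} (hΦ : ∀ i j, Φ i j = -Φ j i) (hm : 0 < m) (hΔ : 0 < Δ) (hD : 0 < D)
    (hh : 0 < h) (hflow : ∀ i j, f j ≤ f i → m * (f i - f j) ≤ Φ i j)
    (hsum : ∀ i, ∑ j, a i j * Φ i j ≤ γ) (hdeg : ∀ i, ∑ j, a i j ≤ D)
    (hΔγ : 2 * γ ≤ m * h * Δ)
    (hcut : ∀ S : Finset V, 2 * S.card ≤ Fintype.card V → h * S.card ≤ cutWeight a S)
    (i₀ : V) {k : ℕ} (hk : (Fintype.card V : ℝ) < 2 * (1 + h / (2 * D)) ^ k) :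
    Fintype.card V < 2 * (Finset.univ.filter fun i => f i₀ - k * Δ ≤ f i).card := by
  have key : ∀ k : ℕ,
      Fintype.card V < 2 * (Finset.univ.filter fun i => f i₀ - k * Δ ≤ f i).card ∨
      (1 + h / (2 * D)) ^ k ≤ (Finset.univ.filter fun i => f i₀ - k * Δ ≤ f i).card := by
    intro k
    induction k with
    | zero =>
      right
      have : 0 < (Finset.univ.filter fun i => f i₀ - (0 : ℕ) * Δ ≤ f i).card :=
        Finset.card_pos.2 ⟨i₀, by simp⟩
      rw [pow_zero]
      exact_mod_cast this
    | succ k ih =>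
      have hmono : (Finset.univ.filter fun i => f i₀ - k * Δ ≤ f i).card
          ≤ (Finset.univ.filter fun i => f i₀ - (k + 1 : ℕ) * Δ ≤ f i).card := by
        refine Finset.card_le_card fun i => ?_
        simp only [Finset.mem_filter, Finset.mem_univ, true_and]
        push_cast
        intro h; linarith
      by_cases hbig : Fintype.card V < 2 * (Finset.univ.filter fun i => f i₀ - k * Δ ≤ f i).card
      · left; omega
      · right
        have ih' := ih.resolve_left hbig
        have hg := levelSet_growth ha hΦ hm hΔ hflow hsum hdeg hΔγ
          (hcut (Finset.univ.filter fun i => f i₀ - k * Δ ≤ f i) (by omega))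
        have e : f i₀ - k * Δ - Δ = f i₀ - (k + 1 : ℕ) * Δ := by push_cast; ring
        rw [e] at hg
        set A : ℝ := ((Finset.univ.filter fun i => f i₀ - k * Δ ≤ f i).card : ℝ)
        set B : ℝ := ((Finset.univ.filter fun i => f i₀ - (k + 1 : ℕ) * Δ ≤ f i).card : ℝ)
        have h1 : (1 + h / (2 * D)) * A ≤ B := by
          have : h / (2 * D) * A ≤ B - A := by
            rw [div_mul_eq_mul_div, div_le_iff₀ (by positivity)]
            linarith
          linarith
        rw [pow_succ]
        have := mul_le_mul_of_nonneg_left ih' (by positivity : 0 ≤ 1 + h / (2 * D))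
        linarith
  rcases key k with h1 | h1
  · exact h1
  · have : (Fintype.card V : ℝ)
        < 2 * (Finset.univ.filter fun i => f i₀ - k * Δ ≤ f i).card := by linarith
    exact_mod_cast this

/-- The oscillation of a solution of the score equations in an expander is at most of the order of
`log n` times the natural scale `γ / (m h)`. -/
lemma oscillation_le_of_expansion [DecidableEq V] (ha : IsAdjacency a) (hψ : IsResponse m ψ)
    {γ h D Δ : ℝ} (hm : 0 < m) (hΔ : 0 < Δ) (hD : 0 < D) (hh : 0 < h)
    (hγ : ∀ i, |∑ j, a i j * ξ i j| ≤ γ) (hdeg : ∀ i, ∑ j, a i j ≤ D)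
    (hΔγ : 2 * γ ≤ m * h * Δ)
    (hcut : ∀ S : Finset V, 2 * S.card ≤ Fintype.card V → h * S.card ≤ cutWeight a S)
    {δ : V → ℝ} (hδ : ∀ i, balance a ψ ξ δ i = 0)
    {k : ℕ} (hk : (Fintype.card V : ℝ) < 2 * (1 + h / (2 * D)) ^ k) (i j : V) :
    δ i - δ j ≤ 2 * k * Δ := by
  have hflux : ∀ i, ∑ j, a i j * ψ i j (δ i - δ j) = -∑ j, a i j * ξ i j := by
    intro i
    have := hδ i
    simp only [balance, mul_add, Finset.sum_add_distrib] at this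
    linarith
  have h1 := levelSet_card ha (Φ := fun i j => ψ i j (δ i - δ j)) (f := δ)
    (hψ.flow_antisymm δ) hm hΔ hD hh (fun i j hij => hψ.flow_lower i j (by linarith))
    (fun i => by rw [hflux]; linarith [neg_abs_le (∑ j, a i j * ξ i j), hγ i])
    hdeg hΔγ hcut i hk
  have h2 := levelSet_card ha (Φ := fun i j => -ψ i j (δ i - δ j)) (f := fun i => -δ i)
    (fun i j => by rw [hψ.flow_antisymm δ i j]) hm hΔ hD hh
    (fun i j hij => by
      rw [hψ.flow_antisymm δ i j, neg_neg]
      have := hψ.flow_lower j i (u := δ j - δ i) (by linarith)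
      linarith)
    (fun i => by
      simp only [mul_neg, Finset.sum_neg_distrib]
      rw [hflux]; linarith [le_abs_self (∑ j, a i j * ξ i j), hγ i])
    hdeg hΔγ hcut j hk
  obtain ⟨l, hl⟩ : ((Finset.univ.filter fun l => δ i - k * Δ ≤ δ l)
      ∩ Finset.univ.filter fun l => -δ j - k * Δ ≤ -δ l).Nonempty := by
    by_contra hne
    rw [Finset.not_nonempty_iff_eq_empty, ← Finset.disjoint_iff_inter_eq_empty] at hne
    have := Finset.card_union_of_disjoint hne
    have := Finset.card_le_univ ((Finset.univ.filter fun l => δ i - k * Δ ≤ δ l)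
      ∪ Finset.univ.filter fun l => -δ j - k * Δ ≤ -δ l)
    omega
  simp only [Finset.mem_inter, Finset.mem_filter, Finset.mem_univ, true_and] at hl
  linarith [hl.1, hl.2]

/-- Stability under deletion of the node `i`: the solution `δ` of the full network and the solution
`δ'` of the network without the edges at `i` differ, off `i` and up to the constant `c`, by little
in `ℓ²`. -/
lemma leaveOneOut_stability [DecidableEq V] (ha : IsAdjacency a) (hψ : IsResponse m ψ)
    (hm : 0 ≤ m) {gap D b ζ : ℝ} (hgap0 : 0 ≤ gap) (i : V) (hdeg : ∑ j, a i j ≤ D)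
    (hgap : ∀ z : V → ℝ, ∑ j, z j = 0 → z i = 0 →
      gap * ∑ j, z j ^ 2 ≤ energy (deleteVertex a i) z)
    (hζ : ∀ j k, |ξ j k| ≤ ζ) {δ δ' : V → ℝ} (hδ : ∀ j, balance a ψ ξ δ j = 0)
    (hδ' : ∀ j, balance (deleteVertex a i) ψ ξ δ' j = 0) (hδ's : ∑ j, δ' j = 0)
    (hδ'i : δ' i = 0) (hb : ∀ j, |δ j| ≤ b) {c : ℝ}
    (hc : ∑ j, (if j = i then 0 else δ j - c) = 0) :
    (m * gap) ^ 2 * ∑ j, (if j = i then 0 else δ j - c - δ' j) ^ 2 ≤ D * (2 * b + ζ) ^ 2 := by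
  set z : V → ℝ := fun j => if j = i then 0 else δ j - c - δ' j with hz
  have hzi : z i = 0 := by simp [hz]
  have hzs : ∑ j, z j = 0 := by
    have : ∀ j, z j = (if j = i then 0 else δ j - c) - δ' j := by
      intro j
      by_cases h : j = i
      · subst h; simp [hz, hδ'i]
      · simp [hz, h]
    rw [Finset.sum_congr rfl fun j _ => this j, Finset.sum_sub_distrib, hc, hδ's, sub_zero]
  have hmono := balance_strongly_monotone (ξ := ξ) (ha.deleteVertex i) hψ (δ' + z) δ'
  rw [add_sub_cancel_left] at hmono
  set g : V → ℝ := fun j => -(a j i * (ψ j i (δ j - δ i) + ξ j i)) with hg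
  have hbal : ∀ j, j ≠ i → balance (deleteVertex a i) ψ ξ (δ' + z) j = g j := by
    intro j hj
    have e1 : ∀ k, deleteVertex a i j k * (ψ j k ((δ' + z) j - (δ' + z) k) + ξ j k)
        = a j k * (ψ j k (δ j - δ k) + ξ j k)
          - if k = i then a j k * (ψ j k (δ j - δ k) + ξ j k) else 0 := by
      intro k
      by_cases hk : k = i
      · simp [deleteVertex, hk]
      · have : (δ' + z) j - (δ' + z) k = δ j - δ k := by
          simp only [Pi.add_apply, hz, hj, hk, if_false]; ring
        rw [this]
        simp [deleteVertex, hj, hk]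
    rw [balance, Finset.sum_congr rfl fun k _ => e1 k, Finset.sum_sub_distrib]
    have := hδ j
    rw [balance] at this
    rw [this, Finset.sum_ite_eq' Finset.univ i]
    simp [hg]
  have h2 := sum_sq_le_of_le_inner (mul_nonneg hm hgap0) g z (by
    rw [mul_assoc]
    refine (mul_le_mul_of_nonneg_left (hgap z hzs hzi) hm).trans (hmono.trans_eq ?_)
    refine Finset.sum_congr rfl fun j _ => ?_
    rw [hδ', sub_zero, Pi.add_apply, add_sub_cancel_left]
    by_cases hj : j = i
    · simp [hj, hzi]
    · rw [hbal j hj])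
  refine h2.trans ?_
  have hpt : ∀ j, g j ^ 2 ≤ a i j * (2 * b + ζ) ^ 2 := by
    intro j
    have h3 : |ψ j i (δ j - δ i) + ξ j i| ≤ 2 * b + ζ := by
      refine (abs_add_le _ _).trans (add_le_add ?_ (hζ j i))
      have := hψ.lipschitz j i (δ j - δ i) 0
      rw [hψ.zero, sub_zero, sub_zero] at this
      exact this.trans ((abs_sub _ _).trans (by linarith [hb j, hb i]))
    have h4 : (ψ j i (δ j - δ i) + ξ j i) ^ 2 ≤ (2 * b + ζ) ^ 2 := by
      rw [← sq_abs]
      exact pow_le_pow_left₀ (abs_nonneg _) h3 2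
    simp only [hg]
    rw [neg_sq, mul_pow, ha.symm i j]
    rcases ha.zero_or_one j i with h | h <;> rw [h] <;> linarith
  refine (Finset.sum_le_sum fun j _ => hpt j).trans ?_
  rw [← Finset.sum_mul]
  exact mul_le_mul_of_nonneg_right hdeg (sq_nonneg _)

/-- If enough neighbours of the node `i`, at which `|δ|` attains its maximum `b`, carry potentials
of size at most `b / 2`, then the flow out of `i` forces `b` to be small. -/
lemma maximum_principle [DecidableEq V] (ha : IsAdjacency a) (hψ : IsResponse m ψ)
    (hm : 0 ≤ m) {b γ w : ℝ} {i : V} {δ : V → ℝ} (hδ : balance a ψ ξ δ i = 0)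
    (hγ : |∑ j, a i j * ξ i j| ≤ γ) (hb : ∀ j, |δ j| ≤ b) (hi : |δ i| = b)
    (hw : w ≤ ∑ j, if |δ j| ≤ b / 2 then a i j else 0) : m * (b / 2) * w ≤ γ := by
  have hb0 : 0 ≤ b := hi ▸ abs_nonneg _
  obtain ⟨s, hs, hsb⟩ : ∃ s : ℝ, (s = 1 ∨ s = -1) ∧ s * δ i = b := by
    rcases abs_choice (δ i) with h | h
    · exact ⟨1, Or.inl rfl, by rw [one_mul, ← h, hi]⟩
    · exact ⟨-1, Or.inr rfl, by rw [neg_one_mul, ← h, hi]⟩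
  have hsj : ∀ j, s * δ j ≤ |δ j| := by
    intro j
    rcases hs with h | h <;> rw [h]
    · simpa using le_abs_self (δ j)
    · simpa using neg_le_abs (δ j)
  have hflow : ∀ j, m * (s * δ i - s * δ j) ≤ s * ψ i j (δ i - δ j) := by
    intro j
    have h0 : 0 ≤ s * (δ i - δ j) := by
      have := hsj j; have := hb j; rw [mul_sub, hsb]; linarith
    rcases hs with h | h
    · subst h
      have := hψ.flow_lower i j (u := δ i - δ j) (by linarith)
      linarith
    · subst h
      rw [hψ.flow_antisymm δ i j]
      have := hψ.flow_lower j i (u := δ j - δ i) (by linarith)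
      linarith
  have hsum : s * ∑ j, a i j * ψ i j (δ i - δ j) ≤ γ := by
    have : ∑ j, a i j * ψ i j (δ i - δ j) = -∑ j, a i j * ξ i j := by
      simp only [balance, mul_add, Finset.sum_add_distrib] at hδ
      linarith
    rw [this]
    refine le_trans ?_ hγ
    rcases hs with h | h <;> rw [h]
    · rw [one_mul]; exact neg_le_abs _
    · rw [neg_mul_neg, one_mul]; exact le_abs_self _
  refine le_trans (le_trans (mul_le_mul_of_nonneg_left hw (by positivity)) ?_) hsum
  rw [Finset.mul_sum, Finset.mul_sum]
  refine Finset.sum_le_sum fun j _ => ?_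
  have h1 := hflow j
  have h2 := hsj j
  have h3 := hb j
  have ha0 := ha.nonneg i j
  have h4 : s * (a i j * ψ i j (δ i - δ j)) = a i j * (s * ψ i j (δ i - δ j)) := by ring
  rw [h4]
  split_ifs with hj
  · rw [mul_comm (m * (b / 2))]
    refine mul_le_mul_of_nonneg_left (le_trans ?_ h1) ha0
    exact mul_le_mul_of_nonneg_left (by linarith) hm
  · rw [mul_zero]
    refine mul_nonneg ha0 (le_trans (mul_nonneg hm ?_) h1)
    linarith

/-- The leave-one-out bound at the node where `|δ|` is maximal: most neighbours of `i` have a small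
leave-one-out potential, hence by stability a small potential, and the maximum principle applies. -/
lemma sup_bound_of_leaveOneOut [DecidableEq V] (ha : IsAdjacency a) (hψ : IsResponse m ψ)
    (hm : 0 < m) {gap D b ζ γ N t : ℝ} (hgap0 : 0 < gap) (i : V) (hdeg : ∑ j, a i j ≤ D)
    (hdeg' : N / 4 ≤ ∑ j, a i j)
    (hgap : ∀ z : V → ℝ, ∑ j, z j = 0 → z i = 0 →
      gap * ∑ j, z j ^ 2 ≤ energy (deleteVertex a i) z)
    (hζ : ∀ j k, |ξ j k| ≤ ζ) (hγ : |∑ j, a i j * ξ i j| ≤ γ)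
    {δ δ' : V → ℝ} (hδ : ∀ j, balance a ψ ξ δ j = 0) (hδs : ∑ j, δ j = 0)
    (hδ' : ∀ j, balance (deleteVertex a i) ψ ξ δ' j = 0) (hδ's : ∑ j, δ' j = 0)
    (hδ'i : δ' i = 0) (hb : ∀ j, |δ j| ≤ b) (hi : |δ i| = b) (hcard : 9 ≤ Fintype.card V)
    (hcount : ∑ j, (if t < |δ' j| then a i j else 0) ≤ N / 16) (hb0 : 0 < b) (htb : 4 * t ≤ b)
    (hsmall : 64 * (D * (2 * b + ζ) ^ 2) ≤ (N / 16) * b ^ 2 * (m * gap) ^ 2) :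
    m * b * N / 16 ≤ γ := by
  set c : ℝ := -δ i / ((Fintype.card V : ℝ) - 1) with hc
  have hn : (8 : ℝ) ≤ (Fintype.card V : ℝ) - 1 := by
    have : (9 : ℝ) ≤ Fintype.card V := by exact_mod_cast hcard
    linarith
  have hcb : |c| ≤ b / 8 := by
    rw [hc, abs_div, abs_neg, hi, abs_of_pos (by linarith : (0 : ℝ) < (Fintype.card V : ℝ) - 1)]
    exact div_le_div_of_nonneg_left hb0.le (by norm_num) hn
  have hcs : ∑ j, (if j = i then 0 else δ j - c) = 0 := by
    have : ∀ j, (if j = i then 0 else δ j - c) = δ j - c - if j = i then δ j - c else 0 := by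
      intro j; split_ifs <;> ring
    rw [Finset.sum_congr rfl fun j _ => this j, Finset.sum_sub_distrib, Finset.sum_sub_distrib, hδs,
      Finset.sum_ite_eq' Finset.univ i]
    simp only [Finset.mem_univ, if_true, Finset.sum_const, Finset.card_univ, nsmul_eq_mul]
    have : c * ((Fintype.card V : ℝ) - 1) = -δ i := by
      rw [hc]; field_simp
    linarith
  have hstab := leaveOneOut_stability ha hψ hm.le hgap0.le i hdeg hgap hζ hδ hδ' hδ's hδ'i hb hcs
  set z : V → ℝ := fun j => if j = i then 0 else δ j - c - δ' j with hz
  have hmg : 0 < (m * gap) ^ 2 := by positivity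
  have hzN : 64 / b ^ 2 * ∑ j, z j ^ 2 ≤ N / 16 := by
    rw [div_mul_eq_mul_div, div_le_iff₀ (by positivity)]
    refine le_of_mul_le_mul_right ?_ hmg
    nlinarith
  have hpt : ∀ j, a i j ≤ (if |δ j| ≤ b / 2 then a i j else 0)
      + (if t < |δ' j| then a i j else 0) + 64 / b ^ 2 * z j ^ 2 := by
    intro j
    have h0 := ha.nonneg i j
    have h1 := ha.le_one i j
    have h2 : 0 ≤ 64 / b ^ 2 * z j ^ 2 := by positivity
    by_cases hj : j = i
    · subst hj; rw [ha.irrefl]; simp only [ite_self]; linarith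
    split_ifs with h3 h4 h4 <;> try linarith
    have hzj : b / 8 ≤ |z j| := by
      have e : z j = δ j - c - δ' j := by simp [hz, hj]
      have : |δ j| ≤ |z j| + |c| + |δ' j| := by
        have e2 : δ j = z j + c + δ' j := by rw [e]; ring
        rw [e2]; exact abs_add_three _ _ _
      linarith
    have : 1 ≤ 64 / b ^ 2 * z j ^ 2 := by
      rw [div_mul_eq_mul_div, le_div_iff₀ (by positivity), ← sq_abs (z j)]
      nlinarith
    linarith
  have hsum := Finset.sum_le_sum fun j (_ : j ∈ Finset.univ) => hpt j
  rw [Finset.sum_add_distrib, Finset.sum_add_distrib, ← Finset.mul_sum] at hsum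
  have := maximum_principle ha hψ hm.le (hδ i) hγ hb hi (w := N / 8) (by linarith)
  linarith

end Network

/-! ### The response function of the comparison model -/

lemma le_deriv_sigmoid {κ x : ℝ} (hx : |x| ≤ Real.log κ + 1) (hκ : 1 ≤ κ) :
    1 / (12 * κ) ≤ Real.sigmoid x * (1 - Real.sigmoid x) := by
  have hκ0 : 0 < κ := by linarith
  have hexp : Real.exp |x| ≤ 3 * κ := by
    calc Real.exp |x| ≤ Real.exp (Real.log κ + 1) := Real.exp_le_exp.2 hx
      _ = κ * Real.exp 1 := by rw [Real.exp_add, Real.exp_log hκ0]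
      _ ≤ 3 * κ := by nlinarith [Real.exp_one_lt_d9]
  have h1 : Real.exp x ≤ 3 * κ := (Real.exp_le_exp.2 (le_abs_self x)).trans hexp
  have h2 : Real.exp (-x) ≤ 3 * κ := (Real.exp_le_exp.2 (neg_le_abs x)).trans hexp
  have h3 : Real.exp x * Real.exp (-x) = 1 := by rw [← Real.exp_add]; simp
  rw [← Real.sigmoid_neg, Real.sigmoid_def, Real.sigmoid_def, neg_neg, ← mul_inv, ← one_div]
  refine one_div_le_one_div_of_le (by positivity) ?_
  nlinarith [Real.exp_pos x, Real.exp_pos (-x)]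

lemma sigmoid_sub_le {x y : ℝ} (hxy : x ≤ y) : Real.sigmoid y - Real.sigmoid x ≤ y - x := by
  have := Convex.image_sub_le_mul_sub_of_deriv_le (D := Set.univ) convex_univ (f := Real.sigmoid)
    continuous_sigmoid.continuousOn differentiable_sigmoid.differentiableOn (C := 1)
    (fun z _ => by
      rw [Real.deriv_sigmoid]
      nlinarith [Real.sigmoid_pos z, Real.sigmoid_lt_one z])
    x trivial y trivial hxy
  linarith

lemma le_sigmoid_sub {κ x y : ℝ} (hκ : 1 ≤ κ) (hxy : x ≤ y)
    (hx : -(Real.log κ + 1) ≤ x) (hy : y ≤ Real.log κ + 1) :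
    1 / (12 * κ) * (y - x) ≤ Real.sigmoid y - Real.sigmoid x :=
  Convex.mul_sub_le_image_sub_of_le_deriv (D := Set.Icc x y) (convex_Icc x y) (f := Real.sigmoid)
    continuous_sigmoid.continuousOn differentiable_sigmoid.differentiableOn
    (fun z hz => by
      rw [Real.deriv_sigmoid]
      have hz' := interior_subset hz
      exact le_deriv_sigmoid (abs_le.2 ⟨by linarith [hz'.1], by linarith [hz'.2]⟩) hκ)
    x (Set.left_mem_Icc.2 hxy) y (Set.right_mem_Icc.2 hxy) hxy

/-- The truncation of `u` to `[-1, 1]`. -/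
noncomputable def clip (u : ℝ) : ℝ := max (-1) (min 1 u)

lemma clip_of_abs_le {u : ℝ} (hu : |u| ≤ 1) : clip u = u := by
  rw [abs_le] at hu
  rw [clip, min_eq_right hu.2, max_eq_right hu.1]

lemma clip_neg (u : ℝ) : clip (-u) = -clip u := by
  unfold clip
  rcases le_total u 1 with h1 | h1 <;> rcases le_total u (-1) with h2 | h2
  · rw [min_eq_left (by linarith), min_eq_right h1, max_eq_right (by linarith), max_eq_left h2]
    norm_num
  · rw [min_eq_right (by linarith), min_eq_right h1, max_eq_right (by linarith), max_eq_right h2]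
  · linarith
  · rw [min_eq_right (by linarith), min_eq_left h1, max_eq_left (by linarith),
      max_eq_right (by linarith)]

lemma clip_mem (u : ℝ) : -1 ≤ clip u ∧ clip u ≤ 1 :=
  ⟨le_max_left _ _, max_le (by norm_num) (min_le_left _ _)⟩

lemma clip_sub {u v : ℝ} (h : v ≤ u) : 0 ≤ clip u - clip v ∧ clip u - clip v ≤ u - v := by
  unfold clip
  rcases le_total u 1 with h1 | h1 <;> rcases le_total u (-1) with h2 | h2 <;>
    rcases le_total v 1 with h3 | h3 <;> rcases le_total v (-1) with h4 | h4 <;>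
    simp [h1, h2, h3, h4] <;> first | linarith | (constructor <;> linarith)

/-- The change of the win probability of a pair with score difference `tᵢ - tⱼ` when the difference
moves by `u`. Outside `[-1, 1]` it is continued linearly with the slope `1 / (12 κ)`, which makes
the response globally strongly monotone; solutions of the score equations with differences in
`[-1, 1]` do not see the continuation. -/
noncomputable def response {V : Type*} (κ : ℝ) (t : V → ℝ) (i j : V) (u : ℝ) : ℝ :=
  Real.sigmoid (t i - t j + clip u) - Real.sigmoid (t i - t j) + 1 / (12 * κ) * (u - clip u)

lemma isResponse_response {V : Type*} {κ : ℝ} {t : V → ℝ} (hκ : 1 ≤ κ)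
    (ht : ∀ i j, t i - t j ≤ Real.log κ) : IsResponse (1 / (12 * κ)) (response κ t) := by
  have hm0 : 0 < 1 / (12 * κ) := by positivity
  have hm1 : 1 / (12 * κ) ≤ 1 := by
    rw [div_le_one (by positivity)]; linarith
  have key : ∀ i j u v, v ≤ u → 1 / (12 * κ) * (u - v) ≤ response κ t i j u - response κ t i j v ∧
      response κ t i j u - response κ t i j v ≤ u - v := by
    intro i j u v huv
    obtain ⟨h1, h2⟩ := clip_sub huv
    have h3 := ht i j
    have h4 := ht j i
    have h5 := le_sigmoid_sub (κ := κ) (x := t i - t j + clip v) (y := t i - t j + clip u) hκ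
      (by linarith) (by linarith [clip_mem v]) (by linarith [clip_mem u])
    have h6 := sigmoid_sub_le (x := t i - t j + clip v) (y := t i - t j + clip u) (by linarith)
    unfold response
    constructor <;> nlinarith
  refine ⟨fun i j u => ?_, fun i j => ?_, fun i j u v => ?_, fun i j u v => ?_⟩
  · have e1 : t i - t j + -clip u = -(t j - t i + clip u) := by ring
    have e2 : t i - t j = -(t j - t i) := by ring
    rw [response, response, clip_neg, e1, e2, Real.sigmoid_neg, Real.sigmoid_neg]
    ring
  · simp [response, clip_of_abs_le]
  · rcases le_total v u with h | h
    · nlinarith [(key i j u v h).1]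
    · nlinarith [(key i j v u h).1]
  · rcases le_total v u with h | h
    · obtain ⟨h1, h2⟩ := key i j u v h
      have : 0 ≤ 1 / (12 * κ) * (u - v) := mul_nonneg hm0.le (by linarith)
      rw [abs_of_nonneg (by linarith), abs_of_nonneg (by linarith)]
      exact h2
    · obtain ⟨h1, h2⟩ := key i j v u h
      have : 0 ≤ 1 / (12 * κ) * (v - u) := mul_nonneg hm0.le (by linarith)
      rw [abs_of_nonpos (by linarith), abs_of_nonpos (by linarith)]
      linarith

/-! ### The network of observed comparisons -/

section Data

variable {n : ℕ}

/-- The adjacency matrix of the comparison graph with edge indicators `e`. -/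
noncomputable def adj (e : Pair n → Bool) (i j : Fin n) : ℝ :=
  if h : j < i then (if e ⟨(i, j), h⟩ then 1 else 0)
  else if h : i < j then (if e ⟨(j, i), h⟩ then 1 else 0) else 0

/-- The antisymmetric matrix whose entry at `(i, j)`, `i > j`, is `v` at this pair. -/
noncomputable def skew (v : Pair n → ℝ) (i j : Fin n) : ℝ :=
  if h : j < i then v ⟨(i, j), h⟩ else if h : i < j then -v ⟨(j, i), h⟩ else 0

lemma isAdjacency_adj (e : Pair n → Bool) : IsAdjacency (adj e) where
  symm i j := by
    unfold adj
    rcases lt_trichotomy i j with h | h | h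
    · simp [h, h.not_gt]
    · subst h; simp
    · simp [h, h.not_gt]
  zero_or_one i j := by
    unfold adj
    split_ifs <;> simp
  irrefl i := by simp [adj]

lemma skew_antisymm (v : Pair n → ℝ) (i j : Fin n) : skew v i j = -skew v j i := by
  unfold skew
  rcases lt_trichotomy i j with h | h | h
  · simp [h, h.not_gt]
  · subst h; simp
  · simp [h, h.not_gt]

lemma skew_hi_lo (v : Pair n → ℝ) (q : Pair n) : skew v q.hi q.lo = v q := by
  have : q.lo < q.hi := q.2
  simp [skew, this]

lemma abs_skew_le {v : Pair n → ℝ} {c : ℝ} (hc : 0 ≤ c) (hv : ∀ q, |v q| ≤ c) (i j : Fin n) :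
    |skew v i j| ≤ c := by
  unfold skew
  split_ifs
  · exact hv _
  · rw [abs_neg]; exact hv _
  · simpa using hc

lemma sum_pair (F : Pair n → ℝ) :
    ∑ q, F q = ∑ i, ∑ j, if h : j < i then F ⟨(i, j), h⟩ else 0 := by
  set H : Fin n × Fin n → ℝ := fun p => if h : p.2 < p.1 then F ⟨p, h⟩ else 0 with hH
  have h1 : ∑ q, F q = ∑ q : Pair n, H q.1 := by
    refine Finset.sum_congr rfl fun q _ => ?_
    have := q.2
    simp [hH, this]
  rw [h1, ← Finset.sum_subtype (Finset.univ.filter fun p : Fin n × Fin n => p.2 < p.1)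
    (fun x => by simp) H, Finset.sum_filter_of_ne, ← Finset.univ_product_univ,
    Finset.sum_product]
  intro p _ hp
  by_contra hcon
  exact hp (by simp [hH, hcon])

lemma sum_adj_mul (e : Pair n → Bool) (f : Fin n → Fin n → ℝ) :
    ∑ i, ∑ j, adj e i j * f i j
      = ∑ q : Pair n, if e q then f q.hi q.lo + f q.lo q.hi else 0 := by
  have h1 : ∀ i j, adj e i j * f i j
      = (if h : j < i then (if e ⟨(i, j), h⟩ then f i j else 0) else 0)
        + (if h : i < j then (if e ⟨(j, i), h⟩ then f i j else 0) else 0) := by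
    intro i j
    unfold adj
    rcases lt_trichotomy i j with h | h | h
    · simp [h, h.not_gt]
    · subst h; simp
    · simp [h, h.not_gt]
  have h2 : ∀ q : Pair n, (if e q then f q.hi q.lo + f q.lo q.hi else 0)
      = (if e q then f q.hi q.lo else 0) + (if e q then f q.lo q.hi else 0) := by
    intro q; split_ifs <;> simp
  simp only [h1, h2, Finset.sum_add_distrib]
  rw [sum_pair, sum_pair]
  congr 1
  rw [Finset.sum_comm]

lemma sum_pair_mul_sub (e : Pair n → Bool) (v : Pair n → ℝ) (w : Fin n → ℝ) :
    ∑ q : Pair n, (if e q then v q * (w q.hi - w q.lo) else 0)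
      = ∑ i, w i * ∑ j, adj e i j * skew v i j := by
  have h1 : ∑ i, w i * ∑ j, adj e i j * skew v i j
      = ∑ i, ∑ j, adj e i j * (w i * skew v i j) := by
    refine Finset.sum_congr rfl fun i _ => ?_
    rw [Finset.mul_sum]
    exact Finset.sum_congr rfl fun j _ => by ring
  rw [h1, sum_adj_mul]
  refine Finset.sum_congr rfl fun q _ => ?_
  rw [skew_antisymm v q.lo q.hi, skew_hi_lo]
  congr 1; ring

/-- A function on pairs, set to the default value at the pairs which contain `i`. -/
def mask {α : Type*} [Inhabited α] (i : Fin n) (e : Pair n → α) (q : Pair n) : α :=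
  if q.hi = i ∨ q.lo = i then default else e q

lemma adj_mask (i : Fin n) (e : Pair n → Bool) : adj (mask i e) = deleteVertex (adj e) i := by
  ext j k
  unfold adj mask deleteVertex
  by_cases hj : j = i <;> by_cases hk : k = i <;> simp [hj, hk]

variable {L : ℕ}

/-- The centred observations: predicted minus observed win frequency, for each pair. -/
noncomputable def noise (t : Fin n → ℝ) (y : Pair n → Fin L → Bool) (q : Pair n) : ℝ :=
  Real.sigmoid (t q.hi - t q.lo) - freq (y q)

open Classical in
/-- A centred solution of the score equations of the network without the node `i`. It is computed
from the masked data, hence does not depend on the edges and the outcomes at `i`. -/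
noncomputable def leaveOneOut (κ : ℝ) (t : Fin n → ℝ) (i : Fin n) (e : Pair n → Bool)
    (y : Pair n → Fin L → Bool) : Fin n → ℝ :=
  if h : ∃ δ : Fin n → ℝ, (∀ j, balance (adj (mask i e)) (response κ t)
      (skew (noise t (mask i y))) δ j = 0) ∧ ∑ j, δ j = 0 ∧ δ i = 0
  then h.choose else 0

lemma balance_mask (κ : ℝ) (t : Fin n → ℝ) (i : Fin n) (e : Pair n → Bool)
    (y : Pair n → Fin L → Bool) (δ : Fin n → ℝ) (j : Fin n) :
    balance (adj (mask i e)) (response κ t) (skew (noise t (mask i y))) δ j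
      = balance (deleteVertex (adj e) i) (response κ t) (skew (noise t y)) δ j := by
  rw [adj_mask]
  refine Finset.sum_congr rfl fun k _ => ?_
  by_cases h : j = i ∨ k = i
  · simp [deleteVertex, h]
  · have : skew (noise t (mask i y)) j k = skew (noise t y) j k := by
      push Not at h
      simp [skew, noise, mask, h.1, h.2]
    rw [this]

end Data

/-! ### Solutions of the score equations for well-behaved data -/

section Solution

variable {n L : ℕ}

/-- The properties of the data that hold with high probability, for `N = n p` and noise level `ρ`:
expansion and bounded degrees of the comparison graph, bounded noise at each node and each pair, and
for each node only few neighbours whose leave-one-out potential exceeds the threshold `τ`. The last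
property is only claimed if few nodes exceed the threshold at all, a condition that does not involve
the edges at `i`. -/
structure IsRegular (N ρ κ τ : ℝ) (t : Fin n → ℝ) (e : Pair n → Bool)
    (y : Pair n → Fin L → Bool) : Prop where
  cut : ∀ S : Finset (Fin n), 2 * S.card ≤ n → N / 4 * S.card ≤ cutWeight (adj e) S
  degree : ∀ i, ∑ j, adj e i j ≤ 3 * N
  node_noise : ∀ i, |∑ j, adj e i j * skew (noise t y) i j| ≤ 4 * N * ρ
  pair_noise : ∀ q, |noise t y q| ≤ 4 * Real.sqrt N * ρ
  neighbours : ∀ i, ((Finset.univ.filter fun j => τ < |leaveOneOut κ t i e y j|).card : ℝ)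
      ≤ Real.exp (-32) * n →
    ∑ j, (if τ < |leaveOneOut κ t i e y j| then adj e i j else 0) ≤ N / 16

variable {N ρ κ τ : ℝ} {t : Fin n → ℝ} {e : Pair n → Bool} {y : Pair n → Fin L → Bool}

lemma IsRegular.gap (h : IsRegular N ρ κ τ t e y) (hN : 0 < N) (z : Fin n → ℝ)
    (hz : ∑ i, z i = 0) : N / 96 * ∑ i, z i ^ 2 ≤ energy (adj e) z := by
  have ha := isAdjacency_adj e
  have := cheeger (h := N / 4) (D := 3 * N) ha.symm ha.nonneg (by positivity) (by positivity)
    h.degree (by simpa using h.cut) z hz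
  have e1 : (N / 4) ^ 2 / (2 * (3 * N)) = N / 96 := by field_simp; norm_num
  rwa [e1] at this

lemma IsRegular.gap_deleteVertex (h : IsRegular N ρ κ τ t e y) (hN : 192 ≤ N) (i : Fin n)
    (z : Fin n → ℝ) (hz : ∑ j, z j = 0) (hzi : z i = 0) :
    N / 192 * ∑ j, z j ^ 2 ≤ energy (deleteVertex (adj e) i) z := by
  have h1 := h.gap (by linarith) z hz
  have h2 := energy_delete_vertex (isAdjacency_adj e).le_one i z hzi
  have h3 : 0 ≤ ∑ j, z j ^ 2 := Finset.sum_nonneg fun j _ => sq_nonneg _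
  have h4 : energy (deleteVertex (adj e) i) z
    = energy (fun j k => if j = i ∨ k = i then 0 else adj e j k) z := rfl
  nlinarith

lemma IsRegular.exists_solution (h : IsRegular N ρ κ τ t e y) (hN : 0 < N) (hκ : 1 ≤ κ)
    (ht : ∀ i j, t i - t j ≤ Real.log κ) :
    ∃ δ : Fin n → ℝ, (∀ i, balance (adj e) (response κ t) (skew (noise t y)) δ i = 0) ∧
      ∑ i, δ i = 0 := by
  have ha := isAdjacency_adj e
  have hψ := isResponse_response hκ ht
  let U : Submodule ℝ (EuclideanSpace ℝ (Fin n)) :=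
    { carrier := {v | ∑ i, v i = 0}
      add_mem' := fun {v w} hv hw => by
        simp only [Set.mem_ofPred_eq] at hv hw ⊢
        simp [Finset.sum_add_distrib, hv, hw]
      zero_mem' := by simp
      smul_mem' := fun c v hv => by
        simp only [Set.mem_ofPred_eq] at hv ⊢
        simp [← Finset.mul_sum, hv] }
  obtain ⟨v, hv, hv0⟩ := exists_balance_eq_zero (ξ := skew (noise t y)) ha hψ (by positivity)
    (gap := N / 96) (by positivity) U (fun v _ => sum_balance ha hψ (skew_antisymm _) v)
    (fun v hv => h.gap hN v hv)
  exact ⟨v, hv0, hv⟩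

lemma IsRegular.leaveOneOut_spec (h : IsRegular N ρ κ τ t e y) (hN : 192 ≤ N) (hκ : 1 ≤ κ)
    (ht : ∀ i j, t i - t j ≤ Real.log κ) (i : Fin n) :
    (∀ j, balance (deleteVertex (adj e) i) (response κ t) (skew (noise t y))
      (leaveOneOut κ t i e y) j = 0) ∧
    ∑ j, leaveOneOut κ t i e y j = 0 ∧ leaveOneOut κ t i e y i = 0 := by
  have ha := (isAdjacency_adj e).deleteVertex i
  have hψ := isResponse_response hκ ht
  have hex : ∃ δ : Fin n → ℝ, (∀ j, balance (adj (mask i e)) (response κ t)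
      (skew (noise t (mask i y))) δ j = 0) ∧ ∑ j, δ j = 0 ∧ δ i = 0 := by
    let U : Submodule ℝ (EuclideanSpace ℝ (Fin n)) :=
      { carrier := {v | ∑ j, v j = 0 ∧ v i = 0}
        add_mem' := fun {v w} hv hw => by
          simp only [Set.mem_ofPred_eq] at hv hw ⊢
          simp [Finset.sum_add_distrib, hv, hw]
        zero_mem' := by simp
        smul_mem' := fun c v hv => by
          simp only [Set.mem_ofPred_eq] at hv ⊢
          simp [← Finset.mul_sum, hv] }
    obtain ⟨v, hv, hv0⟩ := exists_balance_eq_zero (ξ := skew (noise t y)) ha hψ (by positivity)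
      (gap := N / 192) (by positivity) U
      (fun v _ => ⟨sum_balance ha hψ (skew_antisymm _) v, by simp [balance, deleteVertex]⟩)
      (fun v hv => h.gap_deleteVertex hN i v hv.1 hv.2)
    exact ⟨v, fun j => by rw [balance_mask]; exact hv0 j, hv.1, hv.2⟩
  have hspec := hex.choose_spec
  have hdef : leaveOneOut κ t i e y = hex.choose := by
    rw [leaveOneOut, dif_pos hex]
  rw [hdef]
  exact ⟨fun j => by rw [← balance_mask]; exact hspec.1 j, hspec.2⟩

lemma IsRegular.abs_skew_noise_le (h : IsRegular N ρ κ τ t e y) (hρ : 0 ≤ ρ) (i j : Fin n) :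
    |skew (noise t y) i j| ≤ 4 * Real.sqrt N * ρ :=
  abs_skew_le (by positivity) h.pair_noise i j

/-- The `ℓ²` error of the solution of the score equations: noise `4 N ρ` at each node, divided by
the product of the slope `1 / (12 κ)` and the spectral gap `N / 96`. -/
lemma IsRegular.sum_sq_le (h : IsRegular N ρ κ τ t e y) (hN : 0 < N) (hκ : 1 ≤ κ)
    (ht : ∀ i j, t i - t j ≤ Real.log κ) {δ : Fin n → ℝ}
    (hδ : ∀ i, balance (adj e) (response κ t) (skew (noise t y)) δ i = 0)
    (hδs : ∑ i, δ i = 0) : ∑ i, δ i ^ 2 ≤ n * (4608 * κ * ρ) ^ 2 := by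
  have hκ0 : 0 < κ := by linarith
  have h1 := sum_sq_le_of_balance_eq_zero (isAdjacency_adj e) (isResponse_response hκ ht)
    (by positivity) (by positivity) (h.gap hN δ hδs) hδ
  have h2 : ∑ i, (∑ j, adj e i j * skew (noise t y) i j) ^ 2 ≤ n * (4 * N * ρ) ^ 2 := by
    refine (Finset.sum_le_sum fun i _ => ?_).trans_eq (b := ∑ _i : Fin n, (4 * N * ρ) ^ 2) ?_
    · rw [← sq_abs]
      exact pow_le_pow_left₀ (abs_nonneg _) (h.node_noise i) 2
    · simp
  have e1 : (1 / (12 * κ) * (N / 96)) ^ 2 * (n * (4608 * κ * ρ) ^ 2) = n * (4 * N * ρ) ^ 2 := by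
    field_simp; ring
  refine le_of_mul_le_mul_left ?_ (by positivity : 0 < (1 / (12 * κ) * (N / 96)) ^ 2)
  rw [e1]
  exact h1.trans h2

lemma IsRegular.leaveOneOut_sum_sq_le (h : IsRegular N ρ κ τ t e y) (hN : 192 ≤ N) (hκ : 1 ≤ κ)
    (hρ : 0 ≤ ρ) (ht : ∀ i j, t i - t j ≤ Real.log κ) (i : Fin n) :
    ∑ j, leaveOneOut κ t i e y j ^ 2 ≤ n * (18432 * κ * ρ) ^ 2 := by
  have hκ0 : 0 < κ := by linarith
  have hN0 : 0 < N := by linarith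
  have ha := isAdjacency_adj e
  obtain ⟨hs1, hs2, hs3⟩ := h.leaveOneOut_spec hN hκ ht i
  have h1 := sum_sq_le_of_balance_eq_zero (ha.deleteVertex i)
    (isResponse_response hκ ht) (by positivity) (by positivity)
    (h.gap_deleteVertex hN i _ hs2 hs3) hs1
  have hsqrt : Real.sqrt N ≤ N := Real.sqrt_le_iff.2 ⟨hN0.le, by nlinarith⟩
  have hpt : ∀ j, |∑ k, deleteVertex (adj e) i j k * skew (noise t y) j k| ≤ 8 * N * ρ := by
    intro j
    by_cases hj : j = i
    · have : ∑ k, deleteVertex (adj e) i j k * skew (noise t y) j k = 0 := by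
        simp [deleteVertex, hj]
      rw [this, abs_zero]; positivity
    · have e1 : ∀ k, deleteVertex (adj e) i j k * skew (noise t y) j k
          = adj e j k * skew (noise t y) j k
            - if k = i then adj e j k * skew (noise t y) j k else 0 := by
        intro k
        by_cases hk : k = i <;> simp [deleteVertex, hj, hk]
      rw [Finset.sum_congr rfl fun k _ => e1 k, Finset.sum_sub_distrib,
        Finset.sum_ite_eq' Finset.univ i]
      simp only [Finset.mem_univ, if_true]
      have h3 : |adj e j i * skew (noise t y) j i| ≤ 4 * N * ρ := by
        rw [abs_mul, abs_of_nonneg (ha.nonneg j i)]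
        have h4 := h.abs_skew_noise_le hρ j i
        have h5 := mul_le_mul_of_nonneg_right hsqrt hρ
        have h6 := mul_le_mul_of_nonneg_right (ha.le_one j i) (abs_nonneg (skew (noise t y) j i))
        linarith
      exact (abs_sub _ _).trans (by linarith [h.node_noise j])
  have h2 : ∑ j, (∑ k, deleteVertex (adj e) i j k * skew (noise t y) j k) ^ 2
      ≤ n * (8 * N * ρ) ^ 2 := by
    refine (Finset.sum_le_sum fun j _ => ?_).trans_eq (b := ∑ _i : Fin n, (8 * N * ρ) ^ 2) ?_
    · rw [← sq_abs]
      exact pow_le_pow_left₀ (abs_nonneg _) (hpt j) 2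
    · simp
  have e1 : (1 / (12 * κ) * (N / 192)) ^ 2 * (n * (18432 * κ * ρ) ^ 2) = n * (8 * N * ρ) ^ 2 := by
    field_simp; ring
  refine le_of_mul_le_mul_left ?_ (by positivity : 0 < (1 / (12 * κ) * (N / 192)) ^ 2)
  rw [e1]
  exact h1.trans h2

/-- Few leave-one-out potentials exceed the threshold `18432 e¹⁶ κ ρ`, by Chebyshev's inequality. -/
lemma IsRegular.card_leaveOneOut_le
    (h : IsRegular N ρ κ (18432 * Real.exp 16 * κ * ρ) t e y) (hN : 192 ≤ N)
    (hκ : 1 ≤ κ) (hρ : 0 < ρ) (ht : ∀ i j, t i - t j ≤ Real.log κ) (i : Fin n) :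
    ((Finset.univ.filter fun j =>
      18432 * Real.exp 16 * κ * ρ < |leaveOneOut κ t i e y j|).card : ℝ) ≤ Real.exp (-32) * n := by
  have hκ0 : 0 < κ := by linarith
  have h1 := h.leaveOneOut_sum_sq_le hN hκ hρ.le ht i
  set B := Finset.univ.filter fun j =>
    18432 * Real.exp 16 * κ * ρ < |leaveOneOut κ t i e y j| with hB
  have h2 : (B.card : ℝ) * (18432 * Real.exp 16 * κ * ρ) ^ 2
      ≤ ∑ j, leaveOneOut κ t i e y j ^ 2 := by
    calc (B.card : ℝ) * (18432 * Real.exp 16 * κ * ρ) ^ 2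
        = ∑ _j ∈ B, (18432 * Real.exp 16 * κ * ρ) ^ 2 := by simp
      _ ≤ ∑ j ∈ B, leaveOneOut κ t i e y j ^ 2 := by
          refine Finset.sum_le_sum fun j hj => ?_
          rw [← sq_abs (leaveOneOut κ t i e y j)]
          simp only [hB, Finset.mem_filter, Finset.mem_univ, true_and] at hj
          exact pow_le_pow_left₀ (by positivity) hj.le 2
      _ ≤ _ := Finset.sum_le_sum_of_subset_of_nonneg (Finset.subset_univ _)
          fun j _ _ => sq_nonneg _
  have e1 : (18432 * Real.exp 16 * κ * ρ) ^ 2 = Real.exp 32 * (18432 * κ * ρ) ^ 2 := by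
    have : Real.exp 32 = Real.exp 16 ^ 2 := by rw [← Real.exp_nat_mul]; norm_num
    rw [this]; ring
  rw [e1] at h2
  have h3 : (B.card : ℝ) * Real.exp 32 ≤ n := by
    refine le_of_mul_le_mul_right ?_ (by positivity : 0 < (18432 * κ * ρ) ^ 2)
    linarith
  rw [Real.exp_neg, mul_comm, ← div_eq_mul_inv, le_div_iff₀ (Real.exp_pos _)]
  exact h3

/-- The sup-norm error if the condition number is at most of the order of the degrees: the
leave-one-out argument. -/
lemma IsRegular.sup_bound_of_kappa_le
    (h : IsRegular N ρ κ (18432 * Real.exp 16 * κ * ρ) t e y) (hN : 10 ^ 10 ≤ N) (hn : 9 ≤ n)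
    (hκ : 1 ≤ κ) (hκN : κ ≤ N / 10 ^ 6) (hρ : 0 < ρ) (ht : ∀ i j, t i - t j ≤ Real.log κ)
    {δ : Fin n → ℝ} (hδ : ∀ i, balance (adj e) (response κ t) (skew (noise t y)) δ i = 0)
    (hδs : ∑ i, δ i = 0) (i : Fin n) : |δ i| ≤ 10 ^ 5 * Real.exp 16 * κ * ρ := by
  have hκ0 : 0 < κ := by linarith
  have hN0 : 0 < N := by linarith
  have ha := isAdjacency_adj e
  have hE : 1 ≤ Real.exp 16 := Real.one_le_exp (by norm_num)
  have hκρ : 0 < κ * ρ := by positivity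
  obtain ⟨i₀, -, hmax⟩ := Finset.univ.exists_max_image (fun i => |δ i|) ⟨i, Finset.mem_univ i⟩
  refine (hmax i (Finset.mem_univ i)).trans ?_
  set b := |δ i₀| with hb
  rcases lt_or_ge b (4 * (18432 * Real.exp 16 * κ * ρ)) with hlt | hge
  · refine hlt.le.trans ?_
    have : 0 ≤ Real.exp 16 * κ * ρ := by positivity
    linarith
  · have hb0 : 0 < b := lt_of_lt_of_le (by positivity) hge
    obtain ⟨hs1, hs2, hs3⟩ := h.leaveOneOut_spec (by linarith) hκ ht i₀
    have hmul : κ * ρ ≤ Real.exp 16 * (κ * ρ) := le_mul_of_one_le_left hκρ.le hE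
    have hζ : 4 * Real.sqrt N * ρ ≤ b * Real.sqrt N / (4 * κ) := by
      rw [le_div_iff₀ (by positivity)]
      have h1 : 16 * (κ * ρ) ≤ b := by linarith
      have := mul_le_mul_of_nonneg_right h1 (Real.sqrt_nonneg N)
      linarith
    have hsq : Real.sqrt N ^ 2 = N := Real.sq_sqrt hN0.le
    have hsN : 10 ^ 5 ≤ Real.sqrt N := Real.le_sqrt_of_sq_le (by norm_num; linarith)
    -- square `h2` below: `56 ^ 2 = 3136` exceeds the product `64 * 3 * 16 = 3072`
    have hsmall : 64 * (3 * N * (2 * b + 4 * Real.sqrt N * ρ) ^ 2)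
        ≤ (N / 16) * b ^ 2 * (1 / (12 * κ) * (N / 192)) ^ 2 := by
      have h2 : 56 * (2 * b + 4 * Real.sqrt N * ρ) ≤ b * (1 / (12 * κ) * (N / 192)) := by
        have h3 : 56 * (2 * b + b * Real.sqrt N / (4 * κ))
            = b * ((56 * (2304 * (2 * κ) + 576 * Real.sqrt N)) / (2304 * κ)) := by
          field_simp; ring
        have h4 : (1 / (12 * κ) * (N / 192)) = N / (2304 * κ) := by field_simp; norm_num
        rw [h4]
        refine le_trans (by linarith) (h3.trans_le ?_)
        refine mul_le_mul_of_nonneg_left ?_ hb0.le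
        refine div_le_div_of_nonneg_right ?_ (by positivity)
        nlinarith
      have h5 := pow_le_pow_left₀ (by positivity) h2 2
      nlinarith [mul_le_mul_of_nonneg_left h5 hN0.le,
        mul_nonneg hN0.le (sq_nonneg (2 * b + 4 * Real.sqrt N * ρ))]
    have hdeg' : N / 4 ≤ ∑ j, adj e i₀ j := by
      have h1 := h.cut {i₀} (by simp; omega)
      rw [cutWeight, Finset.sum_singleton, Finset.card_singleton, Nat.cast_one, mul_one] at h1
      exact h1.trans (Finset.sum_le_sum_of_subset_of_nonneg (Finset.subset_univ _)
        fun j _ _ => ha.nonneg i₀ j)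
    have hfin := sup_bound_of_leaveOneOut (t := 18432 * Real.exp 16 * κ * ρ) ha
      (isResponse_response hκ ht) (by positivity) (by positivity : 0 < N / 192) i₀ (h.degree i₀)
      hdeg' (fun z => h.gap_deleteVertex (by linarith) i₀ z) (h.abs_skew_noise_le hρ.le)
      (h.node_noise i₀) hδ hδs hs1 hs2 hs3 (fun j => hmax j (Finset.mem_univ j)) rfl
      (by simpa using hn)
      (h.neighbours i₀ (h.card_leaveOneOut_le (by linarith) hκ hρ ht i₀)) hb0 hge hsmall
    have h6 : b ≤ 768 * (κ * ρ) := by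
      have e1 : 1 / (12 * κ) * b * N / 16 = b * N / (192 * κ) := by field_simp; norm_num
      rw [e1, div_le_iff₀ (by positivity)] at hfin
      refine le_of_mul_le_mul_right ?_ hN0
      linarith
    have : 0 ≤ Real.exp 16 * κ * ρ := by positivity
    linarith

/-- The sup-norm error from the growth of the level sets, with an additional factor `log n`. It is
used when the condition number exceeds the order of the degrees, and so absorbs this factor. -/
lemma IsRegular.sup_bound_of_le_kappa (h : IsRegular N ρ κ τ t e y) (hN : 0 < N) (hn : 2 ≤ n)
    (hκ : 1 ≤ κ) (hρ : 0 < ρ) (ht : ∀ i j, t i - t j ≤ Real.log κ)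
    {δ : Fin n → ℝ} (hδ : ∀ i, balance (adj e) (response κ t) (skew (noise t y)) δ i = 0)
    (hδs : ∑ i, δ i = 0) (i : Fin n) : |δ i| ≤ 20736 * Real.log n * κ * ρ := by
  have hκ0 : 0 < κ := by linarith
  have hlog : 1 / 2 ≤ Real.log n := by
    have h1 : Real.log 2 ≤ Real.log n := Real.log_le_log (by norm_num) (by exact_mod_cast hn)
    linarith [Real.log_two_gt_d9]
  set k := ⌈25 * Real.log n⌉₊ with hk
  have hk1 : 25 * Real.log n ≤ k := Nat.le_ceil _
  have hk2 : (k : ℝ) ≤ 27 * Real.log n := by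
    have := (Nat.ceil_lt_add_one (by positivity : 0 ≤ 25 * Real.log n)).le
    rw [← hk] at this
    linarith
  have hn0 : (0 : ℝ) < n := by positivity
  have hpow : ((Fintype.card (Fin n) : ℕ) : ℝ) < 2 * (1 + N / 4 / (2 * (3 * N))) ^ k := by
    have e1 : 1 + N / 4 / (2 * (3 * N)) = 25 / 24 := by field_simp; norm_num
    rw [e1, Fintype.card_fin]
    have h1 : (1 : ℝ) / 25 ≤ Real.log (25 / 24) := by
      have := Real.one_sub_inv_le_log_of_pos (by norm_num : (0 : ℝ) < 25 / 24)
      norm_num at this ⊢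
      linarith
    have h2 : (n : ℝ) ≤ (25 / 24) ^ k := by
      rw [← Real.log_le_log_iff hn0 (by positivity), Real.log_pow]
      nlinarith
    linarith
  have hosc : ∀ i j, δ i - δ j ≤ 20736 * Real.log n * κ * ρ := by
    intro i j
    have h1 := oscillation_le_of_expansion (isAdjacency_adj e) (isResponse_response hκ ht)
      (γ := 4 * N * ρ) (h := N / 4) (D := 3 * N) (Δ := 384 * κ * ρ) (by positivity) (by positivity)
      (by positivity) (by positivity) h.node_noise h.degree
      (le_of_eq (by field_simp; norm_num)) (by simpa using h.cut) hδ hpow i j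
    have h2 := mul_le_mul_of_nonneg_right hk2 (by positivity : 0 ≤ κ * ρ)
    nlinarith
  -- a centred function is bounded by its oscillation
  have hn' : (n : ℝ) * δ i = ∑ j, (δ i - δ j) := by
    rw [Finset.sum_sub_distrib, hδs]; simp
  have h1 : (n : ℝ) * δ i ≤ n * (20736 * Real.log n * κ * ρ) := by
    rw [hn']
    refine (Finset.sum_le_sum fun j _ => hosc i j).trans_eq (by simp)
  have h2 : -((n : ℝ) * δ i) ≤ n * (20736 * Real.log n * κ * ρ) := by
    rw [hn', ← Finset.sum_neg_distrib]
    refine (Finset.sum_le_sum fun j _ => ?_).trans_eq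
      (b := ∑ _j : Fin n, 20736 * Real.log n * κ * ρ) (by simp)
    linarith [hosc j i]
  rw [abs_le]
  constructor
  · refine le_of_mul_le_mul_left ?_ hn0
    linarith
  · exact le_of_mul_le_mul_left h1 hn0

/-- For regular data the score equations of the comparison model have a small centred solution. -/
theorem IsRegular.exists_score_solution
    (h : IsRegular N ρ κ (18432 * Real.exp 16 * κ * ρ) t e y) (hN : 10 ^ 10 ≤ N) (hn : 9 ≤ n)
    (hκ : 1 ≤ κ) (hρ : 0 < ρ) (ht : ∀ i j, t i - t j ≤ Real.log κ)
    {cp : ℝ} (hcp : 10 ^ 11 ≤ cp) (hcpN : cp * Real.log n ≤ N)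
    (hsmall₁ : 10 ^ 5 * Real.exp 16 * (κ * ρ) ≤ 1 / 2)
    (hsmall₂ : 10 ^ 11 * (κ ^ 2 * ρ) ≤ cp / 2) :
    ∃ δ : Fin n → ℝ, ∑ i, δ i = 0 ∧
      (∀ i, ∑ j, adj e i j * (Real.sigmoid (t i - t j + (δ i - δ j)) - Real.sigmoid (t i - t j)
        + skew (noise t y) i j) = 0) ∧
      ∑ i, δ i ^ 2 ≤ n * (4608 * κ * ρ) ^ 2 ∧
      ∀ i, |δ i| ≤ 10 ^ 5 * Real.exp 16 * (κ ^ 2 * ρ) := by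
  have hN0 : 0 < N := by linarith
  have hκ0 : 0 < κ := by linarith
  have hE : 1 ≤ Real.exp 16 := Real.one_le_exp (by norm_num)
  obtain ⟨δ, hδ, hδs⟩ := h.exists_solution hN0 hκ ht
  have hbound : ∀ i, |δ i| ≤ 1 / 2 ∧ |δ i| ≤ 10 ^ 5 * Real.exp 16 * (κ ^ 2 * ρ) := by
    intro i
    rcases le_or_gt κ (N / 10 ^ 6) with hκN | hκN
    · have h1 := h.sup_bound_of_kappa_le hN hn hκ hκN hρ ht hδ hδs i
      refine ⟨by linarith, h1.trans ?_⟩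
      have : κ * ρ ≤ κ ^ 2 * ρ := by nlinarith [mul_pos hκ0 hρ]
      have := mul_le_mul_of_nonneg_left this (by positivity : 0 ≤ 10 ^ 5 * Real.exp 16)
      linarith
    -- here `cp * log n ≤ N < 10 ^ 6 * κ`, so that `cp * log n * κ ≲ κ ^ 2`
    · have h1 := h.sup_bound_of_le_kappa hN0 (by omega) hκ hρ ht hδ hδs i
      have hlog : cp * Real.log n ≤ 10 ^ 6 * κ := by
        rw [div_lt_iff₀ (by norm_num)] at hκN
        linarith
      have h2 : cp * |δ i| ≤ 10 ^ 11 * (κ ^ 2 * ρ) := by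
        have h3 := mul_le_mul_of_nonneg_left h1 (by linarith : 0 ≤ cp)
        have h4 := mul_le_mul_of_nonneg_right hlog (by positivity : 0 ≤ κ * ρ)
        nlinarith [mul_pos (mul_pos hκ0 hκ0) hρ]
      refine ⟨?_, ?_⟩
      · refine le_of_mul_le_mul_left ?_ (by linarith : 0 < cp)
        linarith
      · have h5 := mul_le_mul_of_nonneg_right hcp (abs_nonneg (δ i))
        have h6 : |δ i| ≤ κ ^ 2 * ρ := by linarith
        refine h6.trans (le_mul_of_one_le_left (by positivity) ?_)
        linarith
  refine ⟨δ, hδs, fun i => ?_, h.sum_sq_le hN0 hκ ht hδ hδs, fun i => (hbound i).2⟩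
  rw [← hδ i, balance]
  refine Finset.sum_congr rfl fun j _ => ?_
  have hij : |δ i - δ j| ≤ 1 :=
    (abs_sub _ _).trans (by linarith [(hbound i).1, (hbound j).1])
  rw [response, clip_of_abs_le hij]
  ring

end Solution

/-! ### Tail bounds for independent indicators -/

section Tails

variable {Ω : Type*} [MeasurableSpace Ω] {μ : Measure Ω}
  {ι : Type*} {b : ι → Ω → Bool}

/-- The indicator of `b = true` as a real number. -/
def boolInd (b : Bool) : ℝ := if b then 1 else 0

lemma measurable_boolInd : Measurable boolInd := Measurable.of_discrete

lemma integral_boolInd {b : Ω → Bool} (hb : Measurable b) :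
    ∫ ω, boolInd (b ω) ∂μ = μ.real {ω | b ω = true} := by
  have h1 : (fun ω => boolInd (b ω)) = Set.indicator {ω | b ω = true} 1 := by
    ext ω
    by_cases h : b ω = true <;> simp [boolInd, h]
  rw [h1, integral_indicator_one]
  exact hb (measurableSet_singleton true)

lemma HasSubgaussianMGF.mono {X : Ω → ℝ} {c c' : NNReal} (h : HasSubgaussianMGF X c μ)
    (hc : c ≤ c') : HasSubgaussianMGF X c' μ :=
  ⟨h.integrable_exp_mul, fun t => (h.mgf_le t).trans (Real.exp_le_exp.2 (by
    have : (c : ℝ) ≤ c' := by exact_mod_cast hc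
    have := mul_le_mul_of_nonneg_right this (sq_nonneg t)
    linarith))⟩

/-- Functions of disjoint groups of independent bits are independent. -/
lemma indepFun_of_disjoint [Fintype ι] (hb : ∀ i, Measurable (b i)) (hind : iIndepFun b μ)
    (P Q : ι → Prop) [DecidablePred P] [DecidablePred Q] (hPQ : ∀ i, ¬(P i ∧ Q i))
    {α β : Type*} [MeasurableSpace α] [MeasurableSpace β] (F : (ι → Bool) → α)
    (G : (ι → Bool) → β) :
    IndepFun (fun ω => F fun i => if P i then b i ω else false)
      (fun ω => G fun i => if Q i then b i ω else false) μ := by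
  classical
  have h1 := iIndepFun.indepFun_finset (Finset.univ.filter P) (Finset.univ.filter Q) (by
    rw [Finset.disjoint_filter]
    exact fun i _ h1 h2 => hPQ i ⟨h1, h2⟩) hind hb
  have h2 := h1.comp
    (φ := fun a => F fun i => if h : P i then a ⟨i, by simpa using h⟩ else false)
    (ψ := fun a => G fun i => if h : Q i then a ⟨i, by simpa using h⟩ else false)
    Measurable.of_discrete Measurable.of_discrete
  simpa only [Function.comp_def, dite_eq_ite] using h2

variable [IsProbabilityMeasure μ]

lemma mgf_boolInd_le {b : Ω → Bool} (hb : Measurable b) (l : ℝ) :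
    mgf (fun ω => boolInd (b ω)) μ l
      ≤ Real.exp (μ.real {ω | b ω = true} * (Real.exp l - 1)) := by
  have h1 : ∀ ω, Real.exp (l * boolInd (b ω)) = 1 + (Real.exp l - 1) * boolInd (b ω) := by
    intro ω
    by_cases h : b ω = true <;> simp [boolInd, h]
  have hint : Integrable (fun ω => boolInd (b ω)) μ := by
    refine Integrable.of_bound (measurable_boolInd.comp hb).aestronglyMeasurable 1
      (ae_of_all _ fun ω => ?_)
    unfold boolInd
    split_ifs <;> simp
  rw [mgf]
  simp only [h1]
  rw [integral_add (integrable_const _) (hint.const_mul _), integral_const_mul,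
    integral_boolInd hb]
  simp only [integral_const, probReal_univ, smul_eq_mul, one_mul]
  rw [mul_comm, add_comm]
  exact Real.add_one_le_exp _

lemma mgf_sum_boolInd_le (hb : ∀ i, Measurable (b i)) (hind : iIndepFun b μ) {p : ℝ}
    (hp : ∀ i, μ.real {ω | b i ω = true} = p) (T : Finset ι) (l : ℝ) :
    mgf (fun ω => ∑ i ∈ T, boolInd (b i ω)) μ l
      ≤ Real.exp (T.card * (p * (Real.exp l - 1))) := by
  have h1 : iIndepFun (fun i ω => boolInd (b i ω)) μ :=
    hind.comp (fun _ => boolInd) (fun _ => measurable_boolInd)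
  have h2 := h1.mgf_sum (t := l) (fun i => measurable_boolInd.comp (hb i)) T
  have e : (∑ i ∈ T, fun ω => boolInd (b i ω)) = fun ω => ∑ i ∈ T, boolInd (b i ω) := by
    ext ω; simp
  rw [e] at h2
  rw [h2, Real.exp_nat_mul, ← Finset.prod_const]
  refine Finset.prod_le_prod (fun i _ => mgf_nonneg) fun i _ => ?_
  rw [← hp i]
  exact mgf_boolInd_le (hb i) l

lemma integrable_exp_mul_sum_boolInd (hb : ∀ i, Measurable (b i)) (T : Finset ι) (l : ℝ) :
    Integrable (fun ω => Real.exp (l * ∑ i ∈ T, boolInd (b i ω))) μ := by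
  refine Integrable.of_bound (C := Real.exp (|l| * T.card)) ?_ (ae_of_all _ fun ω => ?_)
  · refine Measurable.aestronglyMeasurable ?_
    exact Real.measurable_exp.comp ((Finset.measurable_sum T fun i _ =>
      measurable_boolInd.comp (hb i)).const_mul l)
  · rw [Real.norm_eq_abs, Real.abs_exp, Real.exp_le_exp]
    have h0 : ∀ i, 0 ≤ boolInd (b i ω) ∧ boolInd (b i ω) ≤ 1 := by
      intro i; unfold boolInd; split_ifs <;> norm_num
    have h1 : ∑ i ∈ T, boolInd (b i ω) ≤ T.card := by
      refine (Finset.sum_le_sum fun i _ => (h0 i).2).trans_eq (by simp)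
    have h2 : 0 ≤ ∑ i ∈ T, boolInd (b i ω) := Finset.sum_nonneg fun i _ => (h0 i).1
    exact (mul_le_mul_of_nonneg_right (le_abs_self l) h2).trans
      (mul_le_mul_of_nonneg_left h1 (abs_nonneg l))

/-- Chernoff bound for the upper tail of a binomial sum. -/
lemma measure_sum_boolInd_ge_le (hb : ∀ i, Measurable (b i)) (hind : iIndepFun b μ) {p : ℝ}
    (hp : ∀ i, μ.real {ω | b i ω = true} = p) (T : Finset ι) {l : ℝ} (hl : 0 ≤ l) (s : ℝ) :
    μ.real {ω | s ≤ ∑ i ∈ T, boolInd (b i ω)}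
      ≤ Real.exp (-l * s + T.card * (p * (Real.exp l - 1))) := by
  rw [Real.exp_add]
  exact (measure_ge_le_exp_mul_mgf s hl (integrable_exp_mul_sum_boolInd hb T l)).trans
    (mul_le_mul_of_nonneg_left (mgf_sum_boolInd_le hb hind hp T l) (Real.exp_pos _).le)

/-- Chernoff bound for the lower tail of a binomial sum. -/
lemma measure_sum_boolInd_le_le (hb : ∀ i, Measurable (b i)) (hind : iIndepFun b μ) {p : ℝ}
    (hp : ∀ i, μ.real {ω | b i ω = true} = p) (T : Finset ι) {l : ℝ} (hl : l ≤ 0) (s : ℝ) :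
    μ.real {ω | ∑ i ∈ T, boolInd (b i ω) ≤ s}
      ≤ Real.exp (-l * s + T.card * (p * (Real.exp l - 1))) := by
  rw [Real.exp_add]
  exact (measure_le_le_exp_mul_mgf s hl (integrable_exp_mul_sum_boolInd hb T l)).trans
    (mul_le_mul_of_nonneg_left (mgf_sum_boolInd_le hb hind hp T l) (Real.exp_pos _).le)

lemma hasSubgaussianMGF_boolInd {b : Ω → Bool} (hb : Measurable b) {c : ℝ} (hc : |c| ≤ 1) :
    HasSubgaussianMGF (fun ω => c * (μ.real {ω | b ω = true} - boolInd (b ω))) (1 / 4) μ := by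
  have h1 := hasSubgaussianMGF_of_mem_Icc (μ := μ) (X := fun ω => boolInd (b ω)) (a := 0) (b := 1)
    (measurable_boolInd.comp hb).aemeasurable (ae_of_all _ fun ω => by
      unfold boolInd; split_ifs <;> simp)
  rw [integral_boolInd hb] at h1
  have h2 := h1.const_mul (-c)
  refine HasSubgaussianMGF.mono (h2.congr (ae_of_all _ fun ω => ?_)) ?_
  · simp only; ring
  · rw [← NNReal.coe_le_coe]
    have h3 : c ^ 2 ≤ 1 := (sq_le_one_iff_abs_le_one c).2 hc
    change (-c) ^ 2 * (((‖(1 : ℝ) - 0‖₊ / 2) ^ 2 : NNReal) : ℝ) ≤ ((1 / 4 : NNReal) : ℝ)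
    norm_num
    linarith

/-- Hoeffding bound for weighted sums of centred indicators with weights in `[-1, 1]`. -/
lemma measure_abs_sum_boolInd_ge_le (hb : ∀ i, Measurable (b i)) (hind : iIndepFun b μ)
    {c : ι → ℝ} (hc : ∀ i, |c i| ≤ 1) (T : Finset ι) {M : ℝ} (hT : (T.card : ℝ) ≤ M)
    {ε : ℝ} (hε : 0 ≤ ε) :
    μ.real {ω | ε ≤ |∑ i ∈ T, c i * (μ.real {ω | b i ω = true} - boolInd (b i ω))|}
      ≤ 2 * Real.exp (-2 * ε ^ 2 / M) := by
  have hM : 0 ≤ M := (Nat.cast_nonneg _).trans hT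
  have key : ∀ c : ι → ℝ, (∀ i, |c i| ≤ 1) →
      μ.real {ω | ε ≤ ∑ i ∈ T, c i * (μ.real {ω | b i ω = true} - boolInd (b i ω))}
        ≤ Real.exp (-2 * ε ^ 2 / M) := by
    intro c hc
    have h1 : iIndepFun (fun i ω => c i * (μ.real {ω | b i ω = true} - boolInd (b i ω))) μ :=
      hind.comp (fun i u => c i * (μ.real {ω | b i ω = true} - boolInd u))
        (fun _ => Measurable.of_discrete)
    have h2 := HasSubgaussianMGF.sum_of_iIndepFun h1 (s := T) (c := fun _ => 1 / 4)
      (fun i _ => hasSubgaussianMGF_boolInd (hb i) (hc i))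
    have h3 := (HasSubgaussianMGF.mono h2 (c' := (M / 4).toNNReal) (by
      rw [← NNReal.coe_le_coe, Real.coe_toNNReal _ (by positivity)]
      simp; linarith)).measure_ge_le hε
    rw [Real.coe_toNNReal _ (by positivity)] at h3
    refine h3.trans_eq ?_
    congr 1
    rcases hM.eq_or_lt with h | h
    · rw [← h]; simp
    · field_simp; norm_num
  have h1 := key c hc
  have h2 := key (fun i => -c i) (fun i => by rw [abs_neg]; exact hc i)
  have hsub : {ω | ε ≤ |∑ i ∈ T, c i * (μ.real {ω | b i ω = true} - boolInd (b i ω))|}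
      ⊆ {ω | ε ≤ ∑ i ∈ T, c i * (μ.real {ω | b i ω = true} - boolInd (b i ω))}
        ∪ {ω | ε ≤ ∑ i ∈ T, -c i * (μ.real {ω | b i ω = true} - boolInd (b i ω))} := by
    intro ω hω
    simp only [Set.mem_union, Set.mem_ofPred_eq] at hω ⊢
    rcases le_abs.1 hω with h | h
    · exact Or.inl h
    · right
      simpa [Finset.sum_neg_distrib] using h
  have h3 := (measureReal_mono (μ := μ) hsub).trans (measureReal_union_le _ _)
  linarith

/-- If `U` and `W` are independent and each section of an event has probability at most `ε`, then
so has the event. -/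
lemma measure_le_of_indepFun {α β : Type*} [Fintype α] [MeasurableSpace α]
    [MeasurableSingletonClass α] [MeasurableSpace β] [DiscreteMeasurableSpace β]
    {U : Ω → α} {W : Ω → β} (hU : Measurable U) (hind : IndepFun U W μ)
    (E : α → Set β) {ε : ℝ} (hε : ∀ u, μ.real {ω | W ω ∈ E u} ≤ ε) :
    μ.real {ω | W ω ∈ E (U ω)} ≤ ε := by
  have hsub : {ω | W ω ∈ E (U ω)} ⊆ ⋃ u, U ⁻¹' {u} ∩ W ⁻¹' (E u) := by
    intro ω hω
    simp only [Set.mem_iUnion]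
    exact ⟨U ω, rfl, hω⟩
  have h1 : ∑ u, μ.real (U ⁻¹' {u}) = 1 := by
    rw [sum_measureReal_preimage_singleton _ fun y _ => hU (measurableSet_singleton y)]
    simp
  calc μ.real {ω | W ω ∈ E (U ω)} ≤ ∑ u, μ.real (U ⁻¹' {u} ∩ W ⁻¹' (E u)) :=
        (measureReal_mono hsub).trans (measureReal_iUnion_fintype_le _)
    _ = ∑ u, μ.real (U ⁻¹' {u}) * μ.real (W ⁻¹' (E u)) := by
        refine Finset.sum_congr rfl fun u _ => ?_
        simp only [Measure.real]
        rw [hind.measure_inter_preimage_eq_mul _ _ (measurableSet_singleton u)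
          (MeasurableSet.of_discrete), ENNReal.toReal_mul]
    _ ≤ ∑ u, μ.real (U ⁻¹' {u}) * ε :=
        Finset.sum_le_sum fun u _ => mul_le_mul_of_nonneg_left (hε u) measureReal_nonneg
    _ = ε := by rw [← Finset.sum_mul, h1, one_mul]

end Tails

/-! ### Regularity of the data with high probability -/

section Regular

variable {n d L : ℕ}

/-- The pairs with one item in `A` and the other one in `B`. -/
def pairsBetween (A B : Finset (Fin n)) : Finset (Pair n) :=
  Finset.univ.filter fun q => (q.hi ∈ A ∧ q.lo ∈ B) ∨ (q.lo ∈ A ∧ q.hi ∈ B)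

lemma sum_adj_eq (e : Pair n → Bool) {A B : Finset (Fin n)}
    (hAB : ∀ q : Pair n, ¬((q.hi ∈ A ∧ q.lo ∈ B) ∧ (q.lo ∈ A ∧ q.hi ∈ B))) :
    ∑ i ∈ A, ∑ j ∈ B, adj e i j = ∑ q ∈ pairsBetween A B, boolInd (e q) := by
  have h1 : ∑ i ∈ A, ∑ j ∈ B, adj e i j
      = ∑ i, ∑ j, adj e i j * if i ∈ A ∧ j ∈ B then 1 else 0 := by
    rw [← Finset.sum_subset (Finset.subset_univ A)]
    · refine Finset.sum_congr rfl fun i hi => ?_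
      rw [← Finset.sum_subset (Finset.subset_univ B)]
      · exact Finset.sum_congr rfl fun j hj => by simp [hi, hj]
      · intro j _ hj; simp [hj]
    · intro i _ hi; simp [hi]
  rw [h1, sum_adj_mul, pairsBetween, Finset.sum_filter]
  refine Finset.sum_congr rfl fun q _ => ?_
  have := hAB q
  unfold boolInd
  by_cases h2 : q.hi ∈ A ∧ q.lo ∈ B <;> by_cases h3 : q.lo ∈ A ∧ q.hi ∈ B
  · exact absurd ⟨h2, h3⟩ this
  all_goals simp [h2, h3]

lemma card_pairsBetween_le {A B : Finset (Fin n)}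
    (hAB : ∀ q : Pair n, ¬((q.hi ∈ A ∧ q.lo ∈ B) ∧ (q.lo ∈ A ∧ q.hi ∈ B))) :
    ((pairsBetween A B).card : ℝ) ≤ A.card * B.card := by
  have h1 := sum_adj_eq (fun _ => true) hAB
  simp only [boolInd, if_true, Finset.sum_const, nsmul_eq_mul, mul_one] at h1
  rw [← h1]
  calc ∑ i ∈ A, ∑ j ∈ B, adj (fun _ => true) i j ≤ ∑ _i ∈ A, ∑ _j ∈ B, (1 : ℝ) :=
        Finset.sum_le_sum fun i _ => Finset.sum_le_sum fun j _ => (isAdjacency_adj _).le_one i j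
    _ = A.card * B.card := by simp

lemma card_pairsBetween_compl (S : Finset (Fin n)) :
    ((pairsBetween S Sᶜ).card : ℝ) = S.card * (n - S.card) := by
  have hAB : ∀ q : Pair n, ¬((q.hi ∈ S ∧ q.lo ∈ Sᶜ) ∧ (q.lo ∈ S ∧ q.hi ∈ Sᶜ)) := by
    rintro q ⟨⟨h1, -⟩, -, h2⟩
    exact Finset.mem_compl.1 h2 h1
  have h1 := sum_adj_eq (fun _ => true) hAB
  simp only [boolInd, if_true, Finset.sum_const, nsmul_eq_mul, mul_one] at h1
  rw [← h1]
  have h2 : ∀ i ∈ S, ∀ j ∈ Sᶜ, adj (fun _ => true) i j = 1 := by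
    intro i hi j hj
    have hne : i ≠ j := by rintro rfl; exact Finset.mem_compl.1 hj hi
    unfold adj
    rcases lt_or_gt_of_ne hne with h | h <;> simp [h, h.not_gt]
  rw [Finset.sum_congr rfl fun i hi => Finset.sum_congr rfl fun j hj => h2 i hi j hj]
  simp only [Finset.sum_const, nsmul_eq_mul, mul_one, Finset.card_compl, Fintype.card_fin]
  rw [Nat.cast_sub (by simpa using Finset.card_le_univ S)]

lemma pairsBetween_singleton (i : Fin n) (B : Finset (Fin n)) (q : Pair n) :
    ¬((q.hi ∈ ({i} : Finset (Fin n)) ∧ q.lo ∈ B) ∧ (q.lo ∈ ({i} : Finset (Fin n)) ∧ q.hi ∈ B)) := by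
  rintro ⟨⟨h1, -⟩, h2, -⟩
  rw [Finset.mem_singleton] at h1 h2
  have : q.lo < q.hi := q.2
  rw [h1, h2] at this
  exact lt_irrefl _ this

lemma leaveOneOut_mask (κ : ℝ) (t : Fin n → ℝ) (i : Fin n) (e : Pair n → Bool)
    (y : Pair n → Fin L → Bool) :
    leaveOneOut κ t i (mask i e) (mask i y) = leaveOneOut κ t i e y := by
  have h1 : mask i (mask i e) = mask i e := by
    ext q; unfold mask; split_ifs <;> rfl
  have h2 : mask i (mask i y) = mask i y := by
    ext q; unfold mask; split_ifs <;> rfl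
  unfold leaveOneOut
  rw [h1, h2]

lemma noise_eq_sum (hL : 1 ≤ L) (t : Fin n → ℝ) (y : Pair n → Fin L → Bool) (q : Pair n) :
    noise t y q = (∑ l, (Real.sigmoid (t q.hi - t q.lo) - boolInd (y q l))) / L := by
  have hL0 : (L : ℝ) ≠ 0 := by positivity
  rw [noise, freq, Finset.sum_sub_distrib, sub_div]
  congr 1
  simp [hL0]

variable {Ω : Type*} [MeasurableSpace Ω] {μ : Measure Ω} {p : ℝ}
  {x : Fin n → EuclideanSpace ℝ (Fin d)} {θ : Param n d} {edge : Pair n → Ω → Bool}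
  {y : Pair n → Fin L → Ω → Bool}

lemma exp_neg_le_inv_pow {s : ℝ} {k : ℕ} (hn : 1 ≤ n) (hs : k * Real.log n ≤ s) :
    Real.exp (-s) ≤ ((n : ℝ) ^ k)⁻¹ := by
  have hn0 : (0 : ℝ) < n := by positivity
  rw [Real.exp_neg]
  refine inv_anti₀ (by positivity) ?_
  have h1 : (n : ℝ) ^ k = Real.exp (k * Real.log n) := by
    rw [Real.exp_nat_mul, Real.exp_log hn0]
  rw [h1]
  exact Real.exp_le_exp.2 hs

lemma IsModel.iIndepFun_edge (h : IsModel μ p x θ edge y) : iIndepFun edge μ :=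
  iIndepFun.precomp (g := Sum.inl) Sum.inl_injective h.indep

lemma IsModel.iIndepFun_y (h : IsModel μ p x θ edge y) :
    iIndepFun (fun r : Pair n × Fin L => y r.1 r.2) μ :=
  iIndepFun.precomp (g := Sum.inr) Sum.inr_injective h.indep

lemma IsModel.measurable (h : IsModel μ p x θ edge y) (k : Pair n ⊕ (Pair n × Fin L)) :
    Measurable ((Sum.elim edge fun r : Pair n × Fin L => y r.1 r.2 :
      Pair n ⊕ (Pair n × Fin L) → Ω → Bool) k) := by
  rcases k with q | r
  · exact h.measurable_edge q
  · exact h.measurable_y r.1 r.2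

lemma IsModel.prob_y_eq (h : IsModel μ p x θ edge y) (q : Pair n) (l : Fin L) :
    μ.real {ω | y q l ω = true} = Real.sigmoid (score x θ q.hi - score x θ q.lo) := by
  rw [h.prob_y, Real.sigmoid_def, expScore, expScore]
  have h1 := Real.exp_pos (score x θ q.hi)
  have h2 := Real.exp_pos (score x θ q.lo)
  rw [neg_sub, Real.exp_sub]
  field_simp

variable [IsProbabilityMeasure μ]

/-- Edge expansion of the Erdős–Rényi graph, by a union bound over all cuts: a set of size `k` fails
with probability at most `ξ ^ k`, `ξ = e ^ (-n p / 16)`, and these add up to `(1 + ξ) ^ n - 1`. -/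
lemma IsModel.measure_cut_le (h : IsModel μ p x θ edge y) (hn : 1 ≤ n) (hp : 0 ≤ p)
    (hN : 128 * Real.log n ≤ n * p) :
    μ.real {ω | ∃ S : Finset (Fin n), 2 * S.card ≤ n ∧
      cutWeight (adj fun q => edge q ω) S < n * p / 4 * S.card} ≤ 2 * ((n : ℝ) ^ 6)⁻¹ := by
  have hn0 : (0 : ℝ) < n := by positivity
  set ξ := Real.exp (-(n * p / 16)) with hξ
  have hξ0 : 0 ≤ ξ := (Real.exp_pos _).le
  have hone : ∀ S : Finset (Fin n), μ.real {ω | 2 * S.card ≤ n ∧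
      cutWeight (adj fun q => edge q ω) S < n * p / 4 * S.card} ≤ ξ ^ S.card := by
    intro S
    by_cases hS : 2 * S.card ≤ n
    · have hAB : ∀ q : Pair n, ¬((q.hi ∈ S ∧ q.lo ∈ Sᶜ) ∧ (q.lo ∈ S ∧ q.hi ∈ Sᶜ)) := by
        rintro q ⟨⟨h1, -⟩, -, h2⟩
        exact Finset.mem_compl.1 h2 h1
      have hsub : {ω | 2 * S.card ≤ n ∧
          cutWeight (adj fun q => edge q ω) S < n * p / 4 * S.card}
          ⊆ {ω | ∑ q ∈ pairsBetween S Sᶜ, boolInd (edge q ω) ≤ n * p / 4 * S.card} := by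
        rintro ω ⟨-, hω⟩
        rw [cutWeight, sum_adj_eq _ hAB] at hω
        exact hω.le
      refine (measureReal_mono hsub).trans ((measure_sum_boolInd_le_le h.measurable_edge
        h.iIndepFun_edge h.prob_edge (pairsBetween S Sᶜ) (l := -(1 / 2)) (by norm_num) _).trans ?_)
      rw [hξ, ← Real.exp_nat_mul, card_pairsBetween_compl]
      refine Real.exp_le_exp.2 ?_
      have h1 : Real.exp (-(1 / 2)) - 1 ≤ -(3 / 8) := by
        have h2 := Real.quadratic_le_exp_of_nonneg (by norm_num : (0 : ℝ) ≤ 1 / 2)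
        have h3 : Real.exp (-(1 / 2)) * Real.exp (1 / 2) = 1 := by rw [← Real.exp_add]; simp
        have h4 := Real.exp_pos (-(1 / 2))
        nlinarith
      have h5 : (n : ℝ) / 2 ≤ n - S.card := by
        have : (2 : ℝ) * S.card ≤ n := by exact_mod_cast hS
        linarith
      have h6 : (0 : ℝ) ≤ S.card := Nat.cast_nonneg _
      have h7 := mul_le_mul_of_nonneg_left h1 (mul_nonneg (mul_nonneg h6
        (show (0 : ℝ) ≤ n - S.card by linarith)) hp)
      have h8 := mul_le_mul_of_nonneg_left h5 (mul_nonneg h6 hp)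
      nlinarith
    · simp only [hS, false_and]
      simp only [Set.ofPred_false, measureReal_empty]
      positivity
  have hsub : {ω | ∃ S : Finset (Fin n), 2 * S.card ≤ n ∧
      cutWeight (adj fun q => edge q ω) S < n * p / 4 * S.card}
      ⊆ ⋃ S ∈ Finset.univ.erase (∅ : Finset (Fin n)), {ω | 2 * S.card ≤ n ∧
      cutWeight (adj fun q => edge q ω) S < n * p / 4 * S.card} := by
    rintro ω ⟨S, hS⟩
    simp only [Set.mem_iUnion]
    refine ⟨S, ?_, hS⟩
    simp only [Finset.mem_erase, Finset.mem_univ, and_true]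
    rintro rfl
    simp [cutWeight] at hS
  have hsum : ∑ S ∈ Finset.univ.erase (∅ : Finset (Fin n)), ξ ^ S.card = (1 + ξ) ^ n - 1 := by
    have h1 := Finset.sum_pow_mul_eq_add_pow ξ 1 (Finset.univ : Finset (Fin n))
    simp only [one_pow, mul_one, Finset.powerset_univ, Finset.card_univ, Fintype.card_fin] at h1
    rw [add_comm ξ 1] at h1
    rw [← h1, ← Finset.add_sum_erase _ _ (Finset.mem_univ (∅ : Finset (Fin n)))]
    simp
  have hξn : n * ξ ≤ ((n : ℝ) ^ 6)⁻¹ := by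
    have h1 : ξ ≤ ((n : ℝ) ^ 7)⁻¹ := by
      refine exp_neg_le_inv_pow hn ?_
      have := Real.log_natCast_nonneg n
      push_cast
      linarith
    calc n * ξ ≤ n * ((n : ℝ) ^ 7)⁻¹ := by gcongr
      _ = ((n : ℝ) ^ 6)⁻¹ := by field_simp
  have hpow : (1 + ξ) ^ n - 1 ≤ 2 * (n * ξ) := by
    have h1 : (1 + ξ) ^ n ≤ Real.exp (n * ξ) := by
      rw [Real.exp_nat_mul]
      exact pow_le_pow_left₀ (by positivity) (by linarith [Real.add_one_le_exp ξ]) n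
    have h2 : n * ξ ≤ 1 := hξn.trans (inv_le_one_of_one_le₀ (one_le_pow₀ (by exact_mod_cast hn)))
    have h3 := Real.abs_exp_sub_one_le (x := n * ξ) (by
      rw [abs_of_nonneg (by positivity)]; exact h2)
    rw [abs_of_nonneg (by positivity : 0 ≤ n * ξ)] at h3
    linarith [le_abs_self (Real.exp (n * ξ) - 1)]
  calc _ ≤ ∑ S ∈ Finset.univ.erase (∅ : Finset (Fin n)), μ.real {ω | 2 * S.card ≤ n ∧
        cutWeight (adj fun q => edge q ω) S < n * p / 4 * S.card} :=
        (measureReal_mono hsub (measure_ne_top μ _)).trans (measureReal_biUnion_finset_le _ _)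
    _ ≤ ∑ S ∈ Finset.univ.erase (∅ : Finset (Fin n)), ξ ^ S.card :=
        Finset.sum_le_sum fun S _ => hone S
    _ ≤ 2 * ((n : ℝ) ^ 6)⁻¹ := by rw [hsum]; linarith

/-- A union bound over the items. -/
lemma measure_exists_le {P : Fin n → Ω → Prop} {ε : ℝ} (hP : ∀ i, μ.real {ω | P i ω} ≤ ε) :
    μ.real {ω | ∃ i, P i ω} ≤ n * ε := by
  have hsub : {ω | ∃ i, P i ω} ⊆ ⋃ i, {ω | P i ω} := by
    rintro ω ⟨i, hi⟩
    exact Set.mem_iUnion.2 ⟨i, hi⟩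
  refine (measureReal_mono hsub).trans ((measureReal_iUnion_fintype_le _).trans ?_)
  refine (Finset.sum_le_sum fun i _ => hP i).trans_eq ?_
  simp

lemma natCast_mul_inv_pow (hn : 1 ≤ n) (k : ℕ) :
    (n : ℝ) * ((n : ℝ) ^ (k + 1))⁻¹ = ((n : ℝ) ^ k)⁻¹ := by
  have hn0 : (0 : ℝ) < n := by positivity
  rw [pow_succ]
  field_simp

lemma IsModel.measure_degree_le (h : IsModel μ p x θ edge y) (hn : 1 ≤ n) (hp : 0 ≤ p)
    (hN : 128 * Real.log n ≤ n * p) :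
    μ.real {ω | ∃ i, 3 * (n * p) < ∑ j, adj (fun q => edge q ω) i j} ≤ ((n : ℝ) ^ 6)⁻¹ := by
  rw [← natCast_mul_inv_pow hn]
  refine measure_exists_le fun i => ?_
  have hsub : {ω | 3 * (n * p) < ∑ j, adj (fun q => edge q ω) i j}
      ⊆ {ω | 3 * (n * p) ≤ ∑ q ∈ pairsBetween {i} Finset.univ, boolInd (edge q ω)} := by
    intro ω hω
    simp only [Set.mem_ofPred_eq] at hω ⊢
    rw [← sum_adj_eq _ (pairsBetween_singleton i _), Finset.sum_singleton]
    exact hω.le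
  refine (measureReal_mono hsub).trans ((measure_sum_boolInd_ge_le h.measurable_edge
    h.iIndepFun_edge h.prob_edge _ zero_le_one _).trans ?_)
  refine le_trans (Real.exp_le_exp.2 ?_) (exp_neg_le_inv_pow (s := n * p) hn ?_)
  · have h1 := card_pairsBetween_le (pairsBetween_singleton i Finset.univ)
    simp only [Finset.card_singleton, Nat.cast_one, one_mul, Finset.card_univ,
      Fintype.card_fin] at h1
    have h2 : p * (Real.exp 1 - 1) ≤ p * 2 :=
      mul_le_mul_of_nonneg_left (by linarith [Real.exp_one_lt_d9]) hp
    have h3 := mul_le_mul_of_nonneg_left h2 (Nat.cast_nonneg (pairsBetween {i} Finset.univ).card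
      (α := ℝ))
    have h4 := mul_le_mul_of_nonneg_right h1 hp
    linarith
  · have := Real.log_natCast_nonneg n
    push_cast
    linarith

/-- The squared noise level times `n p` is `log n / L`. -/
lemma mul_noiseLevel_sq {N ρ : ℝ} (hN : 0 < N) (hL : 1 ≤ L)
    (hρ : ρ = Real.sqrt (Real.log n / (N * L))) : N * L * ρ ^ 2 = Real.log n := by
  have hL0 : (0 : ℝ) < L := by positivity
  rw [hρ, Real.sq_sqrt (div_nonneg (Real.log_natCast_nonneg n) (by positivity))]
  field_simp

lemma IsModel.measure_pair_noise_le (h : IsModel μ p x θ edge y) (hn : 1 ≤ n) (hL : 1 ≤ L)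
    {N ρ : ℝ} (hN : 0 < N) (hρ : ρ = Real.sqrt (Real.log n / (N * L))) :
    μ.real {ω | ∃ q, 4 * Real.sqrt N * ρ < |noise (score x θ) (fun q l => y q l ω) q|}
      ≤ 2 * ((n : ℝ) ^ 6)⁻¹ := by
  have hL0 : (0 : ℝ) < L := by positivity
  have hρ0 : 0 ≤ ρ := hρ ▸ Real.sqrt_nonneg _
  have hsub : {ω | ∃ q, 4 * Real.sqrt N * ρ < |noise (score x θ) (fun q l => y q l ω) q|}
      ⊆ {ω | ∃ i j, ∃ hij : j < i, 4 * Real.sqrt N * ρ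
        < |noise (score x θ) (fun q l => y q l ω) ⟨(i, j), hij⟩|} := by
    rintro ω ⟨q, hq⟩
    exact ⟨q.hi, q.lo, q.2, hq⟩
  refine (measureReal_mono hsub).trans ?_
  have h6 : 2 * ((n : ℝ) ^ 6)⁻¹ = n * (n * (2 * ((n : ℝ) ^ 8)⁻¹)) := by
    have hn0 : (0 : ℝ) < n := by positivity
    field_simp
  rw [h6]
  refine measure_exists_le fun i => measure_exists_le fun j => ?_
  by_cases hij : j < i
  · simp only [hij, exists_true_left]
    set q : Pair n := ⟨(i, j), hij⟩
    set ε := L * (4 * Real.sqrt N * ρ) with hε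
    have hsub2 : {ω | 4 * Real.sqrt N * ρ < |noise (score x θ) (fun q l => y q l ω) q|}
        ⊆ {ω | ε ≤ |∑ r ∈ ({q} : Finset (Pair n)) ×ˢ (Finset.univ : Finset (Fin L)),
          1 * (μ.real {ω | y r.1 r.2 ω = true} - boolInd (y r.1 r.2 ω))|} := by
      intro ω hω
      simp only [Set.mem_ofPred_eq] at hω ⊢
      rw [noise_eq_sum hL, abs_div, abs_of_pos hL0, lt_div_iff₀ hL0] at hω
      rw [Finset.sum_product, Finset.sum_singleton]
      simp only [one_mul, h.prob_y_eq]
      linarith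
    refine (measureReal_mono hsub2).trans ((measure_abs_sum_boolInd_ge_le
      (b := fun r : Pair n × Fin L => y r.1 r.2) (M := L) (fun r => h.measurable_y r.1 r.2)
      h.iIndepFun_y (c := fun _ => 1) (by simp) _ (by simp) (by positivity)).trans ?_)
    refine mul_le_mul_of_nonneg_left ?_ (by norm_num)
    have e1 : -2 * ε ^ 2 / L = -(32 * Real.log n) := by
      rw [hε, mul_pow, mul_pow, mul_pow, Real.sq_sqrt hN.le, ← mul_noiseLevel_sq hN hL hρ]
      field_simp; ring
    rw [e1]
    refine exp_neg_le_inv_pow hn ?_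
    have := Real.log_natCast_nonneg n
    push_cast
    linarith
  · have : {ω | ∃ hij : j < i, 4 * Real.sqrt N * ρ
        < |noise (score x θ) (fun q l => y q l ω) ⟨(i, j), hij⟩|} = ∅ := by
      ext ω; simp [hij]
    rw [this, measureReal_empty]
    positivity

lemma sum_adj_mul_skew (e : Pair n → Bool) (v : Pair n → ℝ) (i : Fin n) :
    ∑ j, adj e i j * skew v i j
      = ∑ q ∈ (pairsBetween {i} Finset.univ).filter fun q => e q = true,
        ((if q.hi = i then 1 else 0) - if q.lo = i then 1 else 0) * v q := by
  have h1 := sum_pair_mul_sub e v (fun k => if k = i then (1 : ℝ) else 0)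
  simp only [ite_mul, one_mul, zero_mul, Finset.sum_ite_eq', Finset.mem_univ, if_true] at h1
  rw [← h1, pairsBetween, Finset.filter_filter, Finset.sum_filter]
  refine Finset.sum_congr rfl fun q _ => ?_
  by_cases he : e q = true <;> by_cases h2 : q.hi = i <;> by_cases h3 : q.lo = i <;>
    simp [he, h2, h3]

/-- The noise at a node, conditionally on the comparison graph: Hoeffding's inequality for the at
most `3 n p L` comparisons of the node. -/
lemma IsModel.measure_node_noise_le (h : IsModel μ p x θ edge y) (hn : 1 ≤ n) (hL : 1 ≤ L)
    {N ρ : ℝ} (hN : 0 < N) (hρ : ρ = Real.sqrt (Real.log n / (N * L))) :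
    μ.real {ω | ∃ i, ∑ j, adj (fun q => edge q ω) i j ≤ 3 * N ∧ 4 * N * ρ
      < |∑ j, adj (fun q => edge q ω) i j
        * skew (noise (score x θ) fun q l => y q l ω) i j|} ≤ 2 * ((n : ℝ) ^ 6)⁻¹ := by
  have hL0 : (0 : ℝ) < L := by positivity
  have hρ0 : 0 ≤ ρ := hρ ▸ Real.sqrt_nonneg _
  have h7 : 2 * ((n : ℝ) ^ 6)⁻¹ = n * (2 * ((n : ℝ) ^ 7)⁻¹) := by
    rw [← natCast_mul_inv_pow hn 6]; ring
  rw [h7]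
  refine measure_exists_le fun i => ?_
  have hind : IndepFun (fun ω q => edge q ω) (fun ω q l => y q l ω) μ := by
    have := indepFun_of_disjoint h.measurable h.indep (fun k => k.isLeft = true)
      (fun k => k.isRight = true) (fun k => by cases k <;> simp)
      (fun f (q : Pair n) => f (Sum.inl q)) (fun f (q : Pair n) (l : Fin L) => f (Sum.inr (q, l)))
    simpa using this
  refine measure_le_of_indepFun (μ := μ) (U := fun ω q => edge q ω) (W := fun ω q l => y q l ω)
    (measurable_pi_lambda _ fun q => h.measurable_edge q) hind
    (fun e => {w | ∑ j, adj e i j ≤ 3 * N ∧ 4 * N * ρ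
      < |∑ j, adj e i j * skew (noise (score x θ) w) i j|}) fun e => ?_
  by_cases hdeg : ∑ j, adj e i j ≤ 3 * N
  · set T := (pairsBetween {i} Finset.univ).filter fun q => e q = true with hT
    have hcard : (T.card : ℝ) ≤ 3 * N := by
      have h1 := sum_adj_eq e (pairsBetween_singleton i Finset.univ)
      rw [Finset.sum_singleton] at h1
      have h2 : (T.card : ℝ) = ∑ q ∈ pairsBetween {i} Finset.univ, boolInd (e q) := by
        unfold boolInd
        rw [← Finset.sum_filter, Finset.sum_const, nsmul_eq_mul, mul_one]
      rw [h2, ← h1]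
      exact hdeg
    set c : Pair n × Fin L → ℝ :=
      fun r => (if r.1.hi = i then 1 else 0) - if r.1.lo = i then 1 else 0 with hc
    have hc1 : ∀ r, |c r| ≤ 1 := by
      intro r; simp only [hc]; split_ifs <;> norm_num
    set ε := L * (4 * N * ρ) with hε
    have hsub : {ω | (fun q l => y q l ω) ∈ {w | ∑ j, adj e i j ≤ 3 * N ∧ 4 * N * ρ
        < |∑ j, adj e i j * skew (noise (score x θ) w) i j|}}
        ⊆ {ω | ε ≤ |∑ r ∈ T ×ˢ (Finset.univ : Finset (Fin L)),
          c r * (μ.real {ω | y r.1 r.2 ω = true} - boolInd (y r.1 r.2 ω))|} := by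
      intro ω hω
      simp only [Set.mem_ofPred_eq] at hω ⊢
      have h1 := hω.2
      rw [sum_adj_mul_skew] at h1
      have h2 : ∑ r ∈ T ×ˢ (Finset.univ : Finset (Fin L)),
          c r * (μ.real {ω | y r.1 r.2 ω = true} - boolInd (y r.1 r.2 ω))
          = L * ∑ q ∈ T, ((if q.hi = i then 1 else 0) - if q.lo = i then 1 else 0)
            * noise (score x θ) (fun q l => y q l ω) q := by
        rw [Finset.sum_product, Finset.mul_sum]
        refine Finset.sum_congr rfl fun q _ => ?_
        rw [noise_eq_sum hL]
        have hcq : ∀ l, c (q, l) = (if q.hi = i then 1 else 0) - if q.lo = i then 1 else 0 :=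
          fun _ => rfl
        simp only [hcq, h.prob_y_eq]
        rw [← Finset.mul_sum]
        field_simp
      rw [h2, abs_mul, abs_of_pos hL0, hε]
      exact mul_le_mul_of_nonneg_left h1.le hL0.le
    refine (measureReal_mono hsub).trans ((measure_abs_sum_boolInd_ge_le
      (b := fun r : Pair n × Fin L => y r.1 r.2) (M := 3 * N * L)
      (fun r => h.measurable_y r.1 r.2) h.iIndepFun_y hc1 _ (by
        rw [Finset.card_product]
        simp only [Finset.card_univ, Fintype.card_fin, Nat.cast_mul]
        gcongr) (by positivity)).trans ?_)
    refine mul_le_mul_of_nonneg_left ?_ (by norm_num)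
    have e1 : -2 * ε ^ 2 / (3 * N * L) = -(32 / 3 * Real.log n) := by
      rw [hε, ← mul_noiseLevel_sq hN hL hρ]
      field_simp; ring
    rw [e1]
    refine exp_neg_le_inv_pow hn ?_
    have := Real.log_natCast_nonneg n
    push_cast
    linarith
  · simp only [Set.mem_ofPred_eq, hdeg, false_and]
    simp only [Set.ofPred_false, measureReal_empty]
    positivity

/-- The edges at `i` are independent of the leave-one-out potentials, so that few neighbours of `i`
have a large one. -/
lemma IsModel.measure_neighbours_le (h : IsModel μ p x θ edge y) (hn : 1 ≤ n) (hp : 0 ≤ p)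
    (hN : 128 * Real.log n ≤ n * p) (κ τ : ℝ) (t : Fin n → ℝ) :
    μ.real {ω | ∃ i, ((Finset.univ.filter fun j => τ < |leaveOneOut κ t i (fun q => edge q ω)
        (fun q l => y q l ω) j|).card : ℝ) ≤ Real.exp (-32) * n ∧
      n * p / 16 < ∑ j, (if τ < |leaveOneOut κ t i (fun q => edge q ω) (fun q l => y q l ω) j|
        then adj (fun q => edge q ω) i j else 0)} ≤ ((n : ℝ) ^ 6)⁻¹ := by
  rw [← natCast_mul_inv_pow hn]
  refine measure_exists_le fun i => ?_
  set U : Ω → (Pair n → Bool) × (Pair n → Fin L → Bool) := fun ω =>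
    (mask i fun q => edge q ω, mask i fun q l => y q l ω) with hU
  set W : Ω → Pair n → Bool := fun ω q => if q.hi = i ∨ q.lo = i then edge q ω else false with hW
  have hUm : Measurable U := by
    refine Measurable.prodMk ?_ ?_
    · refine measurable_pi_lambda _ fun q => ?_
      unfold mask
      split_ifs
      · exact measurable_const
      · exact h.measurable_edge q
    · refine measurable_pi_lambda _ fun q => ?_
      unfold mask
      split_ifs
      · exact measurable_const
      · exact measurable_pi_lambda _ fun l => h.measurable_y q l
  have hind : IndepFun U W μ := by
    classical
    have hdisj := indepFun_of_disjoint h.measurable h.indep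
      (Sum.elim (fun q => ¬(q.hi = i ∨ q.lo = i)) fun r => ¬(r.1.hi = i ∨ r.1.lo = i))
      (Sum.elim (fun q => q.hi = i ∨ q.lo = i) fun _ => False) (fun k => by
        cases k
        · simp only [Sum.elim_inl]; tauto
        · simp)
      (fun f => (fun q : Pair n => f (Sum.inl q), fun (q : Pair n) (l : Fin L) =>
        f (Sum.inr (q, l)))) (fun f (q : Pair n) => f (Sum.inl q))
    convert hdisj using 1
    · funext ω
      refine Prod.ext (funext fun q => ?_) (funext fun q => funext fun l => ?_)
      · by_cases hq : q.hi = i ∨ q.lo = i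
        · simp only [hU, mask, Sum.elim_inl, hq, not_true_eq_false, if_true, if_false]; rfl
        · simp only [hU, mask, Sum.elim_inl, hq, not_false_eq_true, if_true, if_false]
      · by_cases hq : q.hi = i ∨ q.lo = i
        · simp only [hU, mask, Sum.elim_inr, hq, not_true_eq_false, if_true, if_false]; rfl
        · simp only [hU, mask, Sum.elim_inr, hq, not_false_eq_true, if_true, if_false]
    · funext ω q
      by_cases hq : q.hi = i ∨ q.lo = i <;> simp [hW, hq]
  have hWadj : ∀ ω j, adj (W ω) i j = adj (fun q => edge q ω) i j := by
    intro ω j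
    simp [adj, hW]
  set E : (Pair n → Bool) × (Pair n → Fin L → Bool) → Set (Pair n → Bool) := fun u =>
    {w | ((Finset.univ.filter fun j => τ < |leaveOneOut κ t i u.1 u.2 j|).card : ℝ)
        ≤ Real.exp (-32) * n ∧
      n * p / 16 < ∑ j, (if τ < |leaveOneOut κ t i u.1 u.2 j| then adj w i j else 0)} with hE
  have hset : {ω | ((Finset.univ.filter fun j => τ < |leaveOneOut κ t i (fun q => edge q ω)
        (fun q l => y q l ω) j|).card : ℝ) ≤ Real.exp (-32) * n ∧
      n * p / 16 < ∑ j, (if τ < |leaveOneOut κ t i (fun q => edge q ω) (fun q l => y q l ω) j|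
        then adj (fun q => edge q ω) i j else 0)} = {ω | W ω ∈ E (U ω)} := by
    ext ω
    simp only [hE, hU, Set.mem_ofPred_eq, leaveOneOut_mask, hWadj]
  rw [hset]
  refine measure_le_of_indepFun hUm hind E fun u => ?_
  set B := Finset.univ.filter fun j => τ < |leaveOneOut κ t i u.1 u.2 j| with hB
  by_cases hcard : (B.card : ℝ) ≤ Real.exp (-32) * n
  · have hsub : {ω | W ω ∈ E u}
        ⊆ {ω | n * p / 16 ≤ ∑ q ∈ pairsBetween {i} B, boolInd (edge q ω)} := by
      intro ω hω
      have h1 := hω.2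
      simp only [hWadj] at h1
      rw [← Finset.sum_filter] at h1
      simp only [Set.mem_ofPred_eq]
      rw [← sum_adj_eq _ (pairsBetween_singleton i _), Finset.sum_singleton]
      exact h1.le
    -- Chernoff with parameter `32`: as `|B| ≤ e⁻³² n`, the exponential moment is at most
    -- `e ^ (n p)`, and `e ^ (n p - 32 n p / 16) = e ^ (-n p)`.
    refine (measureReal_mono hsub).trans ((measure_sum_boolInd_ge_le h.measurable_edge
      h.iIndepFun_edge h.prob_edge _ (by norm_num : (0 : ℝ) ≤ 32) _).trans ?_)
    refine le_trans (Real.exp_le_exp.2 ?_) (exp_neg_le_inv_pow (s := n * p) hn ?_)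
    · have h1 := card_pairsBetween_le (pairsBetween_singleton i B)
      simp only [Finset.card_singleton, Nat.cast_one, one_mul] at h1
      have h2 : p * (Real.exp 32 - 1) ≤ p * Real.exp 32 :=
        mul_le_mul_of_nonneg_left (by linarith) hp
      have h3 := mul_le_mul_of_nonneg_left h2 (Nat.cast_nonneg (pairsBetween {i} B).card
        (α := ℝ))
      have h4 := mul_le_mul_of_nonneg_right (h1.trans hcard)
        (mul_nonneg hp (Real.exp_pos 32).le)
      have h5 : Real.exp (-32) * n * (p * Real.exp 32) = n * p := by
        have : Real.exp (-32) * Real.exp 32 = 1 := by rw [← Real.exp_add]; simp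
        linear_combination (n * p) * this
      linarith
    · have := Real.log_natCast_nonneg n
      push_cast
      linarith
  · have : {ω | W ω ∈ E u} = ∅ := by
      ext ω
      simp only [hE, Set.mem_ofPred_eq, Set.mem_empty_iff_false, iff_false, not_and]
      exact fun hc => absurd hc hcard
    rw [this, measureReal_empty]
    positivity

/-- The data are regular with high probability. -/
theorem IsModel.measure_not_isRegular_le (h : IsModel μ p x θ edge y) (hn : 1 ≤ n) (hL : 1 ≤ L)
    (hp : 0 < p) (hN : 128 * Real.log n ≤ n * p) (κ τ : ℝ) {ρ : ℝ}
    (hρ : ρ = Real.sqrt (Real.log n / (n * p * L))) :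
    μ.real {ω | ¬IsRegular (n * p) ρ κ τ (score x θ) (fun q => edge q ω) (fun q l => y q l ω)}
      ≤ 8 * ((n : ℝ) ^ 6)⁻¹ := by
  have hN0 : 0 < n * p := by positivity
  have h1 := h.measure_cut_le hn hp.le hN
  have h2 := h.measure_degree_le hn hp.le hN
  have h3 := h.measure_pair_noise_le hn hL hN0 hρ
  have h4 := h.measure_node_noise_le hn hL hN0 hρ
  have h5 := h.measure_neighbours_le hn hp.le hN κ τ (score x θ)
  refine le_trans (measureReal_mono ?_) (le_trans (measureReal_union_le _ _) (add_le_add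
    (le_trans (measureReal_union_le _ _) (add_le_add
    (le_trans (measureReal_union_le _ _) (add_le_add
    (le_trans (measureReal_union_le _ _) (add_le_add h1 h2)) h3)) h4)) h5) |>.trans_eq (by ring))
  intro ω hω
  by_contra hcon
  simp only [Set.mem_union, Set.mem_ofPred_eq, not_or, not_exists, not_and, not_lt] at hcon
  obtain ⟨⟨⟨⟨c1, c2⟩, c3⟩, c4⟩, c5⟩ := hcon
  exact hω ⟨c1, c2, fun i => c4 i (c2 i), c3, c5⟩

end Regular

/-! ### From scores to parameters -/

section Parameters

variable {n d : ℕ} {x : Fin n → EuclideanSpace ℝ (Fin d)}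

lemma score_eq (x : Fin n → EuclideanSpace ℝ (Fin d)) (z : Param n d) (i : Fin n) :
    score x z i = alpha z i + inner ℝ (x i) (beta z) := by
  simp only [score, PiLp.inner_apply, Fintype.sum_sum_type, xTilde, alpha, beta, Sum.elim_inl,
    Sum.elim_inr]
  congr 1
  simp [Pi.single_apply]

lemma score_sub (x : Fin n → EuclideanSpace ℝ (Fin d)) (z w : Param n d) (i : Fin n) :
    score x (z - w) i = score x z i - score x w i := inner_sub_right _ _ _

lemma sub_mem_Theta {z w : Param n d} (hz : z ∈ Theta x) (hw : w ∈ Theta x) :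
    z - w ∈ Theta x := by
  have h1 : alpha (z - w) = alpha z - alpha w := rfl
  simp only [Theta, Set.mem_ofPred_eq] at hz hw ⊢
  rw [h1, Matrix.mulVec_sub, hz, hw, sub_zero]

lemma add_mem_Theta {z w : Param n d} (hz : z ∈ Theta x) (hw : w ∈ Theta x) :
    z + w ∈ Theta x := by
  have h1 : alpha (z + w) = alpha z + alpha w := rfl
  simp only [Theta, Set.mem_ofPred_eq] at hz hw ⊢
  rw [h1, Matrix.mulVec_add, hz, hw, add_zero]

lemma sum_alpha_eq_zero {z : Param n d} (hz : z ∈ Theta x) : ∑ i, alpha z i = 0 := by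
  have h1 : Matrix.mulVec (xBar x).transpose (alpha z) = 0 := hz
  have h2 := congrFun h1 (Sum.inl ())
  simpa [Matrix.mulVec, dotProduct, xBar] using h2

lemma norm_beta_le (z : Param n d) : ‖beta z‖ ≤ ‖z‖ := by
  refine le_of_sq_le_sq ?_ (norm_nonneg _)
  rw [EuclideanSpace.norm_sq_eq, EuclideanSpace.norm_sq_eq, Fintype.sum_sum_type]
  have : 0 ≤ ∑ i : Fin n, ‖z (Sum.inl i)‖ ^ 2 := Finset.sum_nonneg fun i _ => sq_nonneg _
  simp only [beta]
  linarith

lemma sum_pair_sub_sq (u : Fin n → ℝ) :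
    ∑ q : Pair n, (u q.hi - u q.lo) ^ 2 = n * ∑ i, u i ^ 2 - (∑ i, u i) ^ 2 := by
  have h1 := sum_adj_mul (fun _ => true) fun i j => (u i - u j) ^ 2
  have h2 : ∀ i j, adj (fun _ => true) i j * (u i - u j) ^ 2 = (u i - u j) ^ 2 := by
    intro i j
    unfold adj
    rcases lt_trichotomy i j with h | h | h
    · simp [h]
    · subst h; simp
    · simp [h]
  have h3 : ∑ i, ∑ j, (u i - u j) ^ 2 = 2 * (n * ∑ i, u i ^ 2 - (∑ i, u i) ^ 2) := by
    have e1 : ∀ i j, (u i - u j) ^ 2 = u i ^ 2 - 2 * (u i * u j) + u j ^ 2 := by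
      intro i j; ring
    simp only [e1, Finset.sum_add_distrib, Finset.sum_sub_distrib, ← Finset.mul_sum,
      ← Finset.sum_mul]
    simp only [Finset.sum_const, Finset.card_univ, Fintype.card_fin, nsmul_eq_mul,
      ← Finset.mul_sum]
    ring
  simp only [h2, if_true] at h1
  have h4 : ∑ q : Pair n, ((u q.hi - u q.lo) ^ 2 + (u q.lo - u q.hi) ^ 2)
      = 2 * ∑ q : Pair n, (u q.hi - u q.lo) ^ 2 := by
    rw [Finset.mul_sum]
    exact Finset.sum_congr rfl fun q _ => by ring
  rw [h4, h3] at h1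
  linarith

lemma dotProduct_covMatrix (x : Fin n → EuclideanSpace ℝ (Fin d)) (z : Param n d) :
    dotProduct (WithLp.ofLp z) ((covMatrix x).mulVec (WithLp.ofLp z))
      = n * ∑ i, score x z i ^ 2 - (∑ i, score x z i) ^ 2 := by
  rw [← sum_pair_sub_sq, covMatrix, Matrix.sum_mulVec, dotProduct_sum]
  refine Finset.sum_congr rfl fun q _ => ?_
  rw [Matrix.vecMulVec_mulVec]
  have h1 : dotProduct (WithLp.ofLp z) (WithLp.ofLp (xTilde x q.hi - xTilde x q.lo))
      = score x z q.hi - score x z q.lo := by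
    simp only [score]
    rw [← inner_sub_left, EuclideanSpace.inner_eq_star_dotProduct]
    simp
  have h2 : dotProduct (WithLp.ofLp (xTilde x q.hi - xTilde x q.lo)) (WithLp.ofLp z)
      = score x z q.hi - score x z q.lo := by rw [dotProduct_comm, h1]
  rw [h2]
  simp only [op_smul_eq_smul, dotProduct_smul, smul_eq_mul]
  rw [h1]
  ring

/-- The eigenvalue condition in terms of the scores. Here the positivity of the bound excludes the
case in which the supremum defining `lambdaMinPerp` is not attained. -/
lemma norm_sq_le_of_lambdaMinPerp {c : ℝ} (hc : 0 < c)
    (hlam : c * n ≤ lambdaMinPerp x (covMatrix x)) (hn : 0 < n) {z : Param n d}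
    (hz : z ∈ Theta x) :
    c * n * ‖z‖ ^ 2 ≤ n * ∑ i, score x z i ^ 2 - (∑ i, score x z i) ^ 2 := by
  rw [← dotProduct_covMatrix]
  rcases eq_or_ne z 0 with rfl | hz0
  · simp
  · have hpos : 0 < ‖z‖ ^ 2 := by positivity
    have hcn : 0 < c * n := by positivity
    rw [← le_div_iff₀ hpos]
    refine hlam.trans (csSup_le ?_ fun μ hμ => ?_)
    · by_contra hne
      rw [Set.not_nonempty_iff_eq_empty] at hne
      rw [lambdaMinPerp, hne, Real.sSup_empty] at hlam
      linarith
    · rw [le_div_iff₀ hpos]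
      exact hμ z hz

lemma eq_zero_of_score_const {c : ℝ} (hc : 0 < c)
    (hlam : c * n ≤ lambdaMinPerp x (covMatrix x)) (hn : 0 < n) {z : Param n d}
    (hz : z ∈ Theta x) {b : ℝ} (hb : ∀ i, score x z i = b) : z = 0 := by
  have h1 := norm_sq_le_of_lambdaMinPerp hc hlam hn hz
  have h2 : (n : ℝ) * ∑ i, score x z i ^ 2 - (∑ i, score x z i) ^ 2 = 0 := by
    simp only [hb, Finset.sum_const, Finset.card_univ, Fintype.card_fin, nsmul_eq_mul]
    ring
  rw [h2] at h1
  have h3 : 0 < c * n := by positivity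
  have h4 : ‖z‖ ^ 2 = 0 := le_antisymm (nonpos_of_mul_nonpos_right h1 h3) (sq_nonneg _)
  simpa using h4

/-- Every vector of scores is attained on the constrained parameter space, up to a constant: the
map `(z, c) ↦ (X̄ᵀ α, X̃ z + c)` is injective between spaces of the same dimension. -/
lemma exists_score_eq {c : ℝ} (hc : 0 < c)
    (hlam : c * n ≤ lambdaMinPerp x (covMatrix x)) (hn : 0 < n) (δ : Fin n → ℝ) :
    ∃ z ∈ Theta x, ∃ b : ℝ, ∀ i, score x z i = δ i + b := by
  let Ψ : (Param n d × ℝ) →ₗ[ℝ] ((Unit ⊕ Fin d → ℝ) × (Fin n → ℝ)) :=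
    { toFun := fun v => (Matrix.mulVec (xBar x).transpose (alpha v.1), fun i =>
        score x v.1 i - v.2)
      map_add' := fun v w => by
        have h1 : alpha (v + w).1 = alpha v.1 + alpha w.1 := rfl
        refine Prod.ext ?_ ?_
        · simp only [Prod.fst_add]
          exact (congrArg _ h1).trans (Matrix.mulVec_add _ _ _)
        · funext i
          simp only [score, Prod.fst_add, Prod.snd_add, inner_add_right, Pi.add_apply]
          ring
      map_smul' := fun r v => by
        have h1 : alpha (r • v).1 = r • alpha v.1 := rfl
        refine Prod.ext ?_ ?_
        · simp only [Prod.smul_fst, RingHom.id_apply]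
          exact (congrArg _ h1).trans (Matrix.mulVec_smul _ _ _)
        · funext i
          simp only [score, Prod.smul_fst, Prod.smul_snd, inner_smul_right, Pi.smul_apply,
            RingHom.id_apply, smul_eq_mul]
          ring }
  have hinj : Function.Injective Ψ := by
    rw [injective_iff_map_eq_zero]
    rintro ⟨z, b⟩ hv
    have h1 : Matrix.mulVec (xBar x).transpose (alpha z) = 0 := congrArg Prod.fst hv
    have h2 : ∀ i, score x z i = b := fun i => by
      have h3 : score x z i - b = 0 := congrFun (congrArg Prod.snd hv) i
      linarith
    have hz := eq_zero_of_score_const hc hlam hn h1 h2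
    have hb : b = 0 := by
      rw [← h2 ⟨0, hn⟩, hz, score, inner_zero_right]
    rw [hz, hb]; rfl
  have hrank : Module.finrank ℝ (Param n d × ℝ)
      = Module.finrank ℝ ((Unit ⊕ Fin d → ℝ) × (Fin n → ℝ)) := by
    simp [Module.finrank_prod]
    ring
  obtain ⟨⟨z, b⟩, hv⟩ := (LinearMap.injective_iff_surjective_of_finrank_eq_finrank hrank).1 hinj
    (0, δ)
  refine ⟨z, congrArg Prod.fst hv, b, fun i => ?_⟩
  have h3 : score x z i - b = δ i := congrFun (congrArg Prod.snd hv) i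
  linarith

/-- Error bounds for a parameter whose scores are `δ`, centred, up to a constant. -/
lemma error_bounds {c : ℝ} (hc : 0 < c) (hlam : c * n ≤ lambdaMinPerp x (covMatrix x))
    (hn : 0 < n) {r : ℝ} (hr : ∀ i, ‖x i‖ ≤ r) {z : Param n d} (hz : z ∈ Theta x)
    {δ : Fin n → ℝ} (hδ : ∑ i, δ i = 0) {b : ℝ} (hb : ∀ i, score x z i = δ i + b)
    {A : ℝ} (hA : 0 ≤ A) (hl2 : ∑ i, δ i ^ 2 ≤ c * A ^ 2) {B : ℝ} (hsup : ∀ i, |δ i| ≤ B) :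
    ‖beta z‖ ≤ A ∧ (∀ i, |score x z i| ≤ B + r * A) ∧ ∀ i, |alpha z i| ≤ B + 2 * (r * A) := by
  have hn0 : (0 : ℝ) < n := by positivity
  have hr0 : 0 ≤ r := (norm_nonneg _).trans (hr ⟨0, hn⟩)
  have hzA : ‖z‖ ≤ A := by
    have h1 := norm_sq_le_of_lambdaMinPerp hc hlam hn hz
    have h2 : (n : ℝ) * ∑ i, score x z i ^ 2 - (∑ i, score x z i) ^ 2 = n * ∑ i, δ i ^ 2 := by
      have e1 : ∀ i, score x z i ^ 2 = δ i ^ 2 + 2 * b * δ i + b ^ 2 := by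
        intro i; rw [hb]; ring
      simp only [e1]
      simp only [hb, Finset.sum_add_distrib, ← Finset.mul_sum, hδ, Finset.sum_const,
        Finset.card_univ, Fintype.card_fin, nsmul_eq_mul]
      ring
    rw [h2] at h1
    refine le_of_sq_le_sq ?_ hA
    refine le_of_mul_le_mul_left ?_ (by positivity : 0 < c * n)
    nlinarith
  have hβ := (norm_beta_le z).trans hzA
  have hin : ∀ i, |inner ℝ (x i) (beta z)| ≤ r * A := fun i =>
    (abs_real_inner_le_norm _ _).trans (mul_le_mul (hr i) hβ (norm_nonneg _) hr0)
  have hbb : |b| ≤ r * A := by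
    have h1 : (n : ℝ) * b = ∑ i, inner ℝ (x i) (beta z) := by
      have h2 : ∑ i, score x z i = ∑ i, (δ i + b) := Finset.sum_congr rfl fun i _ => hb i
      simp only [score_eq, Finset.sum_add_distrib, sum_alpha_eq_zero hz, hδ, Finset.sum_const,
        Finset.card_univ, Fintype.card_fin, nsmul_eq_mul, zero_add] at h2
      exact h2.symm
    have h3 : |(n : ℝ) * b| ≤ n * (r * A) := by
      rw [h1]
      refine (Finset.abs_sum_le_sum_abs _ _).trans
        ((Finset.sum_le_sum fun i _ => hin i).trans_eq ?_)
      simp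
    rw [abs_mul, abs_of_pos hn0] at h3
    exact le_of_mul_le_mul_left h3 hn0
  have hs : ∀ i, |score x z i| ≤ B + r * A := fun i => by
    rw [hb]
    exact (abs_add_le _ _).trans (add_le_add (hsup i) hbb)
  refine ⟨hβ, hs, fun i => ?_⟩
  have h1 : alpha z i = score x z i - inner ℝ (x i) (beta z) := by rw [score_eq]; ring
  rw [h1]
  exact (abs_sub _ _).trans (by linarith [hs i, hin i])

end Parameters

/-! ### Convexity of the loss -/

/-- The function `s ↦ log (1 + eˢ)` lies strictly above its tangents. -/
lemma log_one_add_exp_gt {s u : ℝ} (hsu : u ≠ s) :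
    Real.log (1 + Real.exp s) + Real.sigmoid s * (u - s) < Real.log (1 + Real.exp u) := by
  have hs := Real.exp_pos s
  have h1 := strictConvexOn_exp.2 (Set.mem_univ 0) (Set.mem_univ (u - s))
    (sub_ne_zero.2 hsu).symm (sub_pos.2 (Real.sigmoid_lt_one s)) (Real.sigmoid_pos s)
    (sub_add_cancel 1 _)
  simp only [smul_eq_mul, mul_zero, zero_add, Real.exp_zero, mul_one] at h1
  have h2 : 1 - Real.sigmoid s + Real.sigmoid s * Real.exp (u - s)
      = (1 + Real.exp u) / (1 + Real.exp s) := by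
    rw [Real.exp_sub, Real.sigmoid_def, Real.exp_neg]
    field_simp
    ring
  rw [h2, lt_div_iff₀ (by positivity)] at h1
  have h3 := Real.log_lt_log (by positivity) h1
  rw [Real.log_mul (by positivity) (by positivity), Real.log_exp] at h3
  linarith

lemma log_one_add_exp_ge (s u : ℝ) :
    Real.log (1 + Real.exp s) + Real.sigmoid s * (u - s) ≤ Real.log (1 + Real.exp u) := by
  rcases eq_or_ne u s with rfl | h
  · simp
  · exact (log_one_add_exp_gt h).le

section MLE

variable {n d L : ℕ} {x : Fin n → EuclideanSpace ℝ (Fin d)} {e : Pair n → Bool}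
  {y : Pair n → Fin L → Bool}

/-- The loss lies above its tangent at a parameter whose scores solve the score equations. If it
takes the same value at another parameter, then the scores change by the same amount at both ends
of each edge. -/
lemma loss_ge_of_score_eq {t : Fin n → ℝ} {θ₀ : Param n d}
    (hgrad : ∀ i, ∑ j, adj e i j * (Real.sigmoid (score x θ₀ i - score x θ₀ j)
      - Real.sigmoid (t i - t j) + skew (noise t y) i j) = 0) (θ : Param n d) :
    loss x e y θ₀ ≤ loss x e y θ ∧ (loss x e y θ ≤ loss x e y θ₀ → ∀ i j, adj e i j ≠ 0 →
      score x θ i - score x θ j = score x θ₀ i - score x θ₀ j) := by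
  set s := score x θ₀ with hs
  set u := score x θ with hu
  set v : Pair n → ℝ := fun q => Real.sigmoid (s q.hi - s q.lo) - freq (y q) with hv
  have hskew : ∀ i j, skew v i j
      = Real.sigmoid (s i - s j) - Real.sigmoid (t i - t j) + skew (noise t y) i j := by
    intro i j
    unfold skew
    rcases lt_trichotomy i j with h | h | h
    · have e1 : s i - s j = -(s j - s i) := by ring
      have e2 : t i - t j = -(t j - t i) := by ring
      simp only [h, h.not_gt, dif_pos, dif_neg, not_false_eq_true, hv, noise]
      rw [e1, e2, Real.sigmoid_neg, Real.sigmoid_neg]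
      simp only [Pair.hi, Pair.lo]
      ring
    · subst h; simp
    · simp only [h, dif_pos, hv, noise, Pair.hi, Pair.lo]
      ring
  have hlin : ∑ q : Pair n, (if e q then v q * ((u - s) q.hi - (u - s) q.lo) else 0) = 0 := by
    rw [sum_pair_mul_sub]
    refine Finset.sum_eq_zero fun i _ => ?_
    simp only [hskew, hgrad, mul_zero]
  have hdiff : loss x e y θ - loss x e y θ₀ = ∑ q : Pair n, if e q then
      Real.log (1 + Real.exp (u q.hi - u q.lo)) - Real.log (1 + Real.exp (s q.hi - s q.lo))
        - Real.sigmoid (s q.hi - s q.lo) * ((u q.hi - u q.lo) - (s q.hi - s q.lo)) else 0 := by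
    refine sub_eq_zero.1 (Eq.trans ?_ hlin)
    rw [loss, loss, ← Finset.sum_sub_distrib, ← Finset.sum_sub_distrib]
    refine Finset.sum_congr rfl fun q _ => ?_
    split_ifs
    · simp only [hv, Pi.sub_apply, ← hs, ← hu]; ring
    · simp
  have hnonneg : ∀ q : Pair n, 0 ≤ (if e q then
      Real.log (1 + Real.exp (u q.hi - u q.lo)) - Real.log (1 + Real.exp (s q.hi - s q.lo))
        - Real.sigmoid (s q.hi - s q.lo) * ((u q.hi - u q.lo) - (s q.hi - s q.lo)) else 0) := by
    intro q
    split_ifs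
    · linarith [log_one_add_exp_ge (s q.hi - s q.lo) (u q.hi - u q.lo)]
    · exact le_rfl
  have h0 : 0 ≤ loss x e y θ - loss x e y θ₀ := by
    rw [hdiff]; exact Finset.sum_nonneg fun q _ => hnonneg q
  refine ⟨by linarith, fun hle => ?_⟩
  have hzero : loss x e y θ - loss x e y θ₀ = 0 := by linarith
  rw [hdiff, Finset.sum_eq_zero_iff_of_nonneg fun q _ => hnonneg q] at hzero
  have hedge : ∀ q : Pair n, e q = true → u q.hi - u q.lo = s q.hi - s q.lo := by
    intro q hq
    by_contra hne
    have h1 := hzero q (Finset.mem_univ q)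
    rw [if_pos hq] at h1
    linarith [log_one_add_exp_gt hne]
  intro i j hij
  unfold adj at hij
  split_ifs at hij with h1 h2 h3 h4
  · exact hedge ⟨(i, j), h1⟩ h2
  · simp at hij
  · have := hedge ⟨(j, i), h3⟩ h4
    simp only [Pair.hi, Pair.lo] at this
    linarith
  · simp at hij
  · simp at hij

/-- In a graph with a spectral gap, a parameter in `Θ` whose scores solve the score equations is the
unique maximum likelihood estimate. -/
lemma isMLE_unique {c gap : ℝ} (hc : 0 < c) (hlam : c * n ≤ lambdaMinPerp x (covMatrix x))
    (hn : 0 < n) (hgap : 0 < gap)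
    (henergy : ∀ z : Fin n → ℝ, ∑ i, z i = 0 → gap * ∑ i, z i ^ 2 ≤ energy (adj e) z)
    {t : Fin n → ℝ} {θ₀ : Param n d} (hθ₀ : θ₀ ∈ Theta x)
    (hgrad : ∀ i, ∑ j, adj e i j * (Real.sigmoid (score x θ₀ i - score x θ₀ j)
      - Real.sigmoid (t i - t j) + skew (noise t y) i j) = 0) :
    IsMLE x e y θ₀ ∧ ∀ θ, IsMLE x e y θ → θ = θ₀ := by
  refine ⟨⟨hθ₀, fun θ _ => (loss_ge_of_score_eq hgrad θ).1⟩, fun θ hθ => ?_⟩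
  have hn0 : (n : ℝ) ≠ 0 := by positivity
  have hedge := (loss_ge_of_score_eq hgrad θ).2 (hθ.2 hθ₀)
  set w : Fin n → ℝ := score x (θ - θ₀) with hw
  set b : ℝ := (∑ i, w i) / n with hb
  have hsum : ∑ i, (w i - b) = 0 := by
    rw [Finset.sum_sub_distrib, Finset.sum_const, Finset.card_univ, Fintype.card_fin,
      nsmul_eq_mul, hb]
    field_simp; ring
  have hE : energy (adj e) (fun i => w i - b) = 0 := by
    unfold energy
    rw [div_eq_zero_iff]
    left
    refine Finset.sum_eq_zero fun i _ => Finset.sum_eq_zero fun j _ => ?_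
    by_cases hij : adj e i j = 0
    · simp [hij]
    · have h1 := hedge i j hij
      have h2 : w i - b - (w j - b) = 0 := by
        simp only [hw, score_sub]; linarith
      simp [h2]
  have h1 := henergy _ hsum
  rw [hE] at h1
  have h2 : ∑ i, (w i - b) ^ 2 = 0 :=
    le_antisymm (nonpos_of_mul_nonpos_right h1 hgap) (Finset.sum_nonneg fun i _ => sq_nonneg _)
  rw [Finset.sum_eq_zero_iff_of_nonneg fun i _ => sq_nonneg _] at h2
  have h3 := eq_zero_of_score_const hc hlam hn (sub_mem_Theta hθ.1 hθ₀) (b := b) fun i => by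
    have := pow_eq_zero_iff (two_ne_zero) |>.1 (h2 i (Finset.mem_univ i))
    linarith
  exact sub_eq_zero.1 h3

end MLE

/-! ### The condition number and the exponential map -/

section Kappa

variable {n d : ℕ} {x : Fin n → EuclideanSpace ℝ (Fin d)} {θ : Param n d}

lemma iInf_expScore_pos (hn : 0 < n) : 0 < ⨅ i, expScore x θ i := by
  have : Nonempty (Fin n) := ⟨⟨0, hn⟩⟩
  obtain ⟨i, hi⟩ := exists_eq_ciInf_of_finite (f := expScore x θ)
  rw [← hi]
  exact Real.exp_pos _

lemma exp_score_sub_le_kappa (hn : 0 < n) (i j : Fin n) :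
    Real.exp (score x θ i - score x θ j) ≤ kappa x θ := by
  rw [Real.exp_sub, kappa]
  have hi : expScore x θ i ≤ ⨆ i, expScore x θ i := le_ciSup (Set.finite_range _).bddAbove i
  exact div_le_div₀ ((Real.exp_pos _).le.trans hi) hi (iInf_expScore_pos hn)
    (ciInf_le (f := expScore x θ) (Set.finite_range _).bddBelow j)

lemma one_le_kappa (hn : 0 < n) : 1 ≤ kappa x θ := by
  simpa using exp_score_sub_le_kappa (x := x) (θ := θ) hn ⟨0, hn⟩ ⟨0, hn⟩

lemma score_sub_le_log_kappa (hn : 0 < n) (i j : Fin n) :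
    score x θ i - score x θ j ≤ Real.log (kappa x θ) :=
  (Real.le_log_iff_exp_le (zero_lt_one.trans_le (one_le_kappa hn))).2
    (exp_score_sub_le_kappa hn i j)

lemma abs_exp_sub_one_le_mul_exp (u : ℝ) : |Real.exp u - 1| ≤ |u| * Real.exp |u| := by
  have h1 := Real.add_one_le_exp u
  have h2 := Real.add_one_le_exp (-u)
  have h3 : Real.exp (-u) * Real.exp u = 1 := by rw [← Real.exp_add]; simp
  have h4 := Real.exp_pos u
  have h5 : 1 ≤ Real.exp |u| := Real.one_le_exp (abs_nonneg u)
  rcases le_total 0 u with hu | hu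
  · rw [abs_of_nonneg (sub_nonneg.2 (Real.one_le_exp hu)), abs_of_nonneg hu]
    nlinarith
  · rw [abs_of_nonpos (sub_nonpos.2 (Real.exp_le_one_iff.2 hu))]
    nlinarith [neg_abs_le u, abs_nonneg u]

lemma norm_expScore_sub_div_le (hn : 0 < n) {θ' : Param n d} {ε M : ℝ}
    (h : ∀ i, |score x θ' i - score x θ i| ≤ ε) (hM : ε ≤ M) :
    ‖expScore x θ' - expScore x θ‖ / ‖expScore x θ‖ ≤ ε * Real.exp M := by
  have hε : 0 ≤ ε := (abs_nonneg _).trans (h ⟨0, hn⟩)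
  have hpos : 0 < ‖expScore x θ‖ := (norm_pos_iff).2 fun h0 =>
    (Real.exp_pos (score x θ ⟨0, hn⟩)).ne' (congrFun h0 ⟨0, hn⟩)
  rw [div_le_iff₀ hpos, pi_norm_le_iff_of_nonneg (by positivity)]
  intro i
  have h1 : (expScore x θ' - expScore x θ) i
      = (Real.exp (score x θ' i - score x θ i) - 1) * expScore x θ i := by
    simp only [Pi.sub_apply, expScore]
    rw [sub_mul, ← Real.exp_add, one_mul, sub_add_cancel]
  rw [h1, norm_mul, Real.norm_eq_abs]
  refine mul_le_mul ((abs_exp_sub_one_le_mul_exp _).trans ?_) (norm_le_pi_norm _ i)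
    (norm_nonneg _) (by positivity)
  exact mul_le_mul (h i) (Real.exp_le_exp.2 ((h i).trans hM)) (Real.exp_pos _).le hε

end Kappa

/-! ### The rate of convergence -/

section Rate

variable {n d L : ℕ} {x : Fin n → EuclideanSpace ℝ (Fin d)} {θs : Param n d}
  {e : Pair n → Bool} {y : Pair n → Fin L → Bool}

/-- A solution of the score equations, close to the true scores, is realised by exactly one
parameter in `Θ`. This parameter is the maximum likelihood estimate, and its errors are controlled
by those of the scores. -/
lemma exists_isMLE_of_score_solution {c gap : ℝ} (hc : 0 < c)
    (hlam : c * n ≤ lambdaMinPerp x (covMatrix x)) (hn : 0 < n) (hgap : 0 < gap)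
    (henergy : ∀ z : Fin n → ℝ, ∑ i, z i = 0 → gap * ∑ i, z i ^ 2 ≤ energy (adj e) z)
    (hθs : θs ∈ Theta x) {r : ℝ} (hr : ∀ i, ‖x i‖ ≤ r) {δ : Fin n → ℝ} (hδ : ∑ i, δ i = 0)
    (hsol : ∀ i, ∑ j, adj e i j * (Real.sigmoid (score x θs i - score x θs j + (δ i - δ j))
      - Real.sigmoid (score x θs i - score x θs j) + skew (noise (score x θs) y) i j) = 0)
    {A : ℝ} (hA : 0 ≤ A) (hl2 : ∑ i, δ i ^ 2 ≤ c * A ^ 2) {B : ℝ} (hsup : ∀ i, |δ i| ≤ B) :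
    ∃ θ₀, IsMLE x e y θ₀ ∧ (∀ θ, IsMLE x e y θ → θ = θ₀) ∧ ‖beta θ₀ - beta θs‖ ≤ A ∧
      (∀ i, |score x θ₀ i - score x θs i| ≤ B + r * A) ∧
      ∀ i, |alpha θ₀ i - alpha θs i| ≤ B + 2 * (r * A) := by
  obtain ⟨z, hz, b, hb⟩ := exists_score_eq hc hlam hn δ
  have hscore : ∀ i, score x (θs + z) i = score x θs i + δ i + b := fun i => by
    rw [add_assoc, ← hb]
    exact inner_add_right _ _ _
  have hmle := isMLE_unique (y := y) (t := score x θs) hc hlam hn hgap henergy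
    (add_mem_Theta hθs hz) fun i => by
      rw [← hsol i]
      refine Finset.sum_congr rfl fun j _ => ?_
      rw [hscore, hscore, show score x θs i + δ i + b - (score x θs j + δ j + b)
        = score x θs i - score x θs j + (δ i - δ j) by ring]
  obtain ⟨h1, h2, h3⟩ := error_bounds hc hlam hn hr hz hδ hb hA hl2 hsup
  refine ⟨θs + z, hmle.1, hmle.2, ?_, fun i => ?_, fun i => ?_⟩
  · rwa [show beta (θs + z) - beta θs = beta z from add_sub_cancel_left (beta θs) (beta z)]
  · rw [show score x (θs + z) i - score x θs i = score x z i by rw [hscore, hb]; ring]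
    exact h2 i
  · rw [show alpha (θs + z) i - alpha θs i = alpha z i from
      add_sub_cancel_left (alpha θs i) (alpha z i)]
    exact h3 i

lemma noiseLevel_of_density {n L : ℕ} {p S : ℝ} (hS : 10 ^ 6 ≤ S) (hn : 2 ≤ n) (hL : 1 ≤ L)
    (hp1 : p ≤ 1) (h : S ^ 2 * Real.log n < n * p) :
    0 < p ∧ 9 ≤ n ∧ 10 ^ 10 ≤ n * p ∧ 128 * Real.log n ≤ n * p ∧
      0 < Real.sqrt (Real.log n / (n * p * L)) ∧
      Real.sqrt (Real.log n / (n * p * L)) ≤ 1 / S := by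
  have hn2 : (2 : ℝ) ≤ n := by exact_mod_cast hn
  have hL1 : (1 : ℝ) ≤ L := by exact_mod_cast hL
  have hlog : 1 / 2 ≤ Real.log n :=
    (by linarith [Real.log_two_gt_d9] : (1 : ℝ) / 2 ≤ Real.log 2).trans
      (Real.log_le_log (by norm_num) hn2)
  have hS0 : 0 < S := lt_of_lt_of_le (by norm_num) hS
  have hS12 : (10 : ℝ) ^ 12 ≤ S ^ 2 := by nlinarith
  have hN : 10 ^ 12 * Real.log n ≤ n * p :=
    (mul_le_mul_of_nonneg_right hS12 (by linarith)).trans h.le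
  have hp : 0 < p := pos_of_mul_pos_right (by linarith : 0 < (n : ℝ) * p) (by linarith)
  have hnp : (n : ℝ) * p ≤ n := mul_le_of_le_one_right (by linarith) hp1
  refine ⟨hp, ?_, by linarith, by linarith, Real.sqrt_pos.2 (by positivity), ?_⟩
  · have : (9 : ℝ) ≤ n := by linarith
    exact_mod_cast this
  · refine Real.sqrt_le_iff.2 ⟨by positivity, ?_⟩
    rw [div_pow, one_pow, div_le_div_iff₀ (by positivity) (by positivity)]
    have : (n : ℝ) * p ≤ n * p * L := le_mul_of_one_le_right (by positivity) hL1
    linarith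

lemma le_rate {n L : ℕ} {p : ℝ} (d : ℕ) (hp : 0 ≤ p) :
    Real.sqrt (Real.log n / (n * p * L)) ≤ rate n d L p := by
  refine Real.sqrt_le_sqrt (div_le_div_of_nonneg_right ?_ (by positivity))
  exact le_mul_of_one_le_left (Real.log_natCast_nonneg n) (by linarith [d.cast_nonneg (α := ℝ)])

/-- On a regular realisation the maximum likelihood estimate satisfies the four error bounds. -/
lemma IsRegular.exists_isMLE {c K p : ℝ} (hc : 0 < c)
    (hlam : c * n ≤ lambdaMinPerp x (covMatrix x)) (hn : 9 ≤ n) (hL : 1 ≤ L) (hp : 0 < p)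
    (hx : ∀ i, ‖x i‖ ≤ Real.sqrt ((d + 1) / n)) (hθs : θs ∈ Theta x)
    {ρ : ℝ} (hρ : ρ = Real.sqrt (Real.log n / (n * p * L))) (hρ0 : 0 < ρ)
    (hK : kappa x θs ^ 2 * rate n d L p ≤ K)
    (h : IsRegular (n * p) ρ (kappa x θs) (18432 * Real.exp 16 * kappa x θs * ρ)
      (score x θs) e y) (hN : 10 ^ 10 ≤ n * p)
    {cp : ℝ} (hcp : 10 ^ 11 ≤ cp) (hcpN : cp * Real.log n ≤ n * p)
    (hsmall₁ : 10 ^ 5 * Real.exp 16 * (kappa x θs * ρ) ≤ 1 / 2)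
    (hsmall₂ : 10 ^ 11 * (kappa x θs ^ 2 * ρ) ≤ cp / 2)
    {C₁ C₂ : ℝ} (hC₁ : C₁ = 4608 / Real.sqrt c) (hC₂ : C₂ = 10 ^ 5 * Real.exp 16) :
    ∃ θ₀, IsMLE x e y θ₀ ∧ (∀ θ, IsMLE x e y θ → θ = θ₀) ∧
      ‖alpha θ₀ - alpha θs‖ ≤ (C₂ + 2 * C₁) * (kappa x θs ^ 2 * rate n d L p) ∧
      ‖beta θ₀ - beta θs‖ ≤ C₁ * (kappa x θs * Real.sqrt (Real.log n / (p * L))) ∧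
      ‖score x θ₀ - score x θs‖ ≤ (C₂ + C₁) * (kappa x θs ^ 2 * rate n d L p) ∧
      ‖expScore x θ₀ - expScore x θs‖ / ‖expScore x θs‖ ≤
        (C₂ + C₁) * Real.exp ((C₂ + C₁) * K) * (kappa x θs ^ 2 * rate n d L p) := by
  have hn0 : 0 < n := by omega
  have hnR : (0 : ℝ) < n := by positivity
  have hLR : (0 : ℝ) < L := by positivity
  have hlog := Real.log_natCast_nonneg n
  have hC₁0 : 0 < C₁ := by rw [hC₁]; positivity
  have hC₂0 : 0 < C₂ := by rw [hC₂]; positivity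
  set κ := kappa x θs with hκdef
  set R := rate n d L p with hR
  have hκ : 1 ≤ κ := one_le_kappa hn0
  have hR0 : 0 ≤ R := Real.sqrt_nonneg _
  have hρR : ρ ≤ R := hρ ▸ le_rate d hp.le
  obtain ⟨δ, hδ, hsol, hl2, hsup⟩ := h.exists_score_solution hN hn hκ hρ0
    (score_sub_le_log_kappa hn0) hcp hcpN hsmall₁ hsmall₂
  set A := C₁ * (κ * Real.sqrt (Real.log n / (p * L))) with hA
  have hl2' : ∑ i, δ i ^ 2 ≤ c * A ^ 2 := by
    refine hl2.trans_eq ?_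
    rw [hA, hC₁, hρ]
    simp only [mul_pow, div_pow]
    rw [Real.sq_sqrt hc.le, Real.sq_sqrt (by positivity), Real.sq_sqrt (by positivity)]
    field_simp
  have hrA : Real.sqrt ((d + 1) / n) * A = C₁ * (κ * R) := by
    rw [hA, hR, rate, show ((d : ℝ) + 1) * Real.log n / (n * p * L)
      = (d + 1) / n * (Real.log n / (p * L)) by field_simp, Real.sqrt_mul (by positivity)]
    ring
  have hκR : κ * R ≤ κ ^ 2 * R := mul_le_mul_of_nonneg_right (by nlinarith) hR0
  have hκρ : κ ^ 2 * ρ ≤ κ ^ 2 * R := mul_le_mul_of_nonneg_left hρR (sq_nonneg κ)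
  obtain ⟨θ₀, h1, h2, h3, h4, h5⟩ := exists_isMLE_of_score_solution (y := y) hc hlam hn0
    (gap := n * p / 96) (by positivity) (h.gap (by positivity)) hθs hx hδ hsol
    (by positivity : 0 ≤ A) hl2' hsup
  rw [← hC₂, hrA] at h4 h5
  have h4' : ∀ i, |score x θ₀ i - score x θs i| ≤ (C₂ + C₁) * (κ ^ 2 * R) := fun i =>
    (h4 i).trans (by nlinarith)
  refine ⟨θ₀, h1, h2, ?_, h3, ?_, ?_⟩
  · exact (pi_norm_le_iff_of_nonneg (by positivity)).2 fun i => (h5 i).trans (by nlinarith)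
  · exact (pi_norm_le_iff_of_nonneg (by positivity)).2 h4'
  · refine (norm_expScore_sub_div_le hn0 h4'
      (mul_le_mul_of_nonneg_left hK (by positivity))).trans_eq (by ring)

end Rate

/-- The constant `S ^ 2` of the density condition is large enough for both smallness conditions. The
first one holds since `(κ ρ) ^ 2 = (κ ^ 2 ρ) ρ ≤ K / S ≤ 1 / (2 D) ^ 2`. -/
lemma smallness_of_density {S K D ρ κ : ℝ} (hK : 0 < K) (hD : 10 ^ 5 ≤ D)
    (hS : S = 10 ^ 6 + K * (2 * D) ^ 2) (hρ : 0 ≤ ρ) (hρS : ρ ≤ 1 / S) (hκ : 0 ≤ κ)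
    (hκρ : κ ^ 2 * ρ ≤ K) :
    D * (κ * ρ) ≤ 1 / 2 ∧ 10 ^ 11 * (κ ^ 2 * ρ) ≤ S ^ 2 / 2 := by
  have hD0 : 0 < D := lt_of_lt_of_le (by norm_num) hD
  have hS6 : 10 ^ 6 ≤ S := hS ▸ le_add_of_nonneg_right (by positivity)
  have hSK : K * (2 * D) ^ 2 ≤ S := hS ▸ le_add_of_nonneg_left (by norm_num)
  have hS0 : 0 < S := lt_of_lt_of_le (by norm_num) hS6
  constructor
  · have h1 : (κ * ρ) ^ 2 ≤ K * (1 / S) := by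
      calc (κ * ρ) ^ 2 = κ ^ 2 * ρ * ρ := by ring
        _ ≤ K * (1 / S) := mul_le_mul hκρ hρS hρ hK.le
    have h2 : (2 * D) ^ 2 * (K * (1 / S)) ≤ 1 := by
      rw [show (2 * D) ^ 2 * (K * (1 / S)) = K * (2 * D) ^ 2 / S by ring]
      exact (div_le_one hS0).2 hSK
    have h3 : (2 * D * (κ * ρ)) ^ 2 ≤ 1 := by
      rw [mul_pow]
      exact (mul_le_mul_of_nonneg_left h1 (by positivity)).trans h2
    have h4 := (sq_le_one_iff₀ (by positivity)).1 h3
    linarith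
  · have h1 : K * (4 * 10 ^ 10) ≤ S := by
      refine le_trans (mul_le_mul_of_nonneg_left ?_ hK.le) hSK
      calc (4 * 10 ^ 10 : ℝ) = (2 * 10 ^ 5) ^ 2 := by norm_num
        _ ≤ (2 * D) ^ 2 := by gcongr
    have h2 : 10 ^ 6 * S ≤ S ^ 2 := by
      rw [sq]; exact mul_le_mul_of_nonneg_right hS6 hS0.le
    linarith

/-- Whatever holds on all regular realisations holds with probability `1 - 8 n⁻⁶`. -/
lemma IsModel.one_sub_le_measure {n d L : ℕ} {x : Fin n → EuclideanSpace ℝ (Fin d)}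
    {θs : Param n d} {p : ℝ} {Ω : Type*} [MeasurableSpace Ω] {μ : Measure Ω}
    [IsProbabilityMeasure μ] {edge : Pair n → Ω → Bool} {y : Pair n → Fin L → Ω → Bool}
    (h : IsModel μ p x θs edge y) (hn : 1 ≤ n) (hL : 1 ≤ L) (hp : 0 < p)
    (hN : 128 * Real.log n ≤ n * p) (κ τ : ℝ) {T : Set Ω}
    (hT : ∀ ω, IsRegular (n * p) (Real.sqrt (Real.log n / (n * p * L))) κ τ (score x θs)
      (fun q => edge q ω) (fun q l => y q l ω) → ω ∈ T) :
    1 - 8 * ((n : ℝ) ^ 6)⁻¹ ≤ μ.real T := by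
  have h0 := h.measure_not_isRegular_le hn hL hp hN κ τ rfl
  have h1 : μ.real Set.univ ≤ μ.real (T ∪ {ω | ¬IsRegular (n * p)
      (Real.sqrt (Real.log n / (n * p * L))) κ τ (score x θs) (fun q => edge q ω)
      (fun q l => y q l ω)}) := by
    refine measureReal_mono fun ω _ => ?_
    by_cases hω : ω ∈ T
    · exact Or.inl hω
    · exact Or.inr fun h => hω (hT ω h)
  have h2 := h1.trans (measureReal_union_le _ _)
  rw [probReal_univ] at h2
  linarith

end CARE

theorem theorem1
    (c₀ c₁ c₂ c₄ c₅ C₁ K : ℝ) (hc₀ : 0 < c₀) (hc₁ : 0 < c₁) (hc₂ : 0 < c₂) (hc₄ : 0 < c₄)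
    (hc₅ : 0 < c₅) (hC₁ : 0 < C₁) (hK : 0 < K) :
    ∃ cp > (0 : ℝ), ∃ C > (0 : ℝ), ∃ C' > (0 : ℝ),
      ∀ (n d L : ℕ) (p : ℝ) (x : Fin n → EuclideanSpace ℝ (Fin d)) (θs : CARE.Param n d),
        d + 1 < n → 1 ≤ L → 0 ≤ p → p ≤ 1 →
        cp * Real.log n < n * p →
        (d + 1) * Real.log n ≤ C₁ * (n * p) →
        (L : ℝ) ≤ c₄ * (n : ℝ) ^ c₅ →
        (∀ i, ‖x i‖ ≤ Real.sqrt ((d + 1) / n)) →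
        CARE.twoInftyNorm (CARE.projXBar x) ≤ c₀ * Real.sqrt ((d + 1) / n) →
        c₂ * n ≤ CARE.lambdaMinPerp x (CARE.covMatrix x) →
        CARE.opNorm (CARE.covMatrix x) ≤ c₁ * n →
        θs ∈ CARE.Theta x →
        CARE.kappa x θs ^ 2 * CARE.rate n d L p ≤ K →
        ∀ {Ω : Type*} [MeasurableSpace Ω] (μ : MeasureTheory.Measure Ω)
          [MeasureTheory.IsProbabilityMeasure μ]
          (edge : CARE.Pair n → Ω → Bool) (y : CARE.Pair n → Fin L → Ω → Bool),
          CARE.IsModel μ p x θs edge y →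
          1 - C' * ((n : ℝ) ^ 6)⁻¹ ≤ μ.real {ω |
            (∃! θ, CARE.IsMLE x (fun q => edge q ω) (fun q l => y q l ω) θ) ∧
            ∀ θ, CARE.IsMLE x (fun q => edge q ω) (fun q l => y q l ω) θ →
              ‖CARE.alpha θ - CARE.alpha θs‖ ≤
                C * (CARE.kappa x θs ^ 2 * CARE.rate n d L p) ∧
              ‖CARE.beta θ - CARE.beta θs‖ ≤
                C * (CARE.kappa x θs * Real.sqrt (Real.log n / (p * L))) ∧
              ‖CARE.score x θ - CARE.score x θs‖ ≤
                C * (CARE.kappa x θs ^ 2 * CARE.rate n d L p) ∧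
              ‖CARE.expScore x θ - CARE.expScore x θs‖ / ‖CARE.expScore x θs‖ ≤
                C * (CARE.kappa x θs ^ 2 * CARE.rate n d L p)} := by
  obtain ⟨D₁, hD₁⟩ : ∃ D : ℝ, D = 4608 / Real.sqrt c₂ := ⟨_, rfl⟩
  obtain ⟨D₂, hD₂⟩ : ∃ D : ℝ, D = 10 ^ 5 * Real.exp 16 := ⟨_, rfl⟩
  have hD₁0 : 0 < D₁ := by rw [hD₁]; positivity
  have hD₂5 : 10 ^ 5 ≤ D₂ := by
    rw [hD₂]
    exact le_mul_of_one_le_right (by norm_num) (Real.one_le_exp (by norm_num))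
  have hD₂0 : 0 < D₂ := lt_of_lt_of_le (by norm_num) hD₂5
  -- `D₁` and `D₂` are the constants of the `ℓ²` and the sup-norm error. The choice of `S` makes the
  -- sup-norm error of the scores at most `1 / 2`, see `smallness_of_density`.
  obtain ⟨S, hS⟩ : ∃ S : ℝ, S = 10 ^ 6 + K * (2 * D₂) ^ 2 := ⟨_, rfl⟩
  have hS6 : 10 ^ 6 ≤ S := hS ▸ le_add_of_nonneg_right (by positivity)
  have hS11 : 10 ^ 11 ≤ S ^ 2 := le_trans (by norm_num) (pow_le_pow_left₀ (by norm_num) hS6 2)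
  have hE : 1 ≤ Real.exp ((D₂ + D₁) * K) := Real.one_le_exp (by positivity)
  obtain ⟨E, hEdef⟩ : ∃ E : ℝ, E = Real.exp ((D₂ + D₁) * K) := ⟨_, rfl⟩
  rw [← hEdef] at hE
  have hE0 : 0 < E := zero_lt_one.trans_le hE
  refine ⟨S ^ 2, pow_pos (lt_of_lt_of_le (by norm_num) hS6) 2, (D₂ + 2 * D₁) * E, by positivity, 8,
    by norm_num, ?_⟩
  intro n d L p x θs hdn hL _ hp1 hcpN _ _ hx _ hlam _ hθs hκK Ω _ μ _ edge y hmodel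
  obtain ⟨hp, hn9, hN, hNlog, hρ0, hρS⟩ := CARE.noiseLevel_of_density hS6 (by omega) hL hp1 hcpN
  have hκ : 1 ≤ CARE.kappa x θs := CARE.one_le_kappa (by omega)
  obtain ⟨hsmall₁, hsmall₂⟩ := CARE.smallness_of_density hK hD₂5 hS hρ0.le hρS
    (zero_le_one.trans hκ)
    ((mul_le_mul_of_nonneg_left (CARE.le_rate d hp.le) (sq_nonneg _)).trans hκK)
  refine hmodel.one_sub_le_measure (by omega) hL hp hNlog (CARE.kappa x θs)
    (18432 * Real.exp 16 * CARE.kappa x θs * Real.sqrt (Real.log n / (n * p * L)))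
    fun ω hω => ?_
  obtain ⟨θ₀, h1, h2, h3, h4, h5, h6⟩ := CARE.IsRegular.exists_isMLE hc₂ hlam hn9 hL hp hx hθs rfl
    hρ0 hκK hω hN hS11 hcpN.le (hD₂ ▸ hsmall₁) hsmall₂ hD₁ hD₂
  rw [← hEdef] at h6
  have hR : 0 ≤ CARE.kappa x θs ^ 2 * CARE.rate n d L p :=
    mul_nonneg (sq_nonneg _) (Real.sqrt_nonneg _)
  have hM : D₂ + 2 * D₁ ≤ (D₂ + 2 * D₁) * E := le_mul_of_one_le_right (by positivity) hE
  refine ⟨⟨θ₀, h1, h2⟩, fun θ hθ => ?_⟩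
  rw [h2 θ hθ]
  exact ⟨h3.trans (mul_le_mul_of_nonneg_right hM hR),
    h4.trans (mul_le_mul_of_nonneg_right (by linarith)
      (mul_nonneg (zero_le_one.trans hκ) (Real.sqrt_nonneg _))),
    h5.trans (mul_le_mul_of_nonneg_right (by linarith) hR),
    h6.trans (mul_le_mul_of_nonneg_right (mul_le_mul_of_nonneg_right (by linarith) hE0.le) hR)⟩
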